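/- Let $\mathbf F_q$ be a finite field with $q$ elements, $X$ a smooth projective geometrically connected curve over $\mathbf F_q$ with function field $K$, $\infty\in X$ a closed point, $A=\Gamma(X\setminus\{\infty\},\mathcal O_X)$, $K_\infty$ the completion of $K$ at $\infty$ and $\mathbf C_\infty$ the completion of an algebraic closure of $K_\infty$. Let $E/K$ be a finite extension, $E^{\rm sep}$ a separable closure of $E$ and $G_E=\mathrm{Gal}(E^{\rm sep}/E)$. For a field $L\supseteq \mathbf F_q$ let $L\{\tau\}$ be the twisted polynomial ring, $\tau c=c^q\tau$; write $x^{(\ell)}=x^{q^\ell}$. An Anderson $A$-module of dimension $N$ over $E$ is an $\mathbf F_q$-algebra homomorphism $\mathcal E:A\to \mathrm{Mat}_N(E\{\tau\})$, $a\mapsto\mathcal E_a$, such that for each $a\in A$ the constant coefficient $\partial\mathcal E_a$ of $\mathcal E_a$ satisfies $(\partial\mathcal E_a-a I_N)^N=0$. A Drinfeld module is an Anderson module of dimension $1$. The motive of $\mathcal E$ is $\mathbb M(\mathcal E)=\mathrm{Mat}_{1\times N}(E\{\tau\})$, on which $E$ and $\tau$ act by left multiplication and $a\in A$ acts by right multiplication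 by $\mathcal E_a$; it is a module over $A_E=E\otimes_{\mathbf F_q}A$ with a $(\mathrm{Frob}_q\otimes\mathrm{id})$-semilinear map $\tau$. Two such $\tau$-modules are isomorphic over $E$ if there is an $A_E$-linear bijection commuting with $\tau$; their tensor product is taken over $A_E$ with $\tau\otimes\tau$. Let $\varphi$ be a Drinfeld $A$-module over $E$, and let $\rho:G_E\to \mathrm{GL}_n(\overline{\mathbf F}_q)$ be a representation factoring through a finite Galois extension of $E$. Let $\mathbf F_q(\rho)$ be the field generated by the matrix entries of $\rho$, $d=[\mathbf F_q(\rho):\mathbf F_q]$, $N=nd$, and $$\mathbb M(\rho)=\bigl(E^{\rm sep}\otimes_{\mathbf F_q}\mathbf F_q(\rho)^n\bigr)^{G_E}\otimes_E A_E,$$ where $G_E$ acts diagonally and $\tau$ is induced by $\mathrm{Frob}_q\otimes\mathrm{id}$. An Artin twist of $\varphi$ by $\rho$ is an Anderson $A$-module $\mathcal E$ of dimension $N$ over $E$ with $\mathbb M(\mathcal E)\cong\mathbb M(\varphi)\otimes\mathbb M(\rho)$ over $E$. Let $\sigma:E\to\mathbf C_\infty$ be a $K$-embedding. $\mathcal E$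 is uniformizable with respect to $\sigma$ if there is an exponential series $\exp_{\mathcal E}=\sum_{k\ge0}e_k\tau^k$, with $e_k\in\mathrm{Mat}_N(\mathbf C_\infty)$, $e_0=I_N$ and $\exp_{\mathcal E}\,\partial\mathcal E_a=\mathcal E_a\exp_{\mathcal E}$ for all $a\in A$ (coefficients viewed in $\mathbf C_\infty$ via $\sigma$), which converges at every point of $\mathbf C_\infty^N$ and defines a surjective map $\mathbf C_\infty^N\to\mathbf C_\infty^N$. Then: 1. An Artin twist of $\varphi$ by $\rho$ exists. Every Artin twist $\mathcal E$ of $\varphi$ by $\rho$ is isomorphic to $\varphi^{\oplus N}$ over $E^{\rm sep}$ (there is $U\in\mathrm{GL}_N(E^{\rm sep}\{\tau\})$ with $U\mathcal E_a=\varphi_a^{\oplus N}U$ for all $a\in A$), and is uniformizable with respect to every $K$-embedding $\sigma:E\to\mathbf C_\infty$. 2. Fix an $\mathbf F_q$-embedding $\mathbf F_q(\rho)\to E^{\rm sep}$ and an $\mathbf F_q$-basis $\alpha=(\alpha_1,\dots,\alpha_d)^T$ of $\mathbf F_q(\rho)$. There exists a fundamental solution, i.e. a matrix $u\in\mathrm{Mat}_{n\times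 d}(E^{\rm sep})$ with entries linearly independent over $\mathbf F_q$ such that $\rho^{(\ell)}(g)\,g(u)\,\alpha^{(\ell)}=u\,\alpha^{(\ell)}$ for all $g\in G_E$ and $0\le\ell<d$. For every fundamental solution $u$, with entries arranged in a column of length $N$, the matrix $M(u)=[u,u^{(1)},\dots,u^{(N-1)}]$ is invertible, and with $P=(M(u)^T)^{-1}$ there is an Artin twist $\mathcal E$ of $\varphi$ by $\rho$ such that $\mathcal E_a=P^{-1}\varphi_a^{\oplus N}P$ for all $a\in A$. -/

import Mathlib

open scoped TensorProduct IntermediateField NNReal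

/-- `K` is an algebraic function field of one variable with full constant field `F`, i.e. the
function field of a smooth projective geometrically irreducible curve when `F` is finite. -/
class IsCurveFunctionField (F K : Type*) [Field F] [Field K] [Algebra F K] : Prop where
  exists_transcendental : ∃ t : K, Transcendental F t ∧ FiniteDimensional F⟮t⟯ K
  mem_range_of_isAlgebraic : ∀ x : K, IsAlgebraic F x → x ∈ (algebraMap F K).range

/-- A place of `K / F`, i.e. a closed point of the smooth projective model of `K`: a proper valuation
ring of `K` containing the constants (discrete, as shown below). -/
structure FunctionFieldPlace (F K : Type*) [Field F] [Field K] [Algebra F K] where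
  ring : ValuationSubring K
  algebraMap_mem : ∀ c : F, algebraMap F K c ∈ ring
  ne_top : ring ≠ ⊤

section
variable {F K : Type*} [Field F] [Field K] [Algebra F K]

open IntermediateField in
theorem IsCurveFunctionField.finiteDimensional_adjoin [IsCurveFunctionField F K] {y : K}
    (hy : Transcendental F y) : FiniteDimensional F⟮y⟯ K := by
  obtain ⟨x, hx, hfin⟩ := IsCurveFunctionField.exists_transcendental (F := F) (K := K)
  have hxy : IsAlgebraic F⟮y⟯ x :=
    isAlgebraic_adjoin_iff.mpr (.adjoin_singleton hx hy
      (isAlgebraic_adjoin_iff.mp (Algebra.IsAlgebraic.isAlgebraic y)))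
  let Fyx := restrictScalars F F⟮y⟯⟮x⟯
  let Fxy := restrictScalars F F⟮x⟯⟮y⟯
  let : Algebra F⟮y⟯ Fyx := F⟮y⟯⟮x⟯.algebra
  let : Module F⟮y⟯ Fyx := Algebra.toModule
  let : SMul F⟮y⟯ Fyx := Algebra.toSMul
  let : Algebra F⟮x⟯ Fxy := F⟮x⟯⟮y⟯.algebra
  let : Module F⟮x⟯ Fxy := Algebra.toModule
  let : SMul F⟮x⟯ Fxy := Algebra.toSMul
  have : FiniteDimensional F⟮y⟯ Fyx :=
    adjoin.finiteDimensional (isAlgebraic_iff_isIntegral.mp hxy)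
  have : FiniteDimensional Fyx K := by
    unfold Fyx
    rw [adjoin_simple_comm]
    have : IsScalarTower F⟮x⟯ Fxy K := isScalarTower_mid' F⟮x⟯⟮y⟯
    exact .right F⟮x⟯ Fxy K
  have : IsScalarTower F⟮y⟯ Fyx K := isScalarTower_mid' F⟮y⟯⟮x⟯
  exact .trans F⟮y⟯ Fyx K

namespace FunctionFieldPlace

theorem transcendental_of_lt_one (P : FunctionFieldPlace F K) {x : K} (hx0 : x ≠ 0)
    (hx : P.ring.valuation x < 1) : Transcendental F x := by
  intro halg
  have h1 : IsAlgebraic F x⁻¹ := halg.inv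
  have h2 : IsIntegral F x⁻¹ := h1.isIntegral
  let f : F →+* P.ring := (algebraMap F K).codRestrict P.ring.toSubring P.algebraMap_mem
  have h3 : IsIntegral P.ring x⁻¹ := by
    obtain ⟨p, hp, hp0⟩ := h2
    refine ⟨p.map f, hp.map f, ?_⟩
    rw [Polynomial.eval₂_map]
    exact hp0
  obtain ⟨y, hy⟩ := IsIntegrallyClosed.isIntegral_iff.mp h3
  have h4 : P.ring.valuation x⁻¹ ≤ 1 := by
    rw [P.ring.valuation_le_one_iff, ← hy]; exact y.2
  rw [map_inv₀] at h4
  have h5 := (one_lt_inv₀ (a := P.ring.valuation x)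
    (zero_lt_iff.mpr ((Valuation.ne_zero_iff _).mpr hx0))).mpr hx
  exact absurd h4 (not_le.mpr h5)


theorem valuation_aeval_eq (P : FunctionFieldPlace F K) {x : K} (hx : Transcendental F x)
    (hx1 : P.ring.valuation x < 1) (p : Polynomial F) (hp : p ≠ 0) :
    ∃ k : ℕ, P.ring.valuation (Polynomial.aeval x p) = P.ring.valuation x ^ k := by
  have hc : ∀ c : F, c ≠ 0 → P.ring.valuation (algebraMap F K c) = 1 := by
    intro c hc
    apply le_antisymm ((P.ring.valuation_le_one_iff _).mpr (P.algebraMap_mem c))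
    have h := (P.ring.valuation_le_one_iff _).mpr (P.algebraMap_mem c⁻¹)
    rw [map_inv₀, map_inv₀] at h
    have h0 : P.ring.valuation (algebraMap F K c) ≠ 0 := by
      simpa using hc
    exact (inv_le_one₀ (zero_lt_iff.mpr h0)).mp h
  have hle : ∀ r : Polynomial F, P.ring.valuation (Polynomial.aeval x r) ≤ 1 := by
    intro r
    induction r using Polynomial.induction_on' with
    | add p q hp hq =>
      rw [map_add]
      exact (P.ring.valuation.map_add _ _).trans (max_le hp hq)
    | monomial n c =>
      rw [Polynomial.aeval_monomial, map_mul, map_pow]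
      exact mul_le_one' ((P.ring.valuation_le_one_iff _).mpr (P.algebraMap_mem c))
        (pow_le_one' hx1.le n)
  obtain ⟨q, hq, hq0⟩ := Polynomial.exists_eq_pow_rootMultiplicity_mul_and_not_dvd p hp 0
  refine ⟨p.rootMultiplicity 0, ?_⟩
  have hcoeff : q.coeff 0 ≠ 0 := by
    intro h
    apply hq0
    rw [Polynomial.C_0, sub_zero]
    exact Polynomial.X_dvd_iff.mpr h
  have h1 : P.ring.valuation (Polynomial.aeval x q) = 1 := by
    have hs : Polynomial.aeval x q
        = algebraMap F K (q.coeff 0) + x * Polynomial.aeval x q.divX := by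
      have h2 := congrArg (Polynomial.aeval x) (Polynomial.divX_mul_X_add q)
      rw [map_add, map_mul, Polynomial.aeval_X, Polynomial.aeval_C] at h2
      rw [← h2]
      ring
    rw [hs, Valuation.map_add_eq_of_lt_left, hc _ hcoeff]
    rw [hc _ hcoeff, map_mul]
    exact mul_lt_one_of_lt_of_le hx1 (hle _)
  conv_lhs => rw [hq]
  simp [h1]

theorem valuation_adjoin_eq (P : FunctionFieldPlace F K) {x : K} (hx : Transcendental F x)
    (hx1 : P.ring.valuation x < 1) (c : F⟮x⟯) (hc : c ≠ 0) :
    ∃ k : ℤ, P.ring.valuation (c : K) = P.ring.valuation x ^ k := by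
  obtain ⟨r, s, hrs⟩ := (IntermediateField.mem_adjoin_simple_iff F (c : K)).mp c.2
  have hr : r ≠ 0 := by rintro rfl; apply hc; ext; simpa using hrs
  have hs : s ≠ 0 := by rintro rfl; apply hc; ext; simpa using hrs
  obtain ⟨k, hk⟩ := P.valuation_aeval_eq hx hx1 r hr
  obtain ⟨l, hl⟩ := P.valuation_aeval_eq hx hx1 s hs
  refine ⟨k - l, ?_⟩
  have hx0 : P.ring.valuation x ≠ 0 := by
    rw [Valuation.ne_zero_iff]
    rintro rfl
    exact hx isAlgebraic_zero
  rw [hrs, map_div₀, hk, hl, zpow_sub₀ hx0, zpow_natCast, zpow_natCast]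

theorem linearIndependent_chain (P : FunctionFieldPlace F K) {x : K} (hx : Transcendental F x)
    (a : ℕ → K) (ha : ∀ i j, i < j → P.ring.valuation (a i) < P.ring.valuation (a j))
    (hxa : x = a 0) (han : ∀ i, P.ring.valuation (a i) < 1) (n : ℕ) :
    LinearIndependent F⟮x⟯ (fun i : Fin n => a i) := by
  classical
  have hx1 : P.ring.valuation x < 1 := hxa ▸ han 0
  have hx0 : 0 < P.ring.valuation x := by
    rw [zero_lt_iff, Valuation.ne_zero_iff]
    rintro rfl
    exact hx isAlgebraic_zero
  have hxle : ∀ i, P.ring.valuation x ≤ P.ring.valuation (a i) := by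
    intro i
    rcases Nat.eq_zero_or_pos i with rfl | hi
    · rw [hxa]
    · rw [hxa]; exact (ha 0 i hi).le
  have hanti : ∀ k l : ℤ, k < l →
      P.ring.valuation x ^ l ≤ P.ring.valuation x ^ k * P.ring.valuation x := by
    intro k l hkl
    rw [← zpow_add_one₀ hx0.ne']
    exact zpow_le_zpow_right_of_le_one₀ hx0 hx1.le (by omega)
  have hne : ∀ i j : ℕ, i < j → ∀ k l : ℤ,
      P.ring.valuation x ^ k * P.ring.valuation (a i)
        ≠ P.ring.valuation x ^ l * P.ring.valuation (a j) := by
    intro i j hij k l h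
    have hk0 : 0 < P.ring.valuation x ^ k := zpow_pos hx0 k
    have hl0 : 0 < P.ring.valuation x ^ l := zpow_pos hx0 l
    have hj0 : 0 < P.ring.valuation (a j) := hx0.trans_le (hxle j)
    rcases lt_trichotomy k l with hkl | rfl | hkl
    · have h1 : P.ring.valuation x ^ l * P.ring.valuation (a j)
          < P.ring.valuation x ^ k * P.ring.valuation (a i) := by
        calc P.ring.valuation x ^ l * P.ring.valuation (a j)
            < P.ring.valuation x ^ l * 1 := by
              exact (mul_lt_mul_iff_right₀ hl0).mpr (han j)
          _ = P.ring.valuation x ^ l := mul_one _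
          _ ≤ P.ring.valuation x ^ k * P.ring.valuation x := hanti k l hkl
          _ ≤ P.ring.valuation x ^ k * P.ring.valuation (a i) := by gcongr; exact hxle i
      exact h1.ne h.symm
    · exact ((mul_lt_mul_iff_right₀ hk0).mpr (ha i j hij)).ne h
    · have h1 : P.ring.valuation x ^ k * P.ring.valuation (a i)
          < P.ring.valuation x ^ l * P.ring.valuation (a j) := by
        calc P.ring.valuation x ^ k * P.ring.valuation (a i)
            ≤ P.ring.valuation x ^ l * P.ring.valuation x * P.ring.valuation (a i) := by
              gcongr; exact hanti l k hkl
          _ ≤ P.ring.valuation x ^ l * 1 * P.ring.valuation (a i) := by gcongr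
          _ < P.ring.valuation x ^ l * P.ring.valuation (a j) := by
              rw [mul_one]; exact (mul_lt_mul_iff_right₀ hl0).mpr (ha i j hij)
      exact h1.ne h
  rw [Fintype.linearIndependent_iff]
  intro g hg
  by_contra hcon
  push Not at hcon
  let S : Finset (Fin n) := Finset.univ.filter fun i => g i ≠ 0
  obtain ⟨i₁, hi₁⟩ := hcon
  obtain ⟨i₀, hi₀, hmax⟩ := S.exists_max_image
    (fun i => P.ring.valuation (g i • a i)) ⟨i₁, by simp [S, hi₁]⟩
  have hval : ∀ i : Fin n, g i ≠ 0 → ∃ k : ℤ,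
      P.ring.valuation (g i • a i) = P.ring.valuation x ^ k * P.ring.valuation (a i) := by
    intro i hi
    obtain ⟨k, hk⟩ := P.valuation_adjoin_eq hx hx1 (g i) hi
    exact ⟨k, by rw [IntermediateField.smul_def, smul_eq_mul, map_mul, hk]⟩
  have hg0 : g i₀ ≠ 0 := by simpa [S] using hi₀
  obtain ⟨k, hk⟩ := hval i₀ hg0
  have hpos : 0 < P.ring.valuation (g i₀ • a i₀) := by
    rw [hk]; exact mul_pos (zpow_pos hx0 k) (hx0.trans_le (hxle _))
  have hlt : ∀ i ∈ Finset.univ.erase i₀,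
      P.ring.valuation (g i • a i) < P.ring.valuation (g i₀ • a i₀) := by
    intro i hi
    have hii : i ≠ i₀ := Finset.ne_of_mem_erase hi
    by_cases hgi : g i = 0
    · simpa [hgi] using hpos
    · refine lt_of_le_of_ne (hmax i (by simp [S, hgi])) ?_
      obtain ⟨l, hl⟩ := hval i hgi
      rw [hk, hl]
      rcases lt_or_gt_of_ne (fun h => hii (Fin.ext h) : (i : ℕ) ≠ i₀) with h | h
      · exact hne _ _ h _ _
      · exact (hne _ _ h _ _).symm
  have hsum := Finset.add_sum_erase Finset.univ (fun i => g i • a i) (Finset.mem_univ i₀)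
  rw [hg] at hsum
  have h2 := P.ring.valuation.map_sum_lt hpos.ne' hlt
  have h3 : g i₀ • a i₀ = - ∑ i ∈ Finset.univ.erase i₀, g i • a i := eq_neg_of_add_eq_zero_left hsum
  rw [h3, Valuation.map_neg] at h2
  exact lt_irrefl _ h2

instance [IsCurveFunctionField F K] (P : FunctionFieldPlace F K) :
    IsDiscreteValuationRing P.ring := by
  have hnf : ¬ IsField P.ring := by
    intro h
    apply P.ne_top
    rw [eq_top_iff]
    intro y _
    rcases P.ring.mem_or_inv_mem y with hy | hy
    · exact hy
    · by_cases hy0 : y = 0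
      · rw [hy0]; exact P.ring.zero_mem
      · obtain ⟨z, hz⟩ := h.mul_inv_cancel (a := (⟨y⁻¹, hy⟩ : P.ring))
          (by intro h0; exact inv_ne_zero hy0 (congrArg Subtype.val h0))
        have hz' : y⁻¹ * (z : K) = 1 := congrArg Subtype.val hz
        have : y = z := by
          rw [inv_mul_eq_one₀ hy0] at hz'; exact hz'
        rw [this]; exact z.2
  have hwf : WfDvdMonoid P.ring := by
    refine ⟨?_⟩
    rw [wellFounded_iff_isEmpty_descending_chain]
    refine ⟨fun ⟨b, hb⟩ => ?_⟩
    have hb0 : ∀ i, b (i + 1) ≠ 0 := fun i => (hb i).1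
    have hlt : ∀ i, P.ring.valuation (b (i + 2) : K) > P.ring.valuation (b (i + 1) : K) := by
      intro i
      obtain ⟨_, c, hc, hbc⟩ := hb (i + 1)
      rw [hbc, MulMemClass.coe_mul, map_mul]
      have hc1 : P.ring.valuation (c : K) < 1 := by
        refine lt_of_le_of_ne ((P.ring.valuation_le_one_iff _).mpr c.2) fun h => hc ?_
        exact (P.ring.valuation_eq_one_iff c).mpr h
      have h0 : 0 < P.ring.valuation (b (i + 2) : K) := by
        rw [zero_lt_iff, Valuation.ne_zero_iff]
        intro h; exact hb0 (i + 1) (Subtype.ext h)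
      calc _ < P.ring.valuation (b (i + 2) : K) * 1 := (mul_lt_mul_iff_right₀ h0).mpr hc1
        _ = _ := mul_one _
    let a : ℕ → K := fun i => (b (i + 1) : K)
    have hmono : StrictMono fun i => P.ring.valuation (a i) := strictMono_nat_of_lt_succ hlt
    have ha1 : ∀ i, P.ring.valuation (a i) < 1 := fun i =>
      (hlt i).trans_le ((P.ring.valuation_le_one_iff _).mpr (b (i + 2)).2)
    have ha0 : a 0 ≠ 0 := fun h => hb0 0 (Subtype.ext h)
    have htr := P.transcendental_of_lt_one ha0 (ha1 0)
    have hfin := IsCurveFunctionField.finiteDimensional_adjoin htr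
    have hli := P.linearIndependent_chain htr a (fun i j h => hmono h) rfl ha1
      (Module.finrank F⟮a 0⟯ K + 1)
    have := hli.fintype_card_le_finrank
    simp at this
  have hpir : IsPrincipalIdealRing P.ring := ((IsBezout.TFAE (R := P.ring)).out 3 1).mp hwf
  exact { not_a_field' := fun h => hnf (IsLocalRing.isField_iff_maximalIdeal_eq.mpr h) }

end FunctionFieldPlace
end


noncomputable section

namespace FunctionFieldPlace

variable {F K : Type*} [Field F] [Field K] [Algebra F K]

/-- The ring `A = Γ(X ∖ P, 𝒪_X)`: the functions which are regular at all places other than `P`. -/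
def regularOutside (P : FunctionFieldPlace F K) : Subalgebra F K where
  carrier := {x | ∀ Q : FunctionFieldPlace F K, Q ≠ P → x ∈ Q.ring}
  mul_mem' hx hy Q hQ := Q.ring.mul_mem _ _ (hx Q hQ) (hy Q hQ)
  add_mem' hx hy Q hQ := Q.ring.add_mem _ _ (hx Q hQ) (hy Q hQ)
  algebraMap_mem' c Q _ := Q.algebraMap_mem c

variable [IsCurveFunctionField F K] (P : FunctionFieldPlace F K)

/-- The base of the normalised absolute value at `P`: the cardinality of the residue field. (For the
finite constant fields considered here this is at least `2`, and the maximum is idle.) -/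
def normBase : ℝ≥0 := max 2 (Nat.card (IsLocalRing.ResidueField P.ring))

theorem one_lt_normBase : 1 < P.normBase := lt_of_lt_of_le one_lt_two (le_max_left _ _)

/-- The absolute value `x ↦ |κ(P)| ^ (-ord_P x)` of `K` at the place `P`. -/
def absValue : AbsoluteValue K ℝ :=
  (IsDiscreteValuationRing.maximalIdeal P.ring).adicAbv (K := K) P.one_lt_normBase

/-- `K_∞`, the completion of `K` at the place. -/
abbrev Completion : Type _ := P.absValue.Completion

instance : IsUltrametricDist (WithAbs P.absValue) :=
  IsUltrametricDist.isUltrametricDist_of_forall_norm_add_le_max_norm fun x y =>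
    (IsDiscreteValuationRing.maximalIdeal P.ring).isNonarchimedean_adicAbv
      P.one_lt_normBase (K := K) x.ofAbs y.ofAbs

instance : IsUltrametricDist P.Completion :=
  IsUltrametricDist.isUltrametricDist_of_forall_norm_add_le_max_norm fun x y => by
    induction x, y using UniformSpace.Completion.induction_on₂ with
    | hp => exact isClosed_le (by fun_prop) (by fun_prop)
    | ih x y =>
      rw [← UniformSpace.Completion.coe_add]
      simp only [UniformSpace.Completion.norm_coe]
      exact IsUltrametricDist.norm_add_le_max x y

instance : NontriviallyNormedField P.Completion where
  non_trivial := by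
    obtain ⟨x, hx⟩ := (IsDiscreteValuationRing.maximalIdeal P.ring).valuation_exists_uniformizer K
    refine ⟨((WithAbs.toAbs P.absValue x⁻¹ : WithAbs P.absValue) : P.Completion), ?_⟩
    rw [UniformSpace.Completion.norm_coe]
    change 1 < P.absValue x⁻¹
    rw [map_inv₀]
    have hx0 : x ≠ 0 := by
      rintro rfl
      rw [map_zero] at hx
      exact WithZero.exp_ne_zero hx.symm
    refine (one_lt_inv₀ (P.absValue.pos hx0)).mpr ?_
    change ((WithZeroMulInt.toNNReal (ne_zero_of_lt P.one_lt_normBase)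
      ((IsDiscreteValuationRing.maximalIdeal P.ring).valuation K x) : ℝ≥0) : ℝ) < 1
    rw [← NNReal.coe_one, NNReal.coe_lt_coe]
    refine (WithZeroMulInt.toNNReal_lt_one_iff P.one_lt_normBase).mpr ?_
    rw [hx]
    decide

/-- An algebraic closure of `K_∞`, with the unique extension of the absolute value. -/
abbrev AlgClosure : Type _ := AlgebraicClosure P.Completion

instance : NormedField P.AlgClosure := spectralNorm.normedField P.Completion P.AlgClosure

/-- `ℂ_∞`, the completion of an algebraic closure of `K_∞`. -/
abbrev CInfty : Type _ := UniformSpace.Completion P.AlgClosure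

/-- The canonical embedding `K → ℂ_∞`. -/
def toCInfty : K →+* P.CInfty :=
  (UniformSpace.Completion.coeRingHom : P.AlgClosure →+* P.CInfty).comp
    ((algebraMap P.Completion P.AlgClosure).comp
      ((UniformSpace.Completion.coeRingHom : WithAbs P.absValue →+* P.Completion).comp
        (WithAbs.equiv P.absValue).symm.toRingHom))

end FunctionFieldPlace
end


noncomputable section

/-- A copy of `R` on which the monoid `ℕ` acts by powers of the `q`-Frobenius `x ↦ x ^ q`, `q = #F`. -/
def FrobeniusTwisted (_F R : Type*) : Type _ := R

namespace FrobeniusTwisted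

variable (F R : Type*) [Field F] [Fintype F] [CommRing R] [Algebra F R]

instance : CommRing (FrobeniusTwisted F R) := inferInstanceAs (CommRing R)

instance : Algebra F (FrobeniusTwisted F R) := inferInstanceAs (Algebra F R)

instance : MulSemiringAction (Multiplicative ℕ) (FrobeniusTwisted F R) where
  smul k x := (x ^ Fintype.card F ^ k.toAdd : FrobeniusTwisted F R)
  one_smul x := by change x ^ Fintype.card F ^ 0 = x; simp
  mul_smul k l x := by
    change x ^ Fintype.card F ^ (k.toAdd + l.toAdd)
      = (x ^ Fintype.card F ^ l.toAdd) ^ Fintype.card F ^ k.toAdd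
    rw [← pow_mul, ← pow_add, add_comm]
  smul_zero k := zero_pow (pow_ne_zero _ Fintype.card_ne_zero)
  smul_one k := one_pow _
  smul_add k x y := by
    change (x + y) ^ Fintype.card F ^ k.toAdd
      = x ^ Fintype.card F ^ k.toAdd + y ^ Fintype.card F ^ k.toAdd
    induction k.toAdd generalizing x y with
    | zero => simp
    | succ m ih =>
      have h := map_add (FiniteField.frobeniusAlgHom F (FrobeniusTwisted F R))
      simp only [FiniteField.frobeniusAlgHom_apply] at h
      rw [pow_succ', pow_mul, pow_mul, pow_mul, h, ih]
  smul_mul k x y := mul_pow x y _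

variable {F R} in
theorem smul_def (k : Multiplicative ℕ) (x : FrobeniusTwisted F R) :
    k • x = x ^ Fintype.card F ^ k.toAdd := rfl

instance : SMulCommClass (Multiplicative ℕ) F (FrobeniusTwisted F R) where
  smul_comm k c x := by
    rw [smul_def, smul_def, Algebra.smul_def, Algebra.smul_def, mul_pow, ← map_pow,
      FiniteField.pow_card_pow]

end FrobeniusTwisted

/-- The twisted polynomial ring `R{τ}`, with `τ r = r ^ q τ`; it is the ring of `F`-linear
endomorphisms of the additive group over `R` (for a field `R`), `τ` being the `q`-Frobenius. -/
abbrev TwistedPolynomial (F R : Type*) [Field F] [Fintype F] [CommRing R] [Algebra F R] : Type _ :=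
  SkewPolynomial (FrobeniusTwisted F R)

namespace TwistedPolynomial

variable {F R S : Type*} [Field F] [Fintype F] [CommRing R] [Algebra F R] [CommRing S] [Algebra F S]

variable (F) in
/-- The constants `R → R{τ}`. -/
def C : R →+* TwistedPolynomial F R := SkewPolynomial.CRingHom (R := FrobeniusTwisted F R)

variable (F R) in
/-- The variable `τ`. -/
def τ : TwistedPolynomial F R := SkewPolynomial.X (R := FrobeniusTwisted F R)

/-- The coefficient `r_k` of `∑ r_k τ ^ k`. -/
def coeff (f : TwistedPolynomial F R) (k : ℕ) : R := SkewPolynomial.coeff f k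

theorem τ_mul_C (r : R) : τ F R * C F r = C F (r ^ Fintype.card F) * τ F R := by
  have h := SkewPolynomial.X_mul_monomial (R := FrobeniusTwisted F R) 0 r
  have h2 := SkewPolynomial.C_mul_X_eq_monomial (R := FrobeniusTwisted F R)
    (a := (r ^ Fintype.card F : R))
  refine h.trans (Eq.trans ?_ h2.symm)
  congr 1
  change (r ^ Fintype.card F ^ 1 : R) = _
  rw [pow_one]

theorem C_pow_mul_τ_pow (r : R) (k : ℕ) :
    C F (r ^ Fintype.card F ^ k) * τ F R ^ k = τ F R ^ k * C F r := by
  induction k generalizing r with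
  | zero => simp
  | succ m ih =>
    rw [pow_succ' (Fintype.card F), pow_mul, pow_succ (τ F R), ← mul_assoc, ih, mul_assoc,
      ← τ_mul_C, mul_assoc]

/-- The ring homomorphism `R{τ} → S{τ}` applying `g : R → S` to the coefficients. -/
def map (g : R →ₐ[F] S) : TwistedPolynomial F R →+* TwistedPolynomial F S :=
  SkewMonoidAlgebra.liftNCRingHom (k := FrobeniusTwisted F R)
    ((C F).comp g.toRingHom) (powersHom _ (τ F S)) (by
      intro r k
      exact (congrArg (fun s => C F s * τ F S ^ k.toAdd)
        (map_pow g (r : R) (Fintype.card F ^ k.toAdd))).trans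
          (C_pow_mul_τ_pow (g r) k.toAdd))


/-- `map g` applies `g` to every coefficient. -/
theorem coeff_map (g : R →ₐ[F] S) (f : TwistedPolynomial F R) (k : ℕ) :
    (map g f).coeff k = g (f.coeff k) := by
  have ha : ∀ p q : TwistedPolynomial F R, ∀ k, (p+q).coeff k = p.coeff k + q.coeff k :=
    fun p q k => SkewPolynomial.coeff_add p q k
  have ha' : ∀ p q : TwistedPolynomial F S, ∀ k, (p+q).coeff k = p.coeff k + q.coeff k :=
    fun p q k => SkewPolynomial.coeff_add p q k
  induction f using SkewPolynomial.induction with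
  | h0 =>
    rw [map_zero]; exact (map_zero g).symm
  | ha n r q hn hr ih =>
    rw [map_add, ha, ha', ih, map_add]
    congr 1
    have : map g (SkewPolynomial.monomial n r : TwistedPolynomial F R) = SkewPolynomial.monomial (R := FrobeniusTwisted F S) n (g r) := by
      have e1 := (SkewPolynomial.C_mul_X_pow_eq_monomial (R := FrobeniusTwisted F S) (a := g r) (n := n))
      refine (SkewMonoidAlgebra.liftNC_single _ _ _ _).trans (Eq.trans rfl e1)
    rw [this]
    have h1 := SkewPolynomial.coeff_monomial (n := n) (m := k) (R := FrobeniusTwisted F S) (a := g r)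
    have h2 := SkewPolynomial.coeff_monomial (n := n) (m := k) (R := FrobeniusTwisted F R) (a := r)
    refine h1.trans (Eq.trans (b := g (if n = k then r else 0 : FrobeniusTwisted F R)) ?_ (congrArg g h2).symm)
    by_cases h : n = k
    · exact (if_pos h).trans (congrArg g (if_pos h)).symm
    · exact (if_neg h).trans ((map_zero g).symm.trans (congrArg g (if_neg h)).symm)

end TwistedPolynomial
end


noncomputable section

section Motives
variable (F A R : Type*) [Field F] [Fintype F] [CommRing A] [Algebra F A] [CommRing R] [Algebra F R]

/-- The endomorphism `Frob_q ⊗ id` of `R ⊗ A`. -/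
def frobeniusTensor : R ⊗[F] A →+* R ⊗[F] A :=
  (Algebra.TensorProduct.map (FiniteField.frobeniusAlgHom F R) (AlgHom.id F A)).toRingHom

/-- A module over `R ⊗ A` with a `Frob_q ⊗ id`-semilinear endomorphism `τ`. -/
structure TauModule where
  carrier : Type*
  [addCommGroup : AddCommGroup carrier]
  [module : Module (R ⊗[F] A) carrier]
  τ : carrier →ₛₗ[frobeniusTensor F A R] carrier

attribute [instance] TauModule.addCommGroup TauModule.module

namespace TauModule
variable {F A R}

/-- The tensor product over `R ⊗ A`, with `τ ⊗ τ`. -/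
def tensor (M M' : TauModule F A R) : TauModule F A R where
  carrier := M.carrier ⊗[R ⊗[F] A] M'.carrier
  τ := TensorProduct.map M.τ M'.τ

/-- Isomorphism of `τ`-modules: an `R ⊗ A`-linear bijection commuting with `τ`. -/
def IsIso (M M' : TauModule F A R) : Prop :=
  ∃ f : M.carrier ≃ₗ[R ⊗[F] A] M'.carrier, ∀ m, f (M.τ m) = M'.τ (f m)

/-- The base change `V ⊗_R (R ⊗ A)` of an `R`-module `V` with a `Frob_q`-semilinear endomorphism. -/
def ofTauSpace {V : Type*} [AddCommGroup V] [Module R V]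
    (τV : V →ₛₗ[(FiniteField.frobeniusAlgHom F R : R →+* R)] V) : TauModule F A R where
  carrier := (R ⊗[F] A) ⊗[R] V
  τ :=
    let σ : R ⊗[F] A →ₛₗ[(FiniteField.frobeniusAlgHom F R : R →+* R)] R ⊗[F] A :=
      { toFun := frobeniusTensor F A R
        map_add' := map_add _
        map_smul' := fun r x => by
          induction x with
          | zero => simp
          | add x y hx hy => rw [smul_add, map_add, hx, hy, map_add, smul_add]
          | tmul s a =>
            simp [frobeniusTensor, TensorProduct.smul_tmul', mul_pow] }
    { toFun := TensorProduct.map σ τV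
      map_add' := map_add _
      map_smul' := fun c x => by
        induction x with
        | zero => simp
        | add x y hx hy => rw [smul_add, map_add, hx, hy, map_add, smul_add]
        | tmul b v =>
          rw [TensorProduct.smul_tmul', TensorProduct.map_tmul, TensorProduct.map_tmul,
            TensorProduct.smul_tmul', smul_eq_mul, smul_eq_mul]
          congr 1
          exact map_mul (frobeniusTensor F A R) c b }

end TauModule

variable [Algebra A R]

/-- An Anderson `A`-module of dimension `N` over `R`: an action of `A` on the `F`-vector space scheme
`𝔾_a ^ N` (whose endomorphisms are the matrices over `R{τ}`) such that every `a : A` acts on the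
Lie algebra as the image of `a` in `R` plus a nilpotent endomorphism. -/
structure AndersonModule (N : ℕ) where
  toAlgHom : A →ₐ[F] Matrix (Fin N) (Fin N) (TwistedPolynomial F R)
  lie_nilpotent : ∀ a : A,
    ((toAlgHom a).map (fun f => f.coeff 0) - Matrix.scalar (Fin N) (algebraMap A R a)) ^ N = 0

/-- A Drinfeld module is an Anderson module of dimension one. -/
abbrev DrinfeldModule := AndersonModule F A R 1

namespace AndersonModule
variable {F A R} {N : ℕ}

/-- The underlying group of the motive: `Hom(𝔾_a ^ N, 𝔾_a)`, as row vectors over `R{τ}`. -/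
def MotiveCarrier (_E : AndersonModule F A R N) : Type _ := Fin N → TwistedPolynomial F R

variable (E : AndersonModule F A R N)

instance : AddCommGroup E.MotiveCarrier :=
  inferInstanceAs (AddCommGroup (Fin N → TwistedPolynomial F R))

/-- `r : R` acts on the motive by composition with the homothety on the target. -/
def constAction : R →ₐ[F] Module.End F (Fin N → TwistedPolynomial F R) where
  toFun r :=
    { toFun := fun m i => TwistedPolynomial.C F r * m i
      map_add' := fun m m' => by ext1 i; simp [mul_add]
      map_smul' := fun c m => by ext1 i; simp }
  map_one' := by refine LinearMap.ext fun m => funext fun i => ?_; simp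
  map_mul' r s := by refine LinearMap.ext fun m => funext fun i => ?_; simp [mul_assoc]
  map_zero' := by refine LinearMap.ext fun m => funext fun i => ?_; simp
  map_add' r s := by refine LinearMap.ext fun m => funext fun i => ?_; simp [add_mul]
  commutes' c := by
    refine LinearMap.ext fun m => funext fun i => ?_
    change TwistedPolynomial.C F (algebraMap F R c) * m i = c • m i
    rw [Algebra.smul_def]
    rfl

/-- `a : A` acts on the motive by composition with the action of `a` on the source. -/
def operatorAction : A →ₐ[F] Module.End F (Fin N → TwistedPolynomial F R) where
  toFun a :=
    { toFun := fun m => Matrix.vecMul m (E.toAlgHom a)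
      map_add' := fun m m' => Matrix.add_vecMul _ _ _
      map_smul' := fun c m => Matrix.smul_vecMul _ _ _ }
  map_one' := by refine LinearMap.ext fun m => ?_; simp
  map_mul' a b := by
    refine LinearMap.ext fun m => ?_
    change Matrix.vecMul m (E.toAlgHom (a * b))
      = Matrix.vecMul (Matrix.vecMul m (E.toAlgHom b)) (E.toAlgHom a)
    rw [Matrix.vecMul_vecMul, ← map_mul, mul_comm]
  map_zero' := by refine LinearMap.ext fun m => ?_; simp
  map_add' a b := by refine LinearMap.ext fun m => ?_; simp [Matrix.vecMul_add]
  commutes' c := by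
    refine LinearMap.ext fun m => ?_
    change Matrix.vecMul m (E.toAlgHom (algebraMap F A c)) = c • m
    rw [AlgHom.commutes, Algebra.algebraMap_eq_smul_one, Matrix.vecMul_smul, Matrix.vecMul_one]

theorem commute_constAction (r : R) (a : A) : Commute (constAction r) (E.operatorAction a) := by
  refine LinearMap.ext fun m => funext fun i => ?_
  change TwistedPolynomial.C F r * (∑ j, m j * E.toAlgHom a j i)
    = ∑ j, (TwistedPolynomial.C F r * m j) * E.toAlgHom a j i
  rw [Finset.mul_sum]
  simp only [mul_assoc]

/-- The resulting action of `R ⊗ A` on the motive. -/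
def motiveAction : R ⊗[F] A →ₐ[F] Module.End F (Fin N → TwistedPolynomial F R) :=
  Algebra.TensorProduct.lift constAction E.operatorAction E.commute_constAction

instance : Module (R ⊗[F] A) E.MotiveCarrier :=
  Module.compHom (Fin N → TwistedPolynomial F R) E.motiveAction.toRingHom

theorem tmul_smul_motive (r : R) (a : A) (m : E.MotiveCarrier) :
    (r ⊗ₜ[F] a) • m = constAction r (E.operatorAction a m) := by
  change E.motiveAction (r ⊗ₜ a) m = _
  rw [motiveAction, Algebra.TensorProduct.lift_tmul]
  rfl

/-- `τ` acts on the motive by composition with the Frobenius of the target. -/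
def motiveTau : E.MotiveCarrier →+ E.MotiveCarrier where
  toFun m := fun i => TwistedPolynomial.τ F R * m i
  map_zero' := funext fun _ => mul_zero _
  map_add' m m' := funext fun i => mul_add (TwistedPolynomial.τ F R) (m i) (m' i)

theorem motiveTau_smul (c : R ⊗[F] A) (m : E.MotiveCarrier) :
    E.motiveTau (c • m) = frobeniusTensor F A R c • E.motiveTau m := by
  induction c with
  | zero => rw [zero_smul, map_zero, map_zero, zero_smul]
  | add c d hc hd => rw [add_smul, map_add, map_add, add_smul, hc, hd]
  | tmul r a =>
    have h : frobeniusTensor F A R (r ⊗ₜ a) = (r ^ Fintype.card F) ⊗ₜ a := by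
      simp [frobeniusTensor]
    rw [h, tmul_smul_motive, tmul_smul_motive]
    funext i
    change TwistedPolynomial.τ F R *
        (TwistedPolynomial.C F r * ∑ j, m j * E.toAlgHom a j i)
      = TwistedPolynomial.C F (r ^ Fintype.card F) *
        ∑ j, (TwistedPolynomial.τ F R * m j) * E.toAlgHom a j i
    rw [← mul_assoc, TwistedPolynomial.τ_mul_C, mul_assoc, Finset.mul_sum]
    simp only [mul_assoc]

/-- The Anderson motive of an Anderson module. -/
def motive : TauModule F A R where
  carrier := E.MotiveCarrier
  τ := { E.motiveTau with map_smul' := E.motiveTau_smul }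

/-- The coefficient matrix of `τ ^ k` in the action of `a`; for `k = 0` it is the action on the Lie
algebra. -/
def coeffMatrix (a : A) (k : ℕ) : Matrix (Fin N) (Fin N) R :=
  (E.toAlgHom a).map fun f => f.coeff k

end AndersonModule
end Motives
end


noncomputable section

namespace AndersonModule

variable {F A R S : Type*} [Field F] [Fintype F] [CommRing A] [Algebra F A] [CommRing R]
  [Algebra F R] [Algebra A R] [CommRing S] [Algebra F S] {N : ℕ}

/-- The matrix of `φ_a ^ {⊕ N}`. -/
def powMatrix (φ : DrinfeldModule F A R) (N : ℕ) (a : A) :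
    Matrix (Fin N) (Fin N) (TwistedPolynomial F R) :=
  Matrix.diagonal fun _ => φ.toAlgHom a 0 0

/-- `E` becomes isomorphic to `φ ^ {⊕ N}` after base change along `g : R → S`: some invertible matrix
`U` over `S{τ}` satisfies `U E_a = φ_a ^ {⊕ N} U` for all `a`. -/
def IsoPowOver (E : AndersonModule F A R N) (φ : DrinfeldModule F A R) (g : R →ₐ[F] S) : Prop :=
  ∃ U : (Matrix (Fin N) (Fin N) (TwistedPolynomial F S))ˣ, ∀ a : A,
    U.val * (E.toAlgHom a).map (TwistedPolynomial.map g)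
      = (powMatrix φ N a).map (TwistedPolynomial.map g) * U.val

/-- `∑ e_k τ ^ k` is the exponential series of `E` over `L` (via `σ`): `e_0 = 1` and
`(∑ e_k τ ^ k) ∂E_a = E_a (∑ e_k τ ^ k)` for every `a`, where `∂E_a` is the action on the Lie algebra. -/
def IsExponentialSeries (E : AndersonModule F A R N) {L : Type*} [CommRing L] (σ : R →+* L)
    (e : ℕ → Matrix (Fin N) (Fin N) L) : Prop :=
  e 0 = 1 ∧ ∀ (a : A) (k : ℕ),
    e k * ((E.coeffMatrix a 0).map σ).map (· ^ Fintype.card F ^ k)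
      = ∑ i ∈ Finset.range (k + 1),
          (E.coeffMatrix a i).map σ * (e (k - i)).map (· ^ Fintype.card F ^ i)

/-- `E` is uniformizable over `L` (via `σ`): the exponential series converges on all of `Lie E (L)`,
and the exponential map `exp : Lie E (L) → E (L)` is surjective. -/
def Uniformizable (E : AndersonModule F A R N) {L : Type*} [NormedField L] (σ : R →+* L) : Prop :=
  ∃ (e : ℕ → Matrix (Fin N) (Fin N) L) (exp : (Fin N → L) → (Fin N → L)),
    E.IsExponentialSeries σ e ∧
    (∀ x : Fin N → L,
      HasSum (fun k => Matrix.mulVec (e k) fun i => x i ^ Fintype.card F ^ k) (exp x)) ∧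
    Function.Surjective exp

end AndersonModule

/-- A representation of the absolute Galois group of `E` (with separable closure `Es`) on a vector space
over an algebraic closure of `F`, factoring through a finite Galois extension `L / E`. -/
structure ArtinRepresentation (F E Es : Type*) [Field F] [Field E] [Field Es] [Algebra E Es]
    (n : ℕ) where
  toHom : Gal(Es/E) →* GL (Fin n) (AlgebraicClosure F)
  finite_image : ∃ L : IntermediateField E Es, FiniteDimensional E L ∧ IsGalois E L ∧
    ∀ g ∈ L.fixingSubgroup, toHom g = 1

namespace ArtinRepresentation

variable {F E Es : Type*} [Field F] [Fintype F] [Field E] [Field Es] [Algebra E Es] {n : ℕ}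
  (ρ : ArtinRepresentation F E Es n)

/-- The field `F(ρ)` generated over `F` by all matrix entries of `ρ`. -/
def coeffField : IntermediateField F (AlgebraicClosure F) :=
  IntermediateField.adjoin F {x | ∃ (g : Gal(Es/E)) (i j : Fin n), x = (ρ.toHom g).val i j}

/-- The degree `d = [F(ρ) : F]`. -/
def degree : ℕ := Module.finrank F ρ.coeffField

/-- The matrix of `ρ(g)`, over the coefficient field. -/
def matrix (g : Gal(Es/E)) : Matrix (Fin n) (Fin n) ρ.coeffField :=
  Matrix.of fun i j => ⟨(ρ.toHom g).val i j, IntermediateField.subset_adjoin F _ ⟨g, i, j, rfl⟩⟩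

/-- The representation space of `ρ` over `F(ρ)`. -/
abbrev Space : Type _ := Fin n → ρ.coeffField

variable [Algebra F E] [Algebra F Es] [IsScalarTower F E Es]

/-- The diagonal action of the Galois group on `Es ⊗ F(ρ) ^ n`, `g ↦ g ⊗ ρ(g)`. -/
def diagonalAction (g : Gal(Es/E)) : Es ⊗[F] ρ.Space →ₗ[F] Es ⊗[F] ρ.Space :=
  TensorProduct.map ((g : Es →ₐ[E] Es).restrictScalars F).toLinearMap
    ((ρ.matrix g).mulVecLin.restrictScalars F)

theorem diagonalAction_smul (g : Gal(Es/E)) (c : E) (x : Es ⊗[F] ρ.Space) :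
    ρ.diagonalAction g (c • x) = c • ρ.diagonalAction g x := by
  induction x with
  | zero => simp
  | add x y hx hy => rw [smul_add, map_add, map_add, smul_add, hx, hy]
  | tmul z w => simp [diagonalAction, TensorProduct.smul_tmul']

/-- The Galois invariants `(Es ⊗ F(ρ) ^ n) ^ G`, an `E`-vector space. -/
def invariants : Submodule E (Es ⊗[F] ρ.Space) where
  carrier := {x | ∀ g, ρ.diagonalAction g x = x}
  zero_mem' g := map_zero _
  add_mem' hx hy g := by rw [map_add, hx g, hy g]
  smul_mem' c x hx g := by rw [diagonalAction_smul, hx g]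

/-- `Frob_q ⊗ id` on `Es ⊗ F(ρ) ^ n`. -/
def frobeniusSpace : Es ⊗[F] ρ.Space →ₗ[F] Es ⊗[F] ρ.Space :=
  TensorProduct.map (FiniteField.frobeniusAlgHom F Es).toLinearMap LinearMap.id

theorem frobeniusSpace_smul (c : E) (x : Es ⊗[F] ρ.Space) :
    ρ.frobeniusSpace (c • x) = c ^ Fintype.card F • ρ.frobeniusSpace x := by
  induction x with
  | zero => simp
  | add x y hx hy => rw [smul_add, map_add, map_add, smul_add, hx, hy]
  | tmul z w => simp [frobeniusSpace, TensorProduct.smul_tmul', Algebra.smul_def, mul_pow]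

theorem diagonalAction_frobeniusSpace (g : Gal(Es/E)) (x : Es ⊗[F] ρ.Space) :
    ρ.diagonalAction g (ρ.frobeniusSpace x) = ρ.frobeniusSpace (ρ.diagonalAction g x) := by
  induction x with
  | zero => simp
  | add x y hx hy => rw [map_add, map_add, map_add, map_add, hx, hy]
  | tmul z w => simp [frobeniusSpace, diagonalAction]

/-- `Frob_q ⊗ id` on the Galois invariants. -/
def invariantsFrobenius :
    ρ.invariants →ₛₗ[(FiniteField.frobeniusAlgHom F E : E →+* E)] ρ.invariants where
  toFun x := ⟨ρ.frobeniusSpace x, fun g => by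
    rw [diagonalAction_frobeniusSpace, x.2 g]⟩
  map_add' x y := Subtype.ext (map_add ρ.frobeniusSpace x.1 y.1)
  map_smul' c x := Subtype.ext (ρ.frobeniusSpace_smul c x.1)

/-- The Artin motive of `ρ`, with `A`-coefficients: `(Es ⊗ F(ρ) ^ n) ^ G ⊗ A`. -/
def motive (A : Type*) [CommRing A] [Algebra F A] : TauModule F A E :=
  TauModule.ofTauSpace (V := ρ.invariants) ρ.invariantsFrobenius

/-- `u` solves `ρ^(l)(g) g(u) α^(l) = u α^(l)` for all `g` and `0 ≤ l < d`, where `(l)` denotes the `l`-fold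
`q`-Frobenius twist and `F(ρ)` is viewed inside `Es` by `ε`. -/
def IsSolution (ε : ρ.coeffField →ₐ[F] Es) (α : Fin ρ.degree → ρ.coeffField)
    (u : Matrix (Fin n) (Fin ρ.degree) Es) : Prop :=
  ∀ (g : Gal(Es/E)) (l : ℕ), l < ρ.degree →
    Matrix.mulVec ((ρ.matrix g).map (fun c => ε c ^ Fintype.card F ^ l))
        (Matrix.mulVec (u.map g) fun j => ε (α j) ^ Fintype.card F ^ l)
      = Matrix.mulVec u fun j => ε (α j) ^ Fintype.card F ^ l

/-- A fundamental solution: its entries are moreover linearly independent over `F`. -/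
def IsFundamentalSolution (ε : ρ.coeffField →ₐ[F] Es) (α : Fin ρ.degree → ρ.coeffField)
    (u : Matrix (Fin n) (Fin ρ.degree) Es) : Prop :=
  ρ.IsSolution ε α u ∧ LinearIndependent F fun ij : Fin n × Fin ρ.degree => u ij.1 ij.2

end ArtinRepresentation

/-- The Moore matrix `M(u) = [u, u^(1), …, u^(N-1)]`, `N = n d`, with the entries of the `n × d` matrix `u`
arranged in a column vector. -/
def frobeniusMatrix (F : Type*) [Fintype F] {L : Type*} [Field L] {n d : ℕ}
    (u : Matrix (Fin n) (Fin d) L) :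
    Matrix (Fin (n * d)) (Fin (n * d)) L :=
  Matrix.of fun i k =>
    u (finProdFinEquiv.symm i).1 (finProdFinEquiv.symm i).2 ^ Fintype.card F ^ (k : ℕ)

/-- `𝓔` is an Artin twist of `φ` by `ρ`: its motive is isomorphic over `E` to the tensor product of the
motives of `φ` and of `ρ`. -/
def IsArtinTwist {F A E Es : Type*} [Field F] [Fintype F] [CommRing A] [Algebra F A] [Field E]
    [Algebra F E] [Algebra A E] [Field Es] [Algebra E Es] [Algebra F Es] [IsScalarTower F E Es]
    {n : ℕ} (φ : DrinfeldModule F A E) (ρ : ArtinRepresentation F E Es n)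
    (𝓔 : AndersonModule F A E (n * ρ.degree)) : Prop :=
  𝓔.motive.IsIso (φ.motive.tensor (ρ.motive A))

end

set_option linter.unusedSectionVars false

noncomputable section

/-! The twist is a Galois descent of `φ^{⊕N}`. Let `V` be the space of invariants `(Es ⊗ F(ρ)^n)^G`
with its Frobenius, and write the coordinates over `Es` of an `E`-basis of `V` as the rows of a
matrix `B`. Galois descent makes `B` invertible. Put `𝓔_a = B φ_a B⁻¹`. Its coefficient of `τ^l` is
the coefficient of `φ_a` times `B (B^(l))⁻¹`, where `(l)` denotes the `l`-fold Frobenius twist. The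
`l`-fold Frobenius of `V` has a matrix `D_l` over `E` with `D_l B = B^(l)`; hence `B (B^(l))⁻¹ =
D_l⁻¹` and `𝓔` is defined over `E`. The map `m ⊗ v ↦ (v_j m)_j`, with `v_j` the coordinates of `v`,
identifies `M(φ) ⊗ V` with the motive of `𝓔`, embedded over `Es` by right multiplication by `B`
(`TrivializedSpace.twist_isIso`).

An isomorphism of motives is right multiplication by an invertible matrix over `E{τ}`
(`AndersonModule.exists_units_of_isIso`). Any two Artin twists are thus isomorphic over `E`, and all
become `φ^{⊕N}` over `Es`.

For uniformizability, let `exp` be the exponential of `φ` and suppose `U 𝓔_a = φ_a^{⊕N} U`. Then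
`U⁻¹ exp ∂U` is an exponential of `𝓔`, and it is entire and surjective if `exp` is. The series `exp`
is built from a single `a ∈ A` of absolute value greater than `1`. Its coefficients decay faster
than every `r^(q^k)` with `r > 0`; a fixed point argument puts a ball in its image, and the
functional equation together with density enlarges this ball to all of `ℂ_∞`. If no such `a` exists,
every element of `A` is regular at all places, so `A = F` and the identity is an exponential.

For the second part, a matrix `u` is the coordinate vector of an element `x` of `Es ⊗ F(ρ)^n`. The
solution equations say that `x` is invariant, as seen through the `d` twisted evaluations `F(ρ) →
Es`, which are jointly injective because a Moore matrix is invertible. Fundamental solutions exist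
because `V` is not a finite union of proper `E`-subspaces, `E` being infinite. The iterated
Frobenius images of such an `x` have coordinate matrix `M(u)^T`; this is an admissible `B`, and `P =
B⁻¹`. -/

theorem FiniteField.frobeniusAlgHom_pow_apply (F : Type*) {R : Type*} [Field F] [Fintype F]
    [CommRing R] [Algebra F R] (k : ℕ) (x : R) :
    (FiniteField.frobeniusAlgHom F R ^ k) x = x ^ Fintype.card F ^ k := by
  induction k generalizing x with
  | zero => simp
  | succ k ih =>
    rw [pow_succ, AlgHom.mul_apply, ih, FiniteField.frobeniusAlgHom_apply, ← pow_mul, pow_succ']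

/-! ### Coefficients of twisted polynomials. -/

namespace TwistedPolynomial

variable {F R S T : Type*} [Field F] [Fintype F] [CommRing R] [Algebra F R] [CommRing S]
  [Algebra F S] [CommRing T] [Algebra F T]

theorem ext {f g : TwistedPolynomial F R} (h : ∀ k, f.coeff k = g.coeff k) : f = g :=
  SkewPolynomial.ext h

variable (F R) in
/-- The coefficient of `τ ^ k` as an additive map. -/
def coeffHom (k : ℕ) : TwistedPolynomial F R →+ R where
  toFun f := f.coeff k
  map_zero' := rfl
  map_add' f g := SkewPolynomial.coeff_add f g k

@[simp] theorem coeff_zero (k : ℕ) : (0 : TwistedPolynomial F R).coeff k = 0 := rfl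

@[simp] theorem coeff_add (f g : TwistedPolynomial F R) (k : ℕ) :
    (f + g).coeff k = f.coeff k + g.coeff k := SkewPolynomial.coeff_add f g k

theorem coeff_sum {ι : Type*} (s : Finset ι) (f : ι → TwistedPolynomial F R) (k : ℕ) :
    (∑ i ∈ s, f i).coeff k = ∑ i ∈ s, (f i).coeff k := map_sum (coeffHom F R k) f s

theorem coeff_C (r : R) (k : ℕ) : (C F r).coeff k = if k = 0 then r else 0 :=
  SkewPolynomial.coeff_C (R := FrobeniusTwisted F R) (a := r)

theorem coeff_one (k : ℕ) : (1 : TwistedPolynomial F R).coeff k = if k = 0 then 1 else 0 := by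
  rw [← map_one (C F), coeff_C]

theorem C_mul_τ_pow (r : R) (n : ℕ) :
    C F r * τ F R ^ n = SkewPolynomial.monomial (R := FrobeniusTwisted F R) n r := by
  have h := SkewPolynomial.C_mul_X_pow_eq_monomial (R := FrobeniusTwisted F R) (a := r) (n := n)
  refine Eq.trans ?_ h
  rfl

theorem coeff_C_mul_τ_pow (r : R) (n k : ℕ) :
    (C F r * τ F R ^ n).coeff k = if n = k then r else 0 := by
  rw [C_mul_τ_pow]
  exact SkewPolynomial.coeff_monomial (R := FrobeniusTwisted F R) (a := r)

theorem induction_on {motive : TwistedPolynomial F R → Prop} (f : TwistedPolynomial F R)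
    (add : ∀ f g, motive f → motive g → motive (f + g)) (zero : motive 0)
    (mono : ∀ (r : R) (n : ℕ), motive (C F r * τ F R ^ n)) : motive f := by
  induction f using SkewPolynomial.induction with
  | h0 => exact zero
  | ha n r q _ _ ih =>
    refine add _ _ ?_ ih
    exact (congrArg motive (C_mul_τ_pow (F := F) (R := R) r n)).mp (mono r n)

theorem coeff_mul (f g : TwistedPolynomial F R) (k : ℕ) :
    (f * g).coeff k
      = ∑ p ∈ Finset.HasAntidiagonal.antidiagonal k, f.coeff p.1 * g.coeff p.2 ^ Fintype.card F ^ p.1 := by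
  have hadd : ∀ (i : ℕ) (x y : R),
      (x + y) ^ Fintype.card F ^ i = x ^ Fintype.card F ^ i + y ^ Fintype.card F ^ i := by
    intro i x y
    simp only [← FiniteField.frobeniusAlgHom_pow_apply, map_add]
  have hzero : ∀ i : ℕ, (0 : R) ^ Fintype.card F ^ i = 0 := fun i =>
    zero_pow (pow_ne_zero _ Fintype.card_ne_zero)
  induction f using induction_on with
  | zero => simp
  | add f f' hf hf' => simp only [add_mul, coeff_add, hf, hf', Finset.sum_add_distrib]
  | mono r n =>
    induction g using induction_on with
    | zero => simp [hzero]
    | add g g' hg hg' => simp only [mul_add, coeff_add, hg, hg', hadd, Finset.sum_add_distrib]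
    | mono s m =>
      have h : C F r * τ F R ^ n * (C F s * τ F R ^ m)
          = C F (r * s ^ Fintype.card F ^ n) * τ F R ^ (n + m) := by
        rw [mul_assoc, ← mul_assoc (τ F R ^ n), ← C_pow_mul_τ_pow, map_mul, pow_add]
        simp only [mul_assoc]
      simp only [h, coeff_C_mul_τ_pow]
      by_cases hk : n + m = k
      · subst hk
        rw [Finset.sum_eq_single (n, m)]
        · simp
        · rintro ⟨i, j⟩ hij hne
          rw [Finset.HasAntidiagonal.mem_antidiagonal] at hij
          by_cases hi : n = i
          · exact absurd (by subst hi; simpa using hij) hne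
          · simp [hi]
        · simp
      · rw [if_neg hk, eq_comm]
        refine Finset.sum_eq_zero fun p hp => ?_
        rw [Finset.HasAntidiagonal.mem_antidiagonal] at hp
        by_cases hj : m = p.2
        · rw [if_neg (fun hi => hk (by rw [hi, hj, hp])), zero_mul]
        · rw [if_neg hj, hzero, mul_zero]

theorem coeff_C_mul (r : R) (f : TwistedPolynomial F R) (k : ℕ) :
    (C F r * f).coeff k = r * f.coeff k := by
  rw [coeff_mul, Finset.sum_eq_single (0, k)]
  · simp [coeff_C]
  · rintro ⟨i, j⟩ hij hne
    rw [Finset.HasAntidiagonal.mem_antidiagonal] at hij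
    have : i ≠ 0 := by
      rintro rfl
      exact hne (by simpa using hij)
    simp [coeff_C, this]
  · simp

theorem coeff_mul_C (f : TwistedPolynomial F R) (r : R) (k : ℕ) :
    (f * C F r).coeff k = f.coeff k * r ^ Fintype.card F ^ k := by
  rw [coeff_mul, Finset.sum_eq_single (k, 0)]
  · simp [coeff_C]
  · rintro ⟨i, j⟩ hij hne
    rw [Finset.HasAntidiagonal.mem_antidiagonal] at hij
    have : j ≠ 0 := by
      rintro rfl
      exact hne (by simpa using hij)
    simp [coeff_C, this]
  · simp

theorem exists_coeff_eq_zero (f : TwistedPolynomial F R) : ∃ n, ∀ k, n ≤ k → f.coeff k = 0 := by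
  induction f using induction_on with
  | zero => exact ⟨0, fun k _ => rfl⟩
  | add f g hf hg =>
    obtain ⟨n, hn⟩ := hf
    obtain ⟨m, hm⟩ := hg
    exact ⟨max n m, fun k hk => by
      rw [coeff_add, hn k (le_trans (le_max_left _ _) hk), hm k (le_trans (le_max_right _ _) hk),
        add_zero]⟩
  | mono r n =>
    exact ⟨n + 1, fun k hk => by rw [coeff_C_mul_τ_pow, if_neg (by omega)]⟩

variable (F) in
/-- The twisted polynomial `∑_{k < n} c_k τ ^ k`. -/
def ofCoeff (n : ℕ) (c : ℕ → R) : TwistedPolynomial F R :=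
  ∑ k ∈ Finset.range n, C F (c k) * τ F R ^ k

theorem coeff_ofCoeff (n : ℕ) (c : ℕ → R) (k : ℕ) :
    (ofCoeff F n c).coeff k = if k < n then c k else 0 := by
  simp [ofCoeff, coeff_sum, coeff_C_mul_τ_pow]

@[simp] theorem map_C (g : R →ₐ[F] S) (r : R) : map g (C F r) = C F (g r) := by
  refine ext fun k => ?_
  rw [coeff_map, coeff_C, coeff_C]
  split_ifs <;> simp

theorem coeff_τ (k : ℕ) : (τ F R).coeff k = if k = 1 then 1 else 0 := by
  have h := coeff_C_mul_τ_pow (F := F) (1 : R) 1 k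
  rw [map_one, one_mul, pow_one] at h
  rw [h]
  simp only [eq_comm]

@[simp] theorem map_τ (g : R →ₐ[F] S) : map g (τ F R) = τ F S := by
  refine ext fun k => ?_
  rw [coeff_map, coeff_τ, coeff_τ]
  split_ifs <;> simp

theorem map_injective {g : R →ₐ[F] S} (hg : Function.Injective g) :
    Function.Injective (map (F := F) g) := fun f f' h => ext fun k => hg <| by
  rw [← coeff_map, ← coeff_map, h]

end TwistedPolynomial
end

/-! ### The twist of a Drinfeld module by a trivialized Frobenius space. -/

noncomputable section

namespace TwistedPolynomial

variable {F R : Type*} [Field F] [Fintype F] [CommRing R] [Algebra F R]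

/-- Multiplication of the coefficients by a sequence of scalars. -/
def scaleCoeff (c : ℕ → R) (f : TwistedPolynomial F R) : TwistedPolynomial F R :=
  ofCoeff F f.exists_coeff_eq_zero.choose fun k => f.coeff k * c k

@[simp] theorem coeff_scaleCoeff (c : ℕ → R) (f : TwistedPolynomial F R) (k : ℕ) :
    (scaleCoeff c f).coeff k = f.coeff k * c k := by
  rw [scaleCoeff, coeff_ofCoeff]
  split_ifs with h
  · rfl
  · rw [f.exists_coeff_eq_zero.choose_spec k (not_lt.mp h), zero_mul]

theorem scaleCoeff_add (c : ℕ → R) (f g : TwistedPolynomial F R) :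
    scaleCoeff c (f + g) = scaleCoeff c f + scaleCoeff c g := ext fun k => by simp [add_mul]

end TwistedPolynomial

/-- In dimension one the nilpotency condition has exponent one, so the tangent action is exactly
scalar. -/
theorem AndersonModule.coeff_zero_toAlgHom {F A R : Type*} [Field F] [Fintype F] [CommRing A]
    [Algebra F A] [CommRing R] [Algebra F R] [Algebra A R] (φ : DrinfeldModule F A R) (a : A) :
    (φ.toAlgHom a 0 0).coeff 0 = algebraMap A R a := by
  have h := congrFun (congrFun (φ.lie_nilpotent a) 0) 0
  rw [pow_one] at h
  simpa [sub_eq_zero] using h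

/-- A semilinear Frobenius space `V` over `E`, with a basis and with coordinates over an extension
`Es` of `E` in which the Frobenius of `V` becomes the coordinatewise Frobenius and the basis becomes
an invertible matrix. -/
structure TrivializedSpace (F E Es V : Type*) [Field F] [Fintype F] [Field E] [Algebra F E]
    [Field Es] [Algebra F Es] [Algebra E Es] [AddCommGroup V] [Module E V]
    (τV : V →ₛₗ[(FiniteField.frobeniusAlgHom F E : E →+* E)] V) (N : ℕ) where
  basis : Module.Basis (Fin N) E V
  coord : V →ₗ[E] (Fin N → Es)
  coord_frobenius : ∀ v j, coord (τV v) j = coord v j ^ Fintype.card F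
  isUnit_det : IsUnit (Matrix.of fun i j => coord (basis i) j).det

namespace TrivializedSpace

variable {F E Es V : Type*} [Field F] [Fintype F] [Field E] [Algebra F E]
    [Field Es] [Algebra F Es] [Algebra E Es] [IsScalarTower F E Es] [AddCommGroup V]
    [Module E V] {τV : V →ₛₗ[(FiniteField.frobeniusAlgHom F E : E →+* E)] V} {N : ℕ}
    (T : TrivializedSpace F E Es V τV N)

/-- The coordinates of the basis. -/
def matrix : Matrix (Fin N) (Fin N) Es := Matrix.of fun i j => T.coord (T.basis i) j

theorem isUnit_det_matrix : IsUnit T.matrix.det := T.isUnit_det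

theorem coord_iterate (l : ℕ) (v : V) (j : Fin N) :
    T.coord (τV^[l] v) j = T.coord v j ^ Fintype.card F ^ l := by
  induction l with
  | zero => simp
  | succ l ih =>
    rw [Function.iterate_succ_apply', T.coord_frobenius, ih, ← pow_mul, pow_succ]

/-- The matrix of the `l`-fold Frobenius in the basis. -/
def frobMatrix (l : ℕ) : Matrix (Fin N) (Fin N) E :=
  Matrix.of fun i k => T.basis.repr (τV^[l] (T.basis i)) k

/-- Take coordinates in the expansion of `τ^l (v_i)` in the basis. This is the source of the descent
to `E`: the matrix comparing `B` with its Frobenius twist has entries in `E`. -/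
theorem frobMatrix_mul (l : ℕ) :
    (T.frobMatrix l).map (algebraMap E Es) * T.matrix
      = T.matrix.map (· ^ Fintype.card F ^ l) := by
  ext i j
  have h := congrArg (fun v => T.coord v j) (T.basis.sum_repr (τV^[l] (T.basis i)))
  simp only [T.coord_iterate] at h
  rw [Matrix.map_apply, matrix, Matrix.of_apply, ← h, Matrix.mul_apply, map_sum, Finset.sum_apply]
  simp only [map_smul, Pi.smul_apply, Algebra.smul_def, frobMatrix, Matrix.map_apply,
    Matrix.of_apply]

/-- Take determinants in `frobMatrix_mul`: the right side becomes a power of `det B`, which is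
nonzero. -/
theorem isUnit_det_frobMatrix (l : ℕ) : IsUnit (T.frobMatrix l).det := by
  have h := congrArg Matrix.det (T.frobMatrix_mul l)
  have h2 : (T.matrix.map (· ^ Fintype.card F ^ l)).det = T.matrix.det ^ Fintype.card F ^ l := by
    rw [← FiniteField.frobeniusAlgHom_pow_apply F, AlgHom.map_det]
    congr 1
    ext i j
    exact (FiniteField.frobeniusAlgHom_pow_apply F l _).symm
  have h3 : ((T.frobMatrix l).map (algebraMap E Es)).det = algebraMap E Es (T.frobMatrix l).det := by
    rw [RingHom.map_det]
    rfl
  rw [Matrix.det_mul, h2, h3] at h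
  rw [isUnit_iff_ne_zero]
  intro h0
  rw [h0, map_zero, zero_mul] at h
  exact pow_ne_zero _ T.isUnit_det_matrix.ne_zero h.symm

/-- The inverse of the matrix of the `l`-fold Frobenius in the basis. -/
def frobMatrixInv (l : ℕ) : Matrix (Fin N) (Fin N) E := (T.frobMatrix l)⁻¹

theorem frobMatrixInv_mul_frobMatrix (l : ℕ) : T.frobMatrixInv l * T.frobMatrix l = 1 :=
  Matrix.nonsing_inv_mul _ (T.isUnit_det_frobMatrix l)

theorem frobMatrix_mul_frobMatrixInv (l : ℕ) : T.frobMatrix l * T.frobMatrixInv l = 1 :=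
  Matrix.mul_nonsing_inv _ (T.isUnit_det_frobMatrix l)

theorem frobMatrixInv_mul (l : ℕ) :
    (T.frobMatrixInv l).map (algebraMap E Es) * T.matrix.map (· ^ Fintype.card F ^ l)
      = T.matrix := by
  rw [← frobMatrix_mul, ← Matrix.mul_assoc, ← Matrix.map_mul, frobMatrixInv_mul_frobMatrix]
  simp

theorem frobMatrixInv_zero : T.frobMatrixInv 0 = 1 := by
  have h : T.frobMatrix 0 = 1 := by
    ext i k
    simp [frobMatrix, Matrix.one_apply, Finsupp.single_apply]
  rw [frobMatrixInv, h, inv_one]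

open TwistedPolynomial

/-- Moving the constant `B_kj` to the left of `τ^l` twists it to `B_kj^(l)`, and `D_l⁻¹ B^(l) = B`
removes the twist. Both the module structure of the twist and the isomorphism of motives come from
this identity. -/
theorem sum_map_scaleCoeff_mul (f : TwistedPolynomial F E) (i j : Fin N) :
    ∑ k, map (IsScalarTower.toAlgHom F E Es) (scaleCoeff (fun l => T.frobMatrixInv l i k) f)
        * C F (T.matrix k j)
      = C F (T.matrix i j) * map (IsScalarTower.toAlgHom F E Es) f := by
  refine TwistedPolynomial.ext fun l => ?_
  have h := congrFun (congrFun (T.frobMatrixInv_mul l) i) j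
  rw [Matrix.mul_apply] at h
  rw [coeff_C_mul, coeff_sum, ← h, Finset.sum_mul]
  refine Finset.sum_congr rfl fun k _ => ?_
  simp only [coeff_mul_C, coeff_map, coeff_scaleCoeff, map_mul, IsScalarTower.coe_toAlgHom',
    Matrix.map_apply]
  ring

theorem isUnit_map_C : IsUnit (T.matrix.map (C F)) :=
  ((Matrix.isUnit_iff_isUnit_det _).mpr T.isUnit_det_matrix).map (C F).mapMatrix

theorem map_C_mul_inv : T.matrix.map (C F) * (T.matrix⁻¹).map (C F) = 1 := by
  rw [← Matrix.map_mul, Matrix.mul_nonsing_inv _ T.isUnit_det_matrix]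
  simp

theorem map_C_inv_mul : (T.matrix⁻¹).map (C F) * T.matrix.map (C F) = 1 := by
  rw [← Matrix.map_mul, Matrix.nonsing_inv_mul _ T.isUnit_det_matrix]
  simp

variable {A : Type*} [CommRing A] [Algebra F A] [Algebra A E]
  (φ : DrinfeldModule F A E)

/-- The action of `a` on the twist, as a matrix over `E{τ}`. -/
def twistMatrix (a : A) : Matrix (Fin N) (Fin N) (TwistedPolynomial F E) :=
  Matrix.of fun i k => scaleCoeff (fun l => T.frobMatrixInv l i k) (φ.toAlgHom a 0 0)

theorem twistMatrix_map_mul (a : A) :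
    (T.twistMatrix φ a).map (map (IsScalarTower.toAlgHom F E Es)) * T.matrix.map (C F)
      = T.matrix.map (C F)
        * (AndersonModule.powMatrix φ N a).map (map (IsScalarTower.toAlgHom F E Es)) := by
  ext1 i j
  rw [Matrix.mul_apply, AndersonModule.powMatrix, Matrix.diagonal_map (map_zero _),
    Matrix.mul_diagonal]
  exact T.sum_map_scaleCoeff_mul (φ.toAlgHom a 0 0) i j

theorem twistMatrix_map (a : A) :
    (T.twistMatrix φ a).map (map (IsScalarTower.toAlgHom F E Es))
      = T.matrix.map (C F)
        * (AndersonModule.powMatrix φ N a).map (map (IsScalarTower.toAlgHom F E Es))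
        * (T.matrix⁻¹).map (C F) := by
  rw [← twistMatrix_map_mul, Matrix.mul_assoc, map_C_mul_inv, Matrix.mul_one]

theorem map_toAlgHom_injective :
    Function.Injective (map (F := F) (IsScalarTower.toAlgHom F E Es)) :=
  map_injective (algebraMap E Es).injective

/-- Identities over `E{τ}` can be checked over `Es{τ}` after right multiplication by `B`. There the
twist is replaced by the diagonal action of `φ`, for which the ring axioms are clear. -/
theorem eq_of_map_mul_eq {X Y : Matrix (Fin N) (Fin N) (TwistedPolynomial F E)}
    (h : X.map (map (IsScalarTower.toAlgHom F E Es)) * T.matrix.map (C F)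
      = Y.map (map (IsScalarTower.toAlgHom F E Es)) * T.matrix.map (C F)) : X = Y :=
  Matrix.map_injective map_toAlgHom_injective (T.isUnit_map_C.mul_right_cancel h)

theorem powMatrix_eq (a : A) :
    AndersonModule.powMatrix φ N a = Matrix.scalar (Fin N) (φ.toAlgHom a 0 0) := rfl

/-- The Anderson module `B φ_a B⁻¹`, where `B` is the matrix of the trivialization. -/
def twist : AndersonModule F A E N where
  toAlgHom :=
    { toFun := T.twistMatrix φ
      map_one' := T.eq_of_map_mul_eq <| by
        rw [twistMatrix_map_mul, powMatrix_eq, map_one, Matrix.one_apply_eq, map_one]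
        simp
      map_mul' := fun a b => T.eq_of_map_mul_eq <| by
        have h : AndersonModule.powMatrix φ N (a * b)
            = AndersonModule.powMatrix φ N a * AndersonModule.powMatrix φ N b := by
          rw [powMatrix_eq, powMatrix_eq, powMatrix_eq, ← map_mul, map_mul φ.toAlgHom,
            Matrix.mul_apply, Fin.sum_univ_one]
        rw [twistMatrix_map_mul, Matrix.map_mul, Matrix.mul_assoc, twistMatrix_map_mul,
          ← Matrix.mul_assoc, twistMatrix_map_mul, Matrix.mul_assoc, h, Matrix.map_mul]
      map_zero' := by
        ext1 i k
        exact TwistedPolynomial.ext fun l => by simp [twistMatrix]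
      map_add' := fun a b => by
        ext1 i k
        exact TwistedPolynomial.ext fun l => by simp [twistMatrix, add_mul]
      commutes' := fun c => T.eq_of_map_mul_eq <| by
        have h : φ.toAlgHom (algebraMap F A c) 0 0 = algebraMap F (TwistedPolynomial F E) c := by
          rw [AlgHom.commutes, Matrix.algebraMap_matrix_apply, if_pos rfl]
        rw [twistMatrix_map_mul]
        ext1 i j
        rw [powMatrix_eq, h, Matrix.algebraMap_eq_diagonal]
        have h2 : Matrix.scalar (Fin N) (algebraMap F (TwistedPolynomial F E) c)
          = Matrix.diagonal (algebraMap F (Fin N → TwistedPolynomial F E) c) := rfl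
        have h3 : map (IsScalarTower.toAlgHom F E Es) (algebraMap F (TwistedPolynomial F E) c)
            = algebraMap F (TwistedPolynomial F Es) c := by
          have h4 : algebraMap F (TwistedPolynomial F E) c = C F (algebraMap F E c) := rfl
          rw [h4, map_C]
          simp only [AlgHom.commutes]
          rfl
        rw [h2, Matrix.diagonal_map (map_zero _), Matrix.mul_diagonal, Matrix.diagonal_mul]
        simp only [Pi.algebraMap_apply, Matrix.map_apply]
        rw [h3]
        exact (Algebra.commutes c _).symm }
  lie_nilpotent := fun a => by
    -- For `N = 0` the exponent is zero, and the equation holds only because the matrix ring is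
    -- trivial. For `N > 0` the tangent action is exactly scalar, since `D_0 = 1`.
    rcases Nat.eq_zero_or_pos N with rfl | hN
    · exact Subsingleton.elim _ _
    · refine (congrArg (· ^ N) ?_).trans (zero_pow hN.ne')
      ext i k
      change (T.twistMatrix φ a i k).coeff 0 - Matrix.scalar (Fin N) (algebraMap A E a) i k = 0
      simp [twistMatrix, frobMatrixInv_zero, AndersonModule.coeff_zero_toAlgHom,
        Matrix.one_apply, Matrix.diagonal_apply]

end TrivializedSpace
end

/-! ### The motive of the twist is `M(φ) ⊗ V`. -/

noncomputable section

namespace TrivializedSpace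

open TwistedPolynomial

variable {F E Es V : Type*} [Field F] [Fintype F] [Field E] [Algebra F E]
    [Field Es] [Algebra F Es] [Algebra E Es] [IsScalarTower F E Es] [AddCommGroup V]
    [Module E V] {τV : V →ₛₗ[(FiniteField.frobeniusAlgHom F E : E →+* E)] V} {N : ℕ}
    (T : TrivializedSpace F E Es V τV N)
    {A : Type*} [CommRing A] [Algebra F A] [Algebra A E] (φ : DrinfeldModule F A E)

/-- The coordinates over `Es` of an element of the motive of the twist. -/
def motiveCoord (m : Fin N → TwistedPolynomial F E) : Fin N → TwistedPolynomial F Es :=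
  Matrix.vecMul (fun k => map (IsScalarTower.toAlgHom F E Es) (m k)) (T.matrix.map (C F))

theorem motiveCoord_injective : Function.Injective T.motiveCoord := by
  intro m m' h
  have h2 := congrArg (fun v => Matrix.vecMul v ((T.matrix⁻¹).map (C F))) h
  simp only [motiveCoord, Matrix.vecMul_vecMul, map_C_mul_inv, Matrix.vecMul_one] at h2
  funext k
  exact map_toAlgHom_injective (congrFun h2 k)

theorem motiveCoord_mul_left (f : TwistedPolynomial F E) (m : Fin N → TwistedPolynomial F E) :
    T.motiveCoord (fun k => f * m k)
      = fun j => map (IsScalarTower.toAlgHom F E Es) f * T.motiveCoord m j := by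
  funext j
  simp only [motiveCoord, Matrix.vecMul, dotProduct, map_mul, Finset.mul_sum, mul_assoc]

theorem motiveCoord_vecMul_twistMatrix (m : Fin N → TwistedPolynomial F E) (a : A) :
    T.motiveCoord (Matrix.vecMul m (T.twistMatrix φ a))
      = fun j => T.motiveCoord m j
          * map (IsScalarTower.toAlgHom F E Es) (φ.toAlgHom a 0 0) := by
  have h1 : (fun k => map (IsScalarTower.toAlgHom F E Es) (Matrix.vecMul m (T.twistMatrix φ a) k))
      = Matrix.vecMul (fun k => map (IsScalarTower.toAlgHom F E Es) (m k))
          ((T.twistMatrix φ a).map (map (IsScalarTower.toAlgHom F E Es))) := by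
    funext k
    simp only [Matrix.vecMul, dotProduct, map_sum, map_mul, Matrix.map_apply]
  rw [motiveCoord, h1, Matrix.vecMul_vecMul, twistMatrix_map_mul, ← Matrix.vecMul_vecMul]
  funext j
  rw [AndersonModule.powMatrix, Matrix.diagonal_map (map_zero _), Matrix.vecMul_diagonal]
  rfl

/-- After multiplication by `B` the motive of the twist lies in `N` copies of `Es{τ}`, where `A`
acts through `φ` on each entry. Linearity is tested there. -/
theorem twist_smul_coord (r : E) (a : A) (m : (T.twist φ).MotiveCarrier) :
    T.motiveCoord ((r ⊗ₜ[F] a : E ⊗[F] A) • m)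
      = fun j => C F (algebraMap E Es r) * (T.motiveCoord m j
          * map (IsScalarTower.toAlgHom F E Es) (φ.toAlgHom a 0 0)) := by
  rw [AndersonModule.tmul_smul_motive]
  refine (T.motiveCoord_mul_left (C F r) _).trans ?_
  rw [map_C]
  funext j
  exact congrArg (fun x => C F (algebraMap E Es r) * x)
    (congrFun (T.motiveCoord_vecMul_twistMatrix φ m a) j)

/-- The map from the motive of `φ ⊕ ⋯ ⊕ φ` to the motive of the twist. -/
def motiveMap (m : Fin N → φ.MotiveCarrier) : (T.twist φ).MotiveCarrier :=
  fun k => ∑ i, scaleCoeff (fun l => T.frobMatrixInv l i k) (m i 0)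

/-- In coordinates the map is left multiplication by the constants `B_ij`. It therefore commutes
with right multiplication by `φ_a` and with left multiplication by the constants from `E`. -/
theorem motiveCoord_motiveMap (m : Fin N → φ.MotiveCarrier) :
    T.motiveCoord (T.motiveMap φ m)
      = fun j => ∑ i, C F (T.matrix i j) * map (IsScalarTower.toAlgHom F E Es) (m i 0) := by
  funext j
  simp only [motiveCoord, motiveMap, Matrix.vecMul, dotProduct, map_sum, Matrix.map_apply,
    Finset.sum_mul]
  rw [Finset.sum_comm]
  exact Finset.sum_congr rfl fun i _ => T.sum_map_scaleCoeff_mul (m i 0) i j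

theorem motiveMap_add (m m' : Fin N → φ.MotiveCarrier) :
    T.motiveMap φ (m + m') = T.motiveMap φ m + T.motiveMap φ m' := by
  funext k
  refine (Finset.sum_congr rfl fun i _ => scaleCoeff_add _ (m i 0) (m' i 0)).trans ?_
  exact Finset.sum_add_distrib

theorem motiveMap_smul (c : E ⊗[F] A) (m : Fin N → φ.MotiveCarrier) :
    T.motiveMap φ (c • m) = c • T.motiveMap φ m := by
  induction c with
  | zero =>
    rw [zero_smul, zero_smul]
    have h := T.motiveMap_add φ 0 0
    rw [add_zero] at h
    exact left_eq_add.mp h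
  | add c d hc hd => rw [add_smul, motiveMap_add, hc, hd, add_smul]
  | tmul r a =>
    refine T.motiveCoord_injective ?_
    rw [twist_smul_coord, motiveCoord_motiveMap, motiveCoord_motiveMap]
    funext j
    rw [Finset.sum_mul, Finset.mul_sum]
    refine Finset.sum_congr rfl fun i _ => ?_
    have h : ((r ⊗ₜ[F] a : E ⊗[F] A) • m) i 0 = C F r * (m i 0 * φ.toAlgHom a 0 0) := by
      rw [Pi.smul_apply, AndersonModule.tmul_smul_motive]
      change C F r * (∑ j : Fin 1, m i j * φ.toAlgHom a j 0) = _
      rw [Fin.sum_univ_one]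
    have hcomm : C F (T.matrix i j) * C F (algebraMap E Es r)
        = C F (algebraMap E Es r) * C F (T.matrix i j) := by
      rw [← map_mul, mul_comm, map_mul]
    rw [h, map_mul, map_mul, map_C, IsScalarTower.coe_toAlgHom', ← mul_assoc, hcomm]
    simp only [mul_assoc]

/-- The inverse of `motiveMap`. -/
def motiveInv (m : (T.twist φ).MotiveCarrier) : Fin N → φ.MotiveCarrier :=
  fun i _ => ∑ k, scaleCoeff (fun l => T.frobMatrix l k i) (m k)

/-- The motive of the twist is additively the `N`-th power of the motive of `φ`. -/
def motiveEquiv : (Fin N → φ.MotiveCarrier) ≃ₗ[E ⊗[F] A] (T.twist φ).MotiveCarrier where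
  toFun := T.motiveMap φ
  map_add' := T.motiveMap_add φ
  map_smul' := T.motiveMap_smul φ
  invFun := T.motiveInv φ
  left_inv m := by
    funext i z
    rw [Subsingleton.elim z 0]
    refine TwistedPolynomial.ext fun l => ?_
    simp only [motiveInv, motiveMap, coeff_sum, coeff_scaleCoeff, Finset.sum_mul]
    rw [Finset.sum_comm]
    -- On the coefficients of `τ^l` the two maps are right multiplication by `D_l⁻¹` and by `D_l`.
    have h : ∀ i', ∑ k, (m i' 0).coeff l * T.frobMatrixInv l i' k * T.frobMatrix l k i
        = (m i' 0).coeff l * (1 : Matrix (Fin N) (Fin N) E) i' i := by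
      intro i'
      rw [← frobMatrixInv_mul_frobMatrix T l, Matrix.mul_apply, Finset.mul_sum]
      simp only [mul_assoc]
    simp [h, Matrix.one_apply]
  right_inv m := by
    funext i
    refine TwistedPolynomial.ext fun l => ?_
    simp only [motiveInv, motiveMap, coeff_sum, coeff_scaleCoeff, Finset.sum_mul]
    rw [Finset.sum_comm]
    have h : ∀ i', ∑ k, (m i').coeff l * T.frobMatrix l i' k * T.frobMatrixInv l k i
        = (m i').coeff l * (1 : Matrix (Fin N) (Fin N) E) i' i := by
      intro i'
      rw [← frobMatrix_mul_frobMatrixInv T l, Matrix.mul_apply, Finset.mul_sum]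
      simp only [mul_assoc]
    simp [h, Matrix.one_apply]

/-- The motive of the twist is the tensor product of the motive of `φ` and of `V`. -/
def tensorEquiv : φ.MotiveCarrier ⊗[E ⊗[F] A] ((E ⊗[F] A) ⊗[E] V)
    ≃ₗ[E ⊗[F] A] (T.twist φ).MotiveCarrier :=
  (TensorProduct.equivFinsuppOfBasisRight (Algebra.TensorProduct.basis (E ⊗[F] A) T.basis)).trans
    ((Finsupp.linearEquivFunOnFinite (E ⊗[F] A) φ.MotiveCarrier (Fin N)).trans (T.motiveEquiv φ))

theorem algebraMap_smul_motive (r : E) (m : φ.MotiveCarrier) :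
    algebraMap E (E ⊗[F] A) r • m = fun i => C F r * m i := by
  rw [Algebra.TensorProduct.algebraMap_apply, Algebra.algebraMap_self_apply,
    AndersonModule.tmul_smul_motive, map_one]
  rfl

/-- The basis has dropped out: only the coordinates of `v` over `Es` remain, and on these the
Frobenius of `V` is the `q`-power map. -/
theorem motiveCoord_tensorEquiv (m : φ.MotiveCarrier) (v : V) :
    T.motiveCoord (T.tensorEquiv φ (m ⊗ₜ (1 ⊗ₜ v)))
      = fun j => C F (T.coord v j) * map (IsScalarTower.toAlgHom F E Es) (m 0) := by
  refine (T.motiveCoord_motiveMap φ _).trans ?_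
  funext j
  have h : ∀ i : Fin N, (Finsupp.linearEquivFunOnFinite (E ⊗[F] A) φ.MotiveCarrier (Fin N))
      ((TensorProduct.equivFinsuppOfBasisRight
        (Algebra.TensorProduct.basis (E ⊗[F] A) T.basis)) (m ⊗ₜ (1 ⊗ₜ v))) i
      = fun i' => C F (T.basis.repr v i) * m i' := by
    intro i
    rw [Finsupp.linearEquivFunOnFinite_apply,
      TensorProduct.equivFinsuppOfBasisRight_apply_tmul_apply,
      Algebra.TensorProduct.basis_repr_tmul, ← algebraMap_smul_motive]
    congr 1
    simp
  have h2 : C F (T.coord v j) = ∑ i, C F (T.matrix i j) * C F (algebraMap E Es (T.basis.repr v i)) := by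
    conv_lhs => rw [← T.basis.sum_repr v]
    rw [map_sum, Finset.sum_apply, map_sum]
    refine Finset.sum_congr rfl fun i _ => ?_
    rw [map_smul, Pi.smul_apply, Algebra.smul_def, mul_comm, map_mul]
    rfl
  rw [h2, Finset.sum_mul]
  refine Finset.sum_congr rfl fun i _ => ?_
  have h3 := congrArg (map (IsScalarTower.toAlgHom F E Es)) (congrFun (h i) 0)
  rw [map_mul, map_C] at h3
  exact (congrArg (C F (T.matrix i j) * ·) h3).trans (mul_assoc _ _ _).symm

/-- Scalars of `B` slide to the left factor, so the tensors `m ⊗ (1 ⊗ v)` generate additively. -/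
theorem tensor_induction {E V B M : Type*} [CommRing E] [AddCommGroup V] [Module E V]
    [CommRing B] [Algebra E B] [AddCommGroup M] [Module B M] (p : M ⊗[B] (B ⊗[E] V) → Prop)
    (add : ∀ x y, p x → p y → p (x + y)) (tmul : ∀ m v, p (m ⊗ₜ (1 ⊗ₜ v))) (x) : p x := by
  have zero : p 0 := by
    have h := tmul 0 0
    rwa [TensorProduct.zero_tmul] at h
  induction x with
  | zero => exact zero
  | add x y hx hy => exact add x y hx hy
  | tmul m w =>
    induction w with
    | zero => rwa [TensorProduct.tmul_zero]
    | add w w' hw hw' =>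
      rw [TensorProduct.tmul_add]
      exact add _ _ hw hw'
    | tmul c v =>
      have h : m ⊗ₜ[B] (c ⊗ₜ[E] v) = (c • m) ⊗ₜ[B] ((1 : B) ⊗ₜ[E] v) := by
        rw [TensorProduct.smul_tmul, TensorProduct.smul_tmul', smul_eq_mul, mul_one]
      rw [h]
      exact tmul _ _

theorem tensorEquiv_τ (x : (φ.motive.tensor (TauModule.ofTauSpace (A := A) τV)).carrier) :
    T.tensorEquiv φ ((φ.motive.tensor (TauModule.ofTauSpace τV)).τ x)
      = (T.twist φ).motiveTau (T.tensorEquiv φ x) := by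
  have hadd : ∀ x y, T.tensorEquiv φ
      ((φ.motive.tensor (TauModule.ofTauSpace τV)).τ (x + y))
      = T.tensorEquiv φ ((φ.motive.tensor (TauModule.ofTauSpace τV)).τ x)
        + T.tensorEquiv φ ((φ.motive.tensor (TauModule.ofTauSpace τV)).τ y) := by
    intro x y
    rw [map_add]
    exact map_add (T.tensorEquiv φ) _ _
  have key : ∀ (m : φ.MotiveCarrier) (v : V),
      T.tensorEquiv φ (φ.motiveTau m ⊗ₜ (1 ⊗ₜ τV v))
        = (T.twist φ).motiveTau (T.tensorEquiv φ (m ⊗ₜ (1 ⊗ₜ v))) := by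
    intro m v
    refine T.motiveCoord_injective ?_
    refine Eq.trans ?_ (T.motiveCoord_mul_left (τ F E) _).symm
    rw [motiveCoord_tensorEquiv, motiveCoord_tensorEquiv]
    funext j
    have h : φ.motiveTau m 0 = τ F E * m 0 := rfl
    -- The `q`-th power of the coordinate is what appears when `τ` is moved past the coordinate.
    rw [h, map_mul, map_τ, T.coord_frobenius, ← mul_assoc, ← mul_assoc, τ_mul_C]
  have key2 : ∀ (m : φ.MotiveCarrier) (v : V),
      T.tensorEquiv φ ((φ.motive.tensor (TauModule.ofTauSpace τV)).τ (m ⊗ₜ (1 ⊗ₜ v)))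
        = (T.twist φ).motiveTau (T.tensorEquiv φ (m ⊗ₜ (1 ⊗ₜ v))) := by
    intro m v
    rw [← key]
    congr 1
    change φ.motiveTau m ⊗ₜ[E ⊗[F] A] (frobeniusTensor F A E 1 ⊗ₜ[E] τV v) = _
    rw [map_one]
  refine tensor_induction (fun x => T.tensorEquiv φ
    ((φ.motive.tensor (TauModule.ofTauSpace τV)).τ x)
      = (T.twist φ).motiveTau (T.tensorEquiv φ x)) (fun x y hx hy => ?_) key2 x
  refine (hadd x y).trans ?_
  rw [hx, hy, ← map_add]
  exact congrArg (T.twist φ).motiveTau (map_add (T.tensorEquiv φ) x y).symm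

theorem twist_isIso : (T.twist φ).motive.IsIso (φ.motive.tensor (TauModule.ofTauSpace τV)) := by
  refine ⟨(T.tensorEquiv φ).symm, fun m => ?_⟩
  obtain ⟨x, rfl⟩ := (T.tensorEquiv φ).surjective m
  refine ((T.tensorEquiv φ).symm_apply_eq).mpr ?_
  have h : (T.tensorEquiv φ).symm (T.tensorEquiv φ x) = x := LinearEquiv.symm_apply_apply _ _
  refine (T.tensorEquiv_τ φ x).symm.trans ?_
  exact congrArg (fun y => T.tensorEquiv φ ((φ.motive.tensor (TauModule.ofTauSpace τV)).τ y)) h.symm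

end TrivializedSpace
end

/-! ### From isomorphisms of motives to isomorphisms of Anderson modules. -/

noncomputable section

namespace TauModule

variable {F A R : Type*} [Field F] [Fintype F] [CommRing A] [Algebra F A] [CommRing R]
  [Algebra F R]

theorem IsIso.symm {M M' : TauModule F A R} (h : M.IsIso M') : M'.IsIso M := by
  obtain ⟨f, hf⟩ := h
  refine ⟨f.symm, fun m => ?_⟩
  rw [LinearEquiv.symm_apply_eq, hf, LinearEquiv.apply_symm_apply]

theorem IsIso.trans {M M' M'' : TauModule F A R} (h : M.IsIso M') (h' : M'.IsIso M'') :
    M.IsIso M'' := by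
  obtain ⟨f, hf⟩ := h
  obtain ⟨f', hf'⟩ := h'
  refine ⟨f.trans f', fun m => ?_⟩
  rw [LinearEquiv.trans_apply, hf, hf', LinearEquiv.trans_apply]

end TauModule

namespace AndersonModule

open TwistedPolynomial

variable {F A R : Type*} [Field F] [Fintype F] [CommRing A] [Algebra F A] [CommRing R]
  [Algebra F R] [Algebra A R] {N : ℕ}

/-- The constants and `τ` generate `R{τ}`, so such an `f` is linear for the left module structure. A
left linear endomorphism of a free module of row vectors is right multiplication by the matrix of
images of the unit vectors. -/
theorem exists_matrix_of_linear {f : (Fin N → TwistedPolynomial F R) → Fin N → TwistedPolynomial F R}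
    (hadd : ∀ m m', f (m + m') = f m + f m')
    (hC : ∀ r m, f (fun i => C F r * m i) = fun i => C F r * f m i)
    (hτ : ∀ m, f (fun i => τ F R * m i) = fun i => τ F R * f m i) :
    ∃ X : Matrix (Fin N) (Fin N) (TwistedPolynomial F R), ∀ m, f m = Matrix.vecMul m X := by
  have hτn : ∀ (n : ℕ) m, f (fun i => τ F R ^ n * m i) = fun i => τ F R ^ n * f m i := by
    intro n
    induction n with
    | zero => simp
    | succ n ih =>
      intro m
      have h := hτ (fun i => τ F R ^ n * m i)
      rw [ih] at h
      simpa only [← mul_assoc, ← pow_succ'] using h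
  have hzero : f 0 = 0 := by
    have h := hadd 0 0
    rw [add_zero] at h
    exact left_eq_add.mp h
  have hmul : ∀ g m, f (fun i => g * m i) = fun i => g * f m i := by
    intro g m
    induction g using TwistedPolynomial.induction_on with
    | zero =>
      simp only [zero_mul]
      exact hzero
    | add g g' hg hg' =>
      have h := hadd (fun i => g * m i) (fun i => g' * m i)
      rw [hg, hg'] at h
      simp only [add_mul]
      exact h
    | mono r n =>
      simp only [mul_assoc]
      rw [hC, hτn]
  refine ⟨Matrix.of fun i => f (Pi.single i 1), fun m => ?_⟩
  have hsum : ∀ (s : Finset (Fin N)) (v : Fin N → Fin N → TwistedPolynomial F R),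
      f (∑ i ∈ s, v i) = ∑ i ∈ s, f (v i) := fun s v =>
    map_sum (⟨⟨f, hzero⟩, hadd⟩ : (Fin N → TwistedPolynomial F R) →+ _) v s
  have h1 : m = ∑ i, (fun k => m i * (Pi.single i 1 : Fin N → TwistedPolynomial F R) k) := by
    funext k
    simp [Finset.sum_apply, Pi.single_apply]
  conv_lhs => rw [h1]
  rw [hsum]
  funext k
  rw [Finset.sum_apply]
  refine Finset.sum_congr rfl fun i _ => ?_
  rw [hmul]
  rfl

theorem matrix_eq_of_vecMul_eq {S : Type*} [Semiring S] {X Y : Matrix (Fin N) (Fin N) S}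
    (h : ∀ m, Matrix.vecMul m X = Matrix.vecMul m Y) : X = Y := by
  ext i j
  have := congrFun (h (Pi.single i 1)) j
  simpa using this

theorem tmul_one_smul_motive (𝓔 : AndersonModule F A R N) (r : R) (m : 𝓔.MotiveCarrier) :
    (r ⊗ₜ[F] (1 : A)) • m = (fun i => C F r * m i : Fin N → TwistedPolynomial F R) := by
  rw [tmul_smul_motive, map_one]
  rfl

theorem one_tmul_smul_motive (𝓔 : AndersonModule F A R N) (a : A) (m : 𝓔.MotiveCarrier) :
    ((1 : R) ⊗ₜ[F] a) • m = Matrix.vecMul m (𝓔.toAlgHom a) := by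
  rw [tmul_smul_motive, map_one]
  rfl

/-- Full faithfulness of the motive on isomorphisms. The map and its inverse are right
multiplications by matrices inverse to each other, and linearity over `1 ⊗ a` is the intertwining
relation. -/
theorem exists_units_of_isIso {𝓔 𝓔' : AndersonModule F A R N} (h : 𝓔.motive.IsIso 𝓔'.motive) :
    ∃ X : (Matrix (Fin N) (Fin N) (TwistedPolynomial F R))ˣ,
      ∀ a, 𝓔.toAlgHom a * X = X * 𝓔'.toAlgHom a := by
  have key : ∀ {𝓔 𝓔' : AndersonModule F A R N} (f : 𝓔.MotiveCarrier ≃ₗ[R ⊗[F] A] 𝓔'.MotiveCarrier),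
      (∀ m, f (𝓔.motiveTau m) = 𝓔'.motiveTau (f m)) →
      ∃ X : Matrix (Fin N) (Fin N) (TwistedPolynomial F R), ∀ m, f m = Matrix.vecMul m X := by
    intro 𝓔 𝓔' f hf
    refine exists_matrix_of_linear (f := f) (map_add f) (fun r m => ?_) hf
    exact (congrArg f (𝓔.tmul_one_smul_motive r m)).symm.trans
      ((f.map_smul (r ⊗ₜ[F] (1 : A)) m).trans (𝓔'.tmul_one_smul_motive r (f m)))
  obtain ⟨f, hf⟩ := h
  change 𝓔.MotiveCarrier ≃ₗ[R ⊗[F] A] 𝓔'.MotiveCarrier at f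
  obtain ⟨X, hX⟩ := key f hf
  have hf' : ∀ m, f.symm (𝓔'.motiveTau m) = 𝓔.motiveTau (f.symm m) := by
    intro m
    rw [LinearEquiv.symm_apply_eq]
    refine Eq.trans ?_ (hf (f.symm m)).symm
    exact congrArg 𝓔'.motiveTau (LinearEquiv.apply_symm_apply f m).symm
  obtain ⟨Y, hY⟩ := key f.symm hf'
  refine ⟨⟨X, Y, ?_, ?_⟩, fun a => matrix_eq_of_vecMul_eq fun m => ?_⟩
  · refine matrix_eq_of_vecMul_eq fun m => ?_
    rw [← Matrix.vecMul_vecMul, Matrix.vecMul_one]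
    refine (hY _).symm.trans ((congrArg f.symm (hX m)).symm.trans ?_)
    exact LinearEquiv.symm_apply_apply f m
  · refine matrix_eq_of_vecMul_eq fun m => ?_
    rw [← Matrix.vecMul_vecMul, Matrix.vecMul_one]
    refine (hX _).symm.trans ((congrArg f (hY m)).symm.trans ?_)
    exact LinearEquiv.apply_symm_apply f m
  · rw [← Matrix.vecMul_vecMul, ← Matrix.vecMul_vecMul]
    refine (hX _).symm.trans ((congrArg f (𝓔.one_tmul_smul_motive a m)).symm.trans ?_)
    refine (f.map_smul ((1 : R) ⊗ₜ[F] a) m).trans ((𝓔'.one_tmul_smul_motive a (f m)).trans ?_)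
    exact congrArg (fun x => Matrix.vecMul x (𝓔'.toAlgHom a)) (hX m)

end AndersonModule

namespace TrivializedSpace

open TwistedPolynomial

variable {F E Es V : Type*} [Field F] [Fintype F] [Field E] [Algebra F E]
    [Field Es] [Algebra F Es] [Algebra E Es] [IsScalarTower F E Es] [AddCommGroup V]
    [Module E V] {τV : V →ₛₗ[(FiniteField.frobeniusAlgHom F E : E →+* E)] V} {N : ℕ}
    {A : Type*} [CommRing A] [Algebra F A] [Algebra A E]

/-- The motive determines `𝓔` up to an invertible matrix `X` over `E{τ}`, so `𝓔` may be compared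
with the explicit twist. As `𝓔_a X B = X B φ_a`, the matrix `(X B)⁻¹` trivializes `𝓔` over `Es`. -/
theorem isoPowOver_of_isIso (T : TrivializedSpace F E Es V τV N) (φ : DrinfeldModule F A E)
    {𝓔 : AndersonModule F A E N}
    (h : 𝓔.motive.IsIso (φ.motive.tensor (TauModule.ofTauSpace τV))) :
    𝓔.IsoPowOver φ (IsScalarTower.toAlgHom F E Es) := by
  obtain ⟨X, hX⟩ := AndersonModule.exists_units_of_isIso (h.trans (T.twist_isIso φ).symm)
  let g := map (F := F) (IsScalarTower.toAlgHom F E Es)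
  let B : (Matrix (Fin N) (Fin N) (TwistedPolynomial F Es))ˣ :=
    ⟨T.matrix.map (C F), (T.matrix⁻¹).map (C F), T.map_C_mul_inv, T.map_C_inv_mul⟩
  let X' : (Matrix (Fin N) (Fin N) (TwistedPolynomial F Es))ˣ := Units.map g.mapMatrix.toMonoidHom X
  have h1 : ∀ a, (𝓔.toAlgHom a).map g * X'.val = X'.val * (T.twistMatrix φ a).map g := by
    intro a
    have h2 := congrArg g.mapMatrix (hX a)
    rw [map_mul, map_mul] at h2
    exact h2
  refine ⟨(X' * B)⁻¹, fun a => ?_⟩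
  have h3 : (𝓔.toAlgHom a).map g * (X' * B).val
      = (X' * B).val * (AndersonModule.powMatrix φ N a).map g := by
    rw [Units.val_mul, ← Matrix.mul_assoc, h1, Matrix.mul_assoc, Matrix.mul_assoc]
    exact congrArg (X'.val * ·) (T.twistMatrix_map_mul φ a)
  change _ * (𝓔.toAlgHom a).map g = (AndersonModule.powMatrix φ N a).map g * _
  rw [Units.inv_mul_eq_iff_eq_mul, ← Matrix.mul_assoc, ← h3, Matrix.mul_assoc, Units.mul_inv,
    Matrix.mul_one]

end TrivializedSpace
end

/-! ### Moore matrices, and Galois descent for the representation space. -/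

noncomputable section

/-- The Moore matrix of linearly independent elements is invertible. -/
theorem isUnit_det_moore {F L : Type*} [Field F] [Fintype F] [Field L] [Algebra F L] {m : ℕ}
    {v : Fin m → L} (hv : LinearIndependent F v) :
    IsUnit (Matrix.of fun i k : Fin m => v i ^ Fintype.card F ^ (k : ℕ)).det := by
  classical
  rw [isUnit_iff_ne_zero]
  intro h0
  obtain ⟨c, hc, hMc⟩ := Matrix.exists_mulVec_eq_zero_iff.mpr h0
  -- A kernel vector gives an `F`-linear polynomial of degree at most `q^(m-1)` that vanishes on the
  -- `F`-span of the `v i`, a set of `q^m` elements. It must then be zero.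
  let p : Polynomial L := ∑ k : Fin m, Polynomial.monomial (Fintype.card F ^ (k : ℕ)) (c k)
  have hq : 1 < Fintype.card F := Fintype.one_lt_card
  have heval : ∀ x, p.eval x = ∑ k : Fin m, c k * (FiniteField.frobeniusAlgHom F L ^ (k : ℕ)) x := by
    intro x
    simp only [p, Polynomial.eval_finsetSum, Polynomial.eval_monomial,
      FiniteField.frobeniusAlgHom_pow_apply]
  have hbasic : ∀ i, ∑ k : Fin m, c k * (FiniteField.frobeniusAlgHom F L ^ (k : ℕ)) (v i) = 0 := by
    intro i
    have h := congrFun hMc i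
    simp only [Matrix.mulVec, dotProduct, Matrix.of_apply, Pi.zero_apply] at h
    rw [← h]
    exact Finset.sum_congr rfl fun k _ => by rw [FiniteField.frobeniusAlgHom_pow_apply, mul_comm]
  have hp : p = 0 := by
    refine Polynomial.eq_zero_of_natDegree_lt_card_of_eval_eq_zero p
      (f := fun a : Fin m → F => ∑ i, a i • v i) ?_ ?_ ?_
    · intro a b hab
      have h := Fintype.linearIndependent_iff.mp hv (fun i => a i - b i) (by
        simp only [sub_smul, Finset.sum_sub_distrib]
        exact sub_eq_zero.mpr hab)
      exact funext fun i => sub_eq_zero.mp (h i)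
    · intro a
      rw [heval]
      simp only [map_sum, map_smul, Finset.mul_sum]
      rw [Finset.sum_comm]
      refine Finset.sum_eq_zero fun i _ => ?_
      simp only [mul_smul_comm]
      rw [← Finset.smul_sum, hbasic, smul_zero]
    · rw [Fintype.card_fun, Fintype.card_fin]
      rcases Nat.eq_zero_or_pos m with rfl | hm
      · simp [p]
      · refine lt_of_le_of_lt (Polynomial.natDegree_sum_le_of_forall_le (n := Fintype.card F ^ (m - 1))
          _ _ fun k _ => ?_) (Nat.pow_lt_pow_right hq (by omega))
        exact (Polynomial.natDegree_monomial_le _).trans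
          (Nat.pow_le_pow_right hq.le (by omega))
  apply hc
  funext k
  have h := congrArg (fun r => Polynomial.coeff r (Fintype.card F ^ (k : ℕ))) hp
  simp only [p, Polynomial.finsetSum_coeff, Polynomial.coeff_monomial, Polynomial.coeff_zero] at h
  rw [Finset.sum_eq_single k] at h
  · simpa using h
  · intro j _ hj
    rw [if_neg]
    intro h2
    exact hj (Fin.ext (Nat.pow_right_injective hq h2))
  · simp

namespace ArtinRepresentation

variable {F E Es : Type*} [Field F] [Field E] [Field Es] [Algebra E Es] {n : ℕ}
  (ρ : ArtinRepresentation F E Es n)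

theorem matrix_one : ρ.matrix 1 = 1 := by
  ext i j
  simp [matrix, Matrix.one_apply, apply_ite Subtype.val]

theorem matrix_mul (g h : Gal(Es/E)) : ρ.matrix (g * h) = ρ.matrix g * ρ.matrix h := by
  ext i j
  simp [matrix, Matrix.mul_apply]

theorem matrix_congr {g h : Gal(Es/E)} (hgh : ρ.toHom g = ρ.toHom h) :
    ρ.matrix g = ρ.matrix h := by
  ext i j
  simp [matrix, hgh]

/-- `ρ` factors through the restriction to a finite Galois extension. -/
theorem exists_factors : ∃ L : IntermediateField E Es, FiniteDimensional E L ∧ IsGalois E L ∧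
    ∀ g h : Gal(Es/E), (∀ x : L, g x = h x) → ρ.toHom g = ρ.toHom h := by
  obtain ⟨L, hL, hG, h1⟩ := ρ.finite_image
  refine ⟨L, hL, hG, fun g h hgh => ?_⟩
  have h2 : ρ.toHom (h⁻¹ * g) = 1 := by
    refine h1 _ ?_
    rw [IntermediateField.mem_fixingSubgroup_iff]
    intro x hx
    rw [AlgEquiv.mul_apply, hgh ⟨x, hx⟩, ← AlgEquiv.mul_apply, inv_mul_cancel, AlgEquiv.one_apply]
  rw [map_mul, map_inv, inv_mul_eq_one] at h2
  exact h2.symm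

/-- The value of `ρ` at `g` depends only on the embedding of `L` into `Es` induced by `g`, and there
are finitely many such embeddings. -/
theorem finite_range : Finite (Set.range ρ.toHom) := by
  obtain ⟨L, hL, hG, h1⟩ := ρ.exists_factors
  let f : Set.range ρ.toHom → (L →ₐ[E] Es) := fun y =>
    (y.2.choose : Es →ₐ[E] Es).comp L.val
  refine Finite.of_injective f fun y z hyz => Subtype.ext ?_
  rw [← y.2.choose_spec, ← z.2.choose_spec]
  exact h1 _ _ fun x => DFunLike.congr_fun hyz x

/-- The field is generated by finitely many algebraic elements. Thus `degree` is the true degree and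
not the default value of `Module.finrank`. -/
instance finiteDimensional_coeffField : FiniteDimensional F ρ.coeffField := by
  have : Finite {x | ∃ (g : Gal(Es/E)) (i j : Fin n), x = (ρ.toHom g).val i j} := by
    have := ρ.finite_range
    have h : {x | ∃ (g : Gal(Es/E)) (i j : Fin n), x = (ρ.toHom g).val i j}
        = Set.range fun y : Set.range ρ.toHom × Fin n × Fin n => y.1.1.val y.2.1 y.2.2 := by
      ext x
      constructor
      · rintro ⟨g, i, j, rfl⟩
        exact ⟨⟨⟨_, g, rfl⟩, i, j⟩, rfl⟩
      · rintro ⟨⟨⟨_, g, rfl⟩, i, j⟩, rfl⟩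
        exact ⟨g, i, j, rfl⟩
    rw [h]
    infer_instance
  exact IntermediateField.finiteDimensional_adjoin fun x _ =>
    (Algebra.IsAlgebraic.isAlgebraic x).isIntegral

variable [Fintype F] [Algebra F E] [Algebra F Es] [IsScalarTower F E Es]

/-- The basis of the representation space given by a basis of the coefficient field. -/
def spaceBasis (α : Module.Basis (Fin ρ.degree) F ρ.coeffField) :
    Module.Basis (Fin (n * ρ.degree)) F ρ.Space :=
  (Pi.basis fun _ : Fin n => α).reindex
    ((Equiv.sigmaEquivProd (Fin n) (Fin ρ.degree)).trans finProdFinEquiv)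

theorem spaceBasis_apply (α : Module.Basis (Fin ρ.degree) F ρ.coeffField) (i : Fin n)
    (j : Fin ρ.degree) : ρ.spaceBasis α (finProdFinEquiv (i, j)) = Pi.single i (α j) := by
  rw [spaceBasis, Module.Basis.reindex_apply]
  simp [Pi.basis_apply]

/-- The `Es`-basis of `Es ⊗ F(ρ) ^ n`. -/
def tensorBasis (α : Module.Basis (Fin ρ.degree) F ρ.coeffField) :
    Module.Basis (Fin (n * ρ.degree)) Es (Es ⊗[F] ρ.Space) :=
  Algebra.TensorProduct.basis Es (ρ.spaceBasis α)

variable (α : Module.Basis (Fin ρ.degree) F ρ.coeffField)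

/-- The basis comes from an `F`-basis of the second factor, and the coordinates in `F` are fixed by
the `q`-power map. -/
theorem tensorBasis_repr_frobeniusSpace (x : Es ⊗[F] ρ.Space) (k : Fin (n * ρ.degree)) :
    (ρ.tensorBasis α).repr (ρ.frobeniusSpace x) k
      = (ρ.tensorBasis α).repr x k ^ Fintype.card F := by
  have hadd := map_add (FiniteField.frobeniusAlgHom F Es)
  simp only [FiniteField.frobeniusAlgHom_apply] at hadd
  induction x with
  | zero => simp
  | add x y hx hy => simp only [map_add, Finsupp.add_apply, hx, hy, hadd]
  | tmul z w =>
    simp only [frobeniusSpace, TensorProduct.map_tmul, tensorBasis,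
      Algebra.TensorProduct.basis_repr_tmul, Finsupp.smul_apply, Finsupp.mapRange_apply,
      LinearMap.id_apply, smul_eq_mul, mul_pow, ← map_pow, FiniteField.pow_card]
    rfl

theorem diagonalAction_semilinear (g : Gal(Es/E)) (c : Es) (x : Es ⊗[F] ρ.Space) :
    ρ.diagonalAction g (c • x) = g c • ρ.diagonalAction g x := by
  induction x with
  | zero => simp
  | add x y hx hy => rw [smul_add, map_add, map_add, smul_add, hx, hy]
  | tmul z w => simp [diagonalAction, TensorProduct.smul_tmul']

/-- Let `f` be a linear form killing the invariants. It kills each trace `t c w = ∑ h(c) ⊗ ρ(h) w`,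
where `h` runs over `Gal(L/E)`. Hence `∑ h(c) f(1 ⊗ ρ(h) w) = 0` for all `c ∈ L`, and Dedekind's
independence of characters gives `f(1 ⊗ w) = 0` from the term `h = 1`. -/
theorem span_invariants_eq_top [IsGalois E Es] :
    Submodule.span Es (ρ.invariants : Set (Es ⊗[F] ρ.Space)) = ⊤ := by
  by_contra hne
  obtain ⟨f, hf0, hf⟩ := Submodule.exists_le_ker_of_lt_top _ (lt_top_iff_ne_top.mpr hne)
  obtain ⟨L, hL, hG, hfac⟩ := ρ.exists_factors
  -- The lifts need not be multiplicative in `h`. It suffices that `ρ` is insensitive to the choice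
  -- of lift.
  let s : Gal(L/E) → Gal(Es/E) := fun h => h.liftNormal Es
  have hs : ∀ (h : Gal(L/E)) (x : L), s h x = (h x : Es) := fun h x =>
    AlgEquiv.liftNormal_commutes h Es x
  let t : L → ρ.Space → Es ⊗[F] ρ.Space := fun c w =>
    ∑ h : Gal(L/E), (h c : Es) ⊗ₜ[F] ((ρ.matrix (s h)).mulVec w)
  have ht : ∀ c w, t c w ∈ ρ.invariants := by
    intro c w g
    let g' : Gal(L/E) := AlgEquiv.restrictNormalHom L g
    have hg' : ∀ x : L, g x = (g' x : Es) := fun x =>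
      (AlgEquiv.restrictNormal_commutes g L x).symm
    simp only [t, map_sum]
    refine Fintype.sum_equiv (Equiv.mulLeft g') _ _ fun h => ?_
    simp only [diagonalAction, TensorProduct.map_tmul, Equiv.coe_mulLeft]
    have h1 : ρ.matrix (s (g' * h)) = ρ.matrix g * ρ.matrix (s h) := by
      rw [← matrix_mul]
      refine ρ.matrix_congr (hfac _ _ fun x => ?_)
      rw [hs, AlgEquiv.mul_apply, AlgEquiv.mul_apply, hs, hg']
    rw [h1, ← Matrix.mulVec_mulVec]
    congr 1
    exact hg' (h c)
  have h0 : ∀ w, f (1 ⊗ₜ[F] w) = 0 := by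
    intro w
    have hli := (linearIndependent_monoidHom L Es).comp
      (fun h : Gal(L/E) => ((algebraMap L Es).toMonoidHom.comp
        (h : L →* L))) (by
          intro h h' hh
          ext x
          exact congrArg (fun k : L →* Es => k x) hh)
    have h1 := Fintype.linearIndependent_iff.mp hli
      (fun h => f (1 ⊗ₜ[F] ((ρ.matrix (s h)).mulVec w))) (by
        funext c
        have h2 : f (t c w) = 0 := hf (Submodule.subset_span (ht c w))
        simp only [t, map_sum] at h2
        rw [Finset.sum_apply, Pi.zero_apply, ← h2]
        refine Finset.sum_congr rfl fun h _ => ?_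
        have h3 : (h c : Es) ⊗ₜ[F] ((ρ.matrix (s h)).mulVec w)
            = (h c : Es) • ((1 : Es) ⊗ₜ[F] ((ρ.matrix (s h)).mulVec w)) := by
          rw [TensorProduct.smul_tmul', smul_eq_mul, mul_one]
        rw [h3, map_smul, Pi.smul_apply, smul_eq_mul, smul_eq_mul, mul_comm]
        rfl) 1
    have h4 : ρ.matrix (s 1) = 1 := by
      rw [← ρ.matrix_one]
      exact ρ.matrix_congr (hfac _ _ fun x => by rw [hs]; rfl)
    simpa only [h4, Matrix.one_mulVec] using h1
  apply hf0
  refine LinearMap.ext fun x => ?_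
  induction x with
  | zero => simp
  | add x y hx hy => rw [map_add, hx, hy]; simp
  | tmul z w =>
    have h3 : z ⊗ₜ[F] w = z • ((1 : Es) ⊗ₜ[F] w) := by
      rw [TensorProduct.smul_tmul', smul_eq_mul, mul_one]
    rw [h3, map_smul, h0, smul_zero, LinearMap.zero_apply]

end ArtinRepresentation
end

/-! ### Bases of invariants and fundamental solutions. -/

noncomputable section

namespace ArtinRepresentation

variable {F E Es : Type*} [Field F] [Field E] [Field Es] [Algebra E Es] {n : ℕ}
  (ρ : ArtinRepresentation F E Es n) [Fintype F] [Algebra F E] [Algebra F Es]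
  [IsScalarTower F E Es] (α : Module.Basis (Fin ρ.degree) F ρ.coeffField)

/-- The coordinates of the invariants with respect to `tensorBasis`. -/
def coord : ρ.invariants →ₗ[E] (Fin (n * ρ.degree) → Es) :=
  ((ρ.tensorBasis α).equivFun.toLinearMap.restrictScalars E).comp ρ.invariants.subtype

theorem coord_apply (x : ρ.invariants) (k : Fin (n * ρ.degree)) :
    ρ.coord α x k = (ρ.tensorBasis α).repr x k := rfl

theorem coord_frobenius (x : ρ.invariants) (k : Fin (n * ρ.degree)) :
    ρ.coord α (ρ.invariantsFrobenius x) k = ρ.coord α x k ^ Fintype.card F :=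
  ρ.tensorBasis_repr_frobeniusSpace α x k

section
variable [IsGalois E Es] (v : Fin (n * ρ.degree) → ρ.invariants)
  (hv : IsUnit (Matrix.of fun i j => ρ.coord α (v i) j).det)

include hv

theorem linearIndependent_coe :
    LinearIndependent Es fun i => (v i : Es ⊗[F] ρ.Space) := by
  have h : LinearIndependent Es (Matrix.of fun i j => ρ.coord α (v i) j).row :=
    Matrix.linearIndependent_rows_iff_isUnit.mpr ((Matrix.isUnit_iff_isUnit_det _).mpr hv)
  exact LinearIndependent.of_comp (ρ.tensorBasis α).equivFun.toLinearMap h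

theorem linearIndependent_of_isUnit_det : LinearIndependent E v := by
  have h := (ρ.linearIndependent_coe α v hv).restrict_scalars (R := E) (by
    intro a b hab
    simpa [Algebra.smul_def] using hab)
  exact LinearIndependent.of_comp ρ.invariants.subtype h

/-- The `v i` form an `Es`-basis of the whole tensor product. Applying `g` to the expansion of an
invariant and using uniqueness of coordinates shows that the coordinates are fixed by `g`, so they
lie in `E`. -/
theorem top_le_span_of_isUnit_det : ⊤ ≤ Submodule.span E (Set.range v) := by
  intro x _
  have hli := ρ.linearIndependent_coe α v hv
  have hcard : Fintype.card (Fin (n * ρ.degree)) = Module.finrank Es (Es ⊗[F] ρ.Space) :=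
    (Module.finrank_eq_card_basis (ρ.tensorBasis α)).symm
  let b := basisOfLinearIndependentOfCardEqFinrank' _ hli hcard
  have hb : ∀ i, b i = v i := fun i => by simp [b]
  have hfix : ∀ g : Gal(Es/E), ∀ i, g (b.repr x i) = b.repr x i := by
    intro g
    have h1 : ρ.diagonalAction g x = ∑ i, g (b.repr x i) • b i := by
      conv_lhs => rw [← b.sum_repr x]
      rw [map_sum]
      refine Finset.sum_congr rfl fun i _ => ?_
      rw [diagonalAction_semilinear, hb, (v i).2 g]
    rw [x.2 g] at h1
    intro i
    have h2 := congrArg (fun y => b.repr y i) h1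
    simp only [b.repr_sum_self] at h2
    exact h2.symm
  have hmem : ∀ i, ∃ c : E, algebraMap E Es c = b.repr x i := fun i =>
    (InfiniteGalois.mem_range_algebraMap_iff_fixed _).mpr fun g => hfix g i
  choose c hc using hmem
  have hx : x = ∑ i, c i • v i := by
    refine Subtype.ext ?_
    conv_lhs => rw [← b.sum_repr x]
    simp only [← hc, hb]
    simp
  rw [hx]
  exact Submodule.sum_mem _ fun i _ => Submodule.smul_mem _ _ (Submodule.subset_span ⟨i, rfl⟩)

/-- Invariants with an invertible coordinate matrix trivialize the space of invariants. -/
def trivializedSpace :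
    TrivializedSpace F E Es ρ.invariants ρ.invariantsFrobenius (n * ρ.degree) where
  basis := Module.Basis.mk (ρ.linearIndependent_of_isUnit_det α v hv)
    (ρ.top_le_span_of_isUnit_det α v hv)
  coord := ρ.coord α
  coord_frobenius := ρ.coord_frobenius α
  isUnit_det := by simpa using hv

theorem trivializedSpace_matrix :
    (ρ.trivializedSpace α v hv).matrix = Matrix.of fun i j => ρ.coord α (v i) j := by
  ext i j
  simp [TrivializedSpace.matrix, trivializedSpace]

end

theorem exists_isUnit_det [IsGalois E Es] : ∃ v : Fin (n * ρ.degree) → ρ.invariants,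
    IsUnit (Matrix.of fun i j => ρ.coord α (v i) j).det := by
  have : FiniteDimensional Es (Es ⊗[F] ρ.Space) := (ρ.tensorBasis α).finiteDimensional_of_finite
  obtain ⟨f, hf, hspan, hli⟩ :=
    Submodule.exists_fun_fin_finrank_span_eq Es (ρ.invariants : Set (Es ⊗[F] ρ.Space))
  have hcard : Module.finrank Es (Submodule.span Es (ρ.invariants : Set (Es ⊗[F] ρ.Space)))
      = n * ρ.degree := by
    rw [span_invariants_eq_top, finrank_top, Module.finrank_eq_card_basis (ρ.tensorBasis α),
      Fintype.card_fin]
  let e := finCongr hcard.symm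
  refine ⟨fun i => ⟨f (e i), hf _⟩, ?_⟩
  rw [← Matrix.isUnit_iff_isUnit_det, ← Matrix.linearIndependent_rows_iff_isUnit]
  exact (hli.comp e e.injective).map' (ρ.tensorBasis α).equivFun.toLinearMap
    (LinearEquiv.ker _)

/-- Each nonzero `c ∈ F^N` defines the `E`-subspace of invariants whose coordinates satisfy the
relation `c`. There are finitely many such `c`, and a vector space over the infinite field `E` is
not a finite union of proper subspaces. -/
theorem exists_coord_linearIndependent [IsGalois E Es] [Infinite E] :
    ∃ x : ρ.invariants, LinearIndependent F (ρ.coord α x) := by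
  obtain ⟨v, hv⟩ := ρ.exists_isUnit_det α
  by_contra hcon
  push Not at hcon
  let l : (Fin (n * ρ.degree) → F) → (Fin (n * ρ.degree) → Es) →ₗ[E] Es := fun c =>
    ∑ k, algebraMap F E (c k) • LinearMap.proj k
  have hl : ∀ c y, l c y = ∑ k, c k • y k := by
    intro c y
    simp only [l, LinearMap.sum_apply, LinearMap.smul_apply, LinearMap.proj_apply,
      algebraMap_smul]
  let p : {c : Fin (n * ρ.degree) → F // c ≠ 0} → Subspace E ρ.invariants := fun c =>
    LinearMap.ker ((l c.1).comp (ρ.coord α))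
  obtain ⟨⟨c, hc⟩, hp⟩ := Subspace.exists_eq_top_of_iUnion_eq_univ (p := p) (by
    refine Set.eq_univ_of_forall fun x => ?_
    have h := hcon x
    rw [Fintype.linearIndependent_iff] at h
    push Not at h
    obtain ⟨c, hc, i, hi⟩ := h
    refine Set.mem_iUnion.mpr ⟨⟨c, fun h0 => hi (congrFun h0 i)⟩, ?_⟩
    change l c (ρ.coord α x) = 0
    rw [hl, hc])
  -- If the subspace of `c` were everything, `c` would be in the kernel of the invertible coordinate
  -- matrix.
  have h0 : Matrix.mulVec (Matrix.of fun i j => ρ.coord α (v i) j)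
      (fun k => algebraMap F Es (c k)) = 0 := by
    funext i
    have h : v i ∈ p ⟨c, hc⟩ := by rw [hp]; trivial
    have h' : l c (ρ.coord α (v i)) = 0 := h
    rw [hl] at h'
    rw [Pi.zero_apply, ← h']
    simp only [Matrix.mulVec, dotProduct, Matrix.of_apply, Algebra.smul_def, mul_comm]
  have h1 := Matrix.eq_zero_of_mulVec_eq_zero hv.ne_zero h0
  apply hc
  funext k
  exact (algebraMap F Es).injective ((congrFun h1 k).trans (map_zero _).symm)

/-- Evaluation of `Es ⊗ F(ρ) ^ n` along the `l`-th Frobenius twist of an embedding. -/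
def evalTwist (ε : ρ.coeffField →ₐ[F] Es) (l : ℕ) : Es ⊗[F] ρ.Space →ₗ[F] (Fin n → Es) :=
  TensorProduct.lift (LinearMap.mk₂ F
    (fun z w i => z * (FiniteField.frobeniusAlgHom F Es ^ l) (ε (w i)))
    (fun z z' w => funext fun i => add_mul _ _ _)
    (fun c z w => funext fun i => smul_mul_assoc _ _ _)
    (fun z w w' => funext fun i => by simp [mul_add])
    (fun c z w => funext fun i => by simp))

theorem evalTwist_tmul (ε : ρ.coeffField →ₐ[F] Es) (l : ℕ) (z : Es) (w : ρ.Space) (i : Fin n) :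
    ρ.evalTwist ε l (z ⊗ₜ w) i = z * (ε (w i)) ^ Fintype.card F ^ l := by
  rw [← FiniteField.frobeniusAlgHom_pow_apply F]
  rfl

/-- The element of `Es ⊗ F(ρ) ^ n` with coordinates `u`. -/
def ofMatrix (u : Matrix (Fin n) (Fin ρ.degree) Es) : Es ⊗[F] ρ.Space :=
  ∑ i, ∑ j, u i j ⊗ₜ[F] (Pi.single i (α j) : ρ.Space)

theorem repr_ofMatrix (u : Matrix (Fin n) (Fin ρ.degree) Es) (i : Fin n) (j : Fin ρ.degree) :
    (ρ.tensorBasis α).repr (ρ.ofMatrix α u) (finProdFinEquiv (i, j)) = u i j := by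
  have h : ρ.ofMatrix α u
      = ∑ k, u (finProdFinEquiv.symm k).1 (finProdFinEquiv.symm k).2 • ρ.tensorBasis α k := by
    rw [ofMatrix, ← Finset.sum_product', Finset.univ_product_univ]
    refine Fintype.sum_equiv finProdFinEquiv _ _ fun x => ?_
    rw [Equiv.symm_apply_apply, tensorBasis, Algebra.TensorProduct.basis_apply,
      TensorProduct.smul_tmul', smul_eq_mul, mul_one, spaceBasis_apply]
  rw [h, Module.Basis.repr_sum_self, Equiv.symm_apply_apply]

/-- This recognises the left side of the defining equation of a solution as an evaluation of the
Galois action; the right side is the case `g = 1`. -/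
theorem evalTwist_diagonalAction_ofMatrix (ε : ρ.coeffField →ₐ[F] Es) (l : ℕ) (g : Gal(Es/E))
    (u : Matrix (Fin n) (Fin ρ.degree) Es) :
    ρ.evalTwist ε l (ρ.diagonalAction g (ρ.ofMatrix α u))
      = Matrix.mulVec ((ρ.matrix g).map (fun c => ε c ^ Fintype.card F ^ l))
        (Matrix.mulVec (u.map g) fun j => ε (α j) ^ Fintype.card F ^ l) := by
  funext k
  simp only [ofMatrix, map_sum, Finset.sum_apply, diagonalAction, TensorProduct.map_tmul,
    evalTwist_tmul, Matrix.mulVec, dotProduct, Matrix.map_apply, Finset.mul_sum]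
  refine Finset.sum_congr rfl fun i _ => Finset.sum_congr rfl fun j _ => ?_
  have h : ((ρ.matrix g).mulVecLin.restrictScalars F (Pi.single i (α j) : ρ.Space)) k
      = ρ.matrix g k i * α j := by
    simp [Matrix.mulVec_single]
  rw [h, map_mul, mul_pow]
  change g (u i j) * _ = _
  ring

theorem evalTwist_ofMatrix (ε : ρ.coeffField →ₐ[F] Es) (l : ℕ)
    (u : Matrix (Fin n) (Fin ρ.degree) Es) :
    ρ.evalTwist ε l (ρ.ofMatrix α u)
      = Matrix.mulVec u fun j => ε (α j) ^ Fintype.card F ^ l := by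
  have h := ρ.evalTwist_diagonalAction_ofMatrix α ε l 1 u
  have h1 : (ρ.matrix 1).map (fun c => ε c ^ Fintype.card F ^ l) = 1 := by
    rw [matrix_one]
    exact Matrix.map_one _ (by simp) (by simp)
  have h2 : ρ.diagonalAction 1 (ρ.ofMatrix α u) = ρ.ofMatrix α u := by
    have h3 : ρ.diagonalAction 1 = LinearMap.id := by
      refine TensorProduct.ext' fun z w => ?_
      simp [diagonalAction, matrix_one]
    rw [h3, LinearMap.id_apply]
  rw [h1, h2, Matrix.one_mulVec] at h
  exact h

theorem ofMatrix_surjective : Function.Surjective (ρ.ofMatrix α) := by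
  intro x
  refine ⟨Matrix.of fun i j => (ρ.tensorBasis α).repr x (finProdFinEquiv (i, j)), ?_⟩
  refine (ρ.tensorBasis α).repr.injective (Finsupp.ext fun k => ?_)
  obtain ⟨⟨i, j⟩, rfl⟩ := finProdFinEquiv.surjective k
  rw [repr_ofMatrix, Matrix.of_apply]

/-- The evaluations for `l < d` are the coordinates multiplied by the Moore matrix of a basis of
`F(ρ)`, which is invertible. -/
theorem eq_of_evalTwist_eq (ε : ρ.coeffField →ₐ[F] Es) {x y : Es ⊗[F] ρ.Space}
    (h : ∀ l < ρ.degree, ρ.evalTwist ε l x = ρ.evalTwist ε l y) : x = y := by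
  let α := Module.finBasis F ρ.coeffField
  have hli : LinearIndependent F fun j => ε (α j) :=
    α.linearIndependent.map' ε.toLinearMap (LinearMap.ker_eq_bot.mpr ε.injective)
  have hM := isUnit_det_moore hli
  rw [← sub_eq_zero]
  obtain ⟨u, hu⟩ := ρ.ofMatrix_surjective α (x - y)
  have hu0 : u = 0 := by
    ext i j
    refine congrFun (Matrix.eq_zero_of_vecMul_eq_zero hM.ne_zero (v := u i) ?_) j
    funext l
    have h1 := congrFun (ρ.evalTwist_ofMatrix α ε l u) i
    rw [hu, map_sub, h l l.2, sub_self] at h1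
    exact h1.symm
  rw [← hu, hu0]
  simp [ofMatrix]

theorem isSolution_iff (ε : ρ.coeffField →ₐ[F] Es) (u : Matrix (Fin n) (Fin ρ.degree) Es) :
    ρ.IsSolution ε α u ↔ ρ.ofMatrix α u ∈ ρ.invariants := by
  constructor
  · intro h g
    refine ρ.eq_of_evalTwist_eq ε fun l hl => ?_
    rw [evalTwist_diagonalAction_ofMatrix, evalTwist_ofMatrix, h g l hl]
  · intro h g l _
    rw [← evalTwist_diagonalAction_ofMatrix, ← evalTwist_ofMatrix, h g]

theorem exists_isFundamentalSolution [IsGalois E Es] [Infinite E] (ε : ρ.coeffField →ₐ[F] Es) :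
    ∃ u, ρ.IsFundamentalSolution ε α u := by
  obtain ⟨x, hx⟩ := ρ.exists_coord_linearIndependent α
  obtain ⟨u, hu⟩ := ρ.ofMatrix_surjective α x
  refine ⟨u, (ρ.isSolution_iff α ε u).mpr (hu ▸ x.2), ?_⟩
  have h : (fun ij : Fin n × Fin ρ.degree => u ij.1 ij.2) = ρ.coord α x ∘ finProdFinEquiv := by
    funext ⟨i, j⟩
    rw [Function.comp_apply, coord_apply, ← hu, repr_ofMatrix]
  rw [h]
  exact hx.comp _ finProdFinEquiv.injective

theorem isUnit_det_frobeniusMatrix {ε : ρ.coeffField →ₐ[F] Es}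
    {u : Matrix (Fin n) (Fin ρ.degree) Es} (hu : ρ.IsFundamentalSolution ε α u) :
    IsUnit (frobeniusMatrix F u).det :=
  isUnit_det_moore (hu.2.comp _ finProdFinEquiv.symm.injective)

/-- Take the invariant `x` with coordinates `u` and its images under the iterates of Frobenius. The
coordinates of the `k`-th iterate are `u^(k)`, which is a row of the transposed Moore matrix. -/
theorem exists_coord_eq_frobeniusMatrix {ε : ρ.coeffField →ₐ[F] Es}
    {u : Matrix (Fin n) (Fin ρ.degree) Es} (hu : ρ.IsFundamentalSolution ε α u) :
    ∃ v : Fin (n * ρ.degree) → ρ.invariants,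
      (Matrix.of fun i j => ρ.coord α (v i) j) = (frobeniusMatrix F u).transpose := by
  let x : ρ.invariants := ⟨ρ.ofMatrix α u, (ρ.isSolution_iff α ε u).mp hu.1⟩
  have hit : ∀ (l : ℕ) k, ρ.coord α (ρ.invariantsFrobenius^[l] x) k
      = ρ.coord α x k ^ Fintype.card F ^ l := by
    intro l k
    induction l with
    | zero => simp
    | succ l ih =>
      rw [Function.iterate_succ_apply', ρ.coord_frobenius, ih, ← pow_mul, pow_succ]
  refine ⟨fun k => ρ.invariantsFrobenius^[(k : ℕ)] x, ?_⟩
  ext k m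
  obtain ⟨⟨i, j⟩, rfl⟩ := finProdFinEquiv.surjective m
  rw [Matrix.of_apply, hit, coord_apply, repr_ofMatrix]
  rw [Matrix.transpose_apply, frobeniusMatrix, Matrix.of_apply, Equiv.symm_apply_apply]

end ArtinRepresentation
end

/-! ### Formal twisted power series. -/

noncomputable section

namespace TwistedSeries

open Finset.HasAntidiagonal

variable {S T : Type*} [Ring S] [Ring T] (θ : S →+* S)

/-- The product of twisted power series `∑ f_k τ ^ k` over `S`, where `τ c = θ c τ`. -/
def mul (f g : ℕ → S) (k : ℕ) : S :=
  ∑ p ∈ antidiagonal k, f p.1 * (θ ^ p.1) (g p.2)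

/-- The constant series. -/
def const (c : S) (k : ℕ) : S := if k = 0 then c else 0

@[simp] theorem const_zero_apply (c : S) : const c 0 = c := rfl

theorem mul_assoc (f g h : ℕ → S) : mul θ (mul θ f g) h = mul θ f (mul θ g h) := by
  funext n
  simp only [mul, Finset.sum_mul, Finset.mul_sum, map_sum, Finset.sum_sigma']
  refine Finset.sum_nbij' (fun ⟨⟨_i, j⟩, ⟨k, l⟩⟩ => ⟨(k, l + j), (l, j)⟩)
    (fun ⟨⟨i, _j⟩, ⟨k, l⟩⟩ => ⟨(i + k, l), (i, k)⟩) ?_ ?_ ?_ ?_ ?_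
  · rintro ⟨⟨i, j⟩, ⟨k, l⟩⟩ h
    simp only [Finset.mem_sigma, mem_antidiagonal] at h ⊢
    obtain ⟨h1, h2⟩ := h
    exact ⟨by omega, trivial⟩
  · rintro ⟨⟨i, j⟩, ⟨k, l⟩⟩ h
    simp only [Finset.mem_sigma, mem_antidiagonal] at h ⊢
    obtain ⟨h1, h2⟩ := h
    exact ⟨by omega, trivial⟩
  · rintro ⟨⟨i, j⟩, ⟨k, l⟩⟩ h
    simp only [Finset.mem_sigma, mem_antidiagonal] at h
    obtain ⟨-, rfl⟩ := h
    rfl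
  · rintro ⟨⟨i, j⟩, ⟨k, l⟩⟩ h
    simp only [Finset.mem_sigma, mem_antidiagonal] at h
    obtain ⟨-, rfl⟩ := h
    rfl
  · rintro ⟨⟨i, j⟩, ⟨k, l⟩⟩ h
    simp only [Finset.mem_sigma, mem_antidiagonal] at h
    obtain ⟨-, rfl⟩ := h
    simp only [map_mul, pow_add, RingHom.mul_def, RingHom.comp_apply, _root_.mul_assoc]

theorem mul_const (f : ℕ → S) (c : S) (k : ℕ) : mul θ f (const c) k = f k * (θ ^ k) c := by
  rw [mul, Finset.sum_eq_single (k, 0)]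
  · simp
  · rintro ⟨i, j⟩ hij hne
    rw [mem_antidiagonal] at hij
    have : j ≠ 0 := by
      rintro rfl
      exact hne (by simpa using hij)
    simp [const, this]
  · simp

theorem const_mul (c : S) (f : ℕ → S) (k : ℕ) : mul θ (const c) f k = c * f k := by
  rw [mul, Finset.sum_eq_single (0, k)]
  · simp
  · rintro ⟨i, j⟩ hij hne
    rw [mem_antidiagonal] at hij
    have : i ≠ 0 := by
      rintro rfl
      exact hne (by simpa using hij)
    simp [const, this]
  · simp

theorem const_mul_const (c d : S) : mul θ (const c) (const d) = const (c * d) := by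
  funext k
  rw [const_mul]
  by_cases hk : k = 0 <;> simp [const, hk]

theorem mul_zero_apply (f g : ℕ → S) : mul θ f g 0 = f 0 * g 0 := by
  simp [mul]

theorem sub_mul (f f' g : ℕ → S) : mul θ (f - f') g = mul θ f g - mul θ f' g := by
  funext k
  simp [mul, _root_.sub_mul]

theorem mul_sub (f g g' : ℕ → S) : mul θ f (g - g') = mul θ f g - mul θ f g' := by
  funext k
  simp [mul, _root_.mul_sub]

/-- Used to pass from scalar series to series of scalar matrices. -/
theorem comp_mul (θ' : T →+* T) (h : S →+* T) (hθ : ∀ x, h (θ x) = θ' (h x)) (f g : ℕ → S) :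
    (fun k => h (mul θ f g k)) = mul θ' (fun k => h (f k)) (fun k => h (g k)) := by
  have hpow : ∀ (i : ℕ) x, h ((θ ^ i) x) = (θ' ^ i) (h x) := by
    intro i
    induction i with
    | zero => intro x; rfl
    | succ i ih =>
      intro x
      rw [pow_succ, RingHom.mul_def, RingHom.comp_apply, ih, hθ, pow_succ, RingHom.mul_def,
        RingHom.comp_apply]
  funext k
  simp only [mul, map_sum, map_mul, hpow]

end TwistedSeries

/-- Summation of the convolution of finitely many additive operators with a convergent series. -/
theorem HasSum.antidiagonal_apply {M : Type*} [AddCommGroup M] [TopologicalSpace M]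
    [ContinuousAdd M] {h : ℕ → M} {y : M} (hy : HasSum h y) (t : ℕ → M →+ M)
    (ht : ∀ i, Continuous (t i)) {n : ℕ} (hn : ∀ i, n ≤ i → t i = 0) :
    HasSum (fun k => ∑ p ∈ Finset.HasAntidiagonal.antidiagonal k, t p.1 (h p.2))
      (∑ i ∈ Finset.range n, t i y) := by
  -- The convolution is a finite sum of shifted series: `s i` is the image of `h` under `t i`,
  -- delayed by `i` places.
  let s : ℕ → ℕ → M := fun i k => if i ≤ k then t i (h (k - i)) else 0
  have hs : ∀ i, HasSum (s i) (t i y) := by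
    intro i
    rw [← (add_left_injective i).hasSum_iff]
    · have h1 : s i ∘ (fun k => k + i) = fun k => t i (h k) := by
        funext k
        simp [s]
      rw [h1]
      exact hy.map (t i) (ht i)
    · intro k hk
      refine if_neg fun hik => hk ⟨k - i, ?_⟩
      change k - i + i = k
      omega
  have h2 := hasSum_sum (s := Finset.range n) fun i _ => hs i
  convert h2 using 1
  funext k
  -- The antidiagonal runs over `i ≤ k` and the operators over `i < n`. Both ranges extend by zero
  -- to a common one.
  have hsub : ∀ m ≤ max (k + 1) n, (∀ i, m ≤ i → s i k = 0) →
      ∑ i ∈ Finset.range m, s i k = ∑ i ∈ Finset.range (max (k + 1) n), s i k := by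
    intro m hle hm
    exact Finset.sum_subset (Finset.range_mono hle) fun i _ hi => hm i (by simpa using hi)
  have h3 := hsub (k + 1) (le_max_left _ _) fun i hi => if_neg (by omega)
  have h4 := hsub n (le_max_right _ _) fun i hi => by simp [s, hn i hi]
  rw [h4, ← h3, Finset.Nat.sum_antidiagonal_eq_sum_range_succ_mk]
  refine Finset.sum_congr rfl fun i hi => ?_
  exact (if_pos (by simpa [Nat.lt_succ_iff] using hi)).symm
end

/-! ### Coefficients of the exponential and their growth. -/

noncomputable section

namespace ExponentialSeries

open Filter Topology

variable (F : Type*) {L : Type*} [Field F] [Fintype F] [NormedField L] [Algebra F L]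

/-- The coefficients of the formal exponential attached to `∑ c_i τ ^ i`, with `e_0 = 1`. -/
def coeff (c : ℕ → L) : ℕ → L
  | 0 => 1
  -- Comparing coefficients of `τ^(k+1)` in `e c_0 = c e` gives `e_{k+1} c_0^(q^(k+1)) = c_0 e_{k+1}
  -- + ∑ c_{i+1} e_{k-i}^(q^(i+1))`, which is solved for `e_{k+1}`.
  | k + 1 => (c 0 ^ Fintype.card F ^ (k + 1) - c 0)⁻¹ *
      ∑ i : Fin (k + 1), c (i + 1) * coeff c (k - i) ^ Fintype.card F ^ ((i : ℕ) + 1)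
  decreasing_by omega

theorem coeff_zero (c : ℕ → L) : coeff F c 0 = 1 := by rw [coeff]

theorem coeff_succ (c : ℕ → L) (k : ℕ) :
    coeff F c (k + 1) = (c 0 ^ Fintype.card F ^ (k + 1) - c 0)⁻¹ *
      ∑ i : Fin (k + 1), c (i + 1) * coeff F c (k - i) ^ Fintype.card F ^ ((i : ℕ) + 1) := by
  rw [coeff]

theorem frobenius_pow_apply (i : ℕ) (x : L) :
    ((FiniteField.frobeniusAlgHom F L : L →+* L) ^ i) x = x ^ Fintype.card F ^ i := by
  rw [← FiniteField.frobeniusAlgHom_pow_apply F]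
  induction i generalizing x with
  | zero => rfl
  | succ i ih =>
    rw [pow_succ, pow_succ, RingHom.mul_def, RingHom.comp_apply, ih, AlgHom.mul_apply]
    rfl

theorem mul_apply_succ (f g : ℕ → L) (k : ℕ) :
    TwistedSeries.mul (FiniteField.frobeniusAlgHom F L : L →+* L) f g (k + 1)
      = f 0 * g (k + 1) + ∑ i : Fin (k + 1), f (i + 1) * g (k - i) ^ Fintype.card F ^ ((i : ℕ) + 1) := by
  rw [TwistedSeries.mul, Finset.Nat.sum_antidiagonal_eq_sum_range_succ_mk,
    Finset.sum_range_succ', add_comm, Finset.sum_range]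
  congr 1
  refine Finset.sum_congr rfl fun i _ => ?_
  rw [frobenius_pow_apply]
  congr 3
  omega

variable {F}

theorem card_pow_pos (k : ℕ) : 0 < Fintype.card F ^ k := pow_pos Fintype.card_pos k

theorem le_card_pow (k : ℕ) : k + 1 ≤ Fintype.card F ^ k :=
  Nat.lt_pow_self Fintype.one_lt_card

theorem one_lt_card_pow_succ (k : ℕ) : 1 < Fintype.card F ^ (k + 1) :=
  Nat.one_lt_pow (Nat.succ_ne_zero k) Fintype.one_lt_card

section
variable [IsUltrametricDist L] {c : ℕ → L}

/-- As `‖c 0‖ > 1`, the power strictly dominates and the ultrametric inequality is an equality. -/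
theorem norm_pow_sub (h1 : 1 < ‖c 0‖) (k : ℕ) :
    ‖c 0 ^ Fintype.card F ^ (k + 1) - c 0‖ = ‖c 0‖ ^ Fintype.card F ^ (k + 1) := by
  have h : ‖c 0‖ < ‖c 0 ^ Fintype.card F ^ (k + 1)‖ := by
    rw [norm_pow]
    calc ‖c 0‖ = ‖c 0‖ ^ 1 := (pow_one _).symm
      _ < _ := pow_lt_pow_right₀ h1 (one_lt_card_pow_succ k)
  rw [sub_eq_add_neg, IsUltrametricDist.norm_add_eq_max_of_norm_ne_norm (by rw [norm_neg]; exact h.ne'),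
    norm_neg, max_eq_left h.le, norm_pow]

theorem pow_sub_ne_zero (h1 : 1 < ‖c 0‖) (k : ℕ) : c 0 ^ Fintype.card F ^ (k + 1) - c 0 ≠ 0 := by
  rw [← norm_ne_zero_iff, norm_pow_sub h1]
  exact pow_ne_zero _ (by linarith)

/-- The functional equation of the exponential. -/
theorem mul_const_eq (h1 : 1 < ‖c 0‖) :
    TwistedSeries.mul (FiniteField.frobeniusAlgHom F L : L →+* L) (coeff F c)
        (TwistedSeries.const (c 0))
      = TwistedSeries.mul (FiniteField.frobeniusAlgHom F L : L →+* L) c (coeff F c) := by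
  funext k
  rw [TwistedSeries.mul_const, frobenius_pow_apply]
  cases k with
  | zero => simp [TwistedSeries.mul_zero_apply, coeff_zero]
  | succ k =>
    rw [mul_apply_succ]
    have h := coeff_succ F c k
    rw [eq_inv_mul_iff_mul_eq₀ (pow_sub_ne_zero h1 k)] at h
    rw [← h]
    ring

/-- A series with vanishing constant term satisfying the functional equation is zero. -/
theorem eq_zero_of_mul_const_eq (h1 : 1 < ‖c 0‖) {f : ℕ → L} (hf0 : f 0 = 0)
    (hf : TwistedSeries.mul (FiniteField.frobeniusAlgHom F L : L →+* L) f
        (TwistedSeries.const (c 0))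
      = TwistedSeries.mul (FiniteField.frobeniusAlgHom F L : L →+* L) c f) : f = 0 := by
  funext k
  induction k using Nat.strong_induction_on with
  | _ k ih =>
    cases k with
    | zero => exact hf0
    | succ k =>
      have h := congrFun hf (k + 1)
      rw [TwistedSeries.mul_const, frobenius_pow_apply, mul_apply_succ, Finset.sum_eq_zero, add_zero,
        mul_comm, ← sub_eq_zero, ← _root_.sub_mul] at h
      · exact (mul_eq_zero.mp h).resolve_left (pow_sub_ne_zero h1 k)
      · intro i _
        rw [ih (k - i) (by omega), Pi.zero_apply, zero_pow (card_pow_pos _).ne', mul_zero]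

theorem norm_coeff_succ_le (h1 : 1 < ‖c 0‖) {k : ℕ} {D : ℝ} (hD : 0 ≤ D)
    (h : ∀ i : Fin (k + 1), ‖c (i + 1)‖ * ‖coeff F c (k - i)‖ ^ Fintype.card F ^ ((i : ℕ) + 1)
      ≤ ‖c 0‖ ^ Fintype.card F ^ (k + 1) * D) : ‖coeff F c (k + 1)‖ ≤ D := by
  have h0 : 0 < ‖c 0‖ ^ Fintype.card F ^ (k + 1) := pow_pos (by linarith) _
  rw [coeff_succ, norm_mul, norm_inv, norm_pow_sub h1, inv_mul_le_iff₀ h0]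
  refine IsUltrametricDist.norm_sum_le_of_forall_le_of_nonneg (by positivity) fun i _ => ?_
  rw [norm_mul, norm_pow]
  exact h i

theorem tendsto_pow_card {t : ℝ} (ht : 1 < t) :
    Tendsto (fun k => t ^ Fintype.card F ^ k) atTop atTop :=
  (tendsto_pow_atTop_atTop_of_one_lt ht).comp
    (tendsto_pow_atTop_atTop_of_one_lt (Fintype.one_lt_card (α := F)))

/-- Bounds of the form `B^(q^k)` reproduce themselves in the recursion, because `(k - i) + (i + 1) =
k + 1`. -/
theorem pow_pow_sub {B : ℝ} {k : ℕ} (i : Fin (k + 1)) :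
    (B ^ Fintype.card F ^ (k - i)) ^ Fintype.card F ^ ((i : ℕ) + 1) = B ^ Fintype.card F ^ (k + 1) := by
  rw [← pow_mul, ← pow_add]
  congr 2
  omega

/-- Once `‖c 0‖^(q^k) ≥ C`, the denominator of the recursion absorbs the `c i`, and a bound
`B^(q^k)` propagates by induction. -/
theorem exists_norm_coeff_le (h1 : 1 < ‖c 0‖) {C : ℝ} (hC : ∀ i, ‖c i‖ ≤ C) :
    ∃ B : ℝ, 1 ≤ B ∧ ∀ k, ‖coeff F c k‖ ≤ B ^ Fintype.card F ^ k := by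
  obtain ⟨k₀, hk₀⟩ := eventually_atTop.mp
    ((tendsto_pow_card (F := F) h1).eventually_ge_atTop C)
  have hC0 : 0 ≤ C := (norm_nonneg _).trans (hC 0)
  -- The sum covers the initial coefficients, and the summand `1` ensures `B ≤ B^(q^k)`.
  let B : ℝ := 1 + ∑ i ∈ Finset.range (k₀ + 1), ‖coeff F c i‖
  have hB : 1 ≤ B := le_add_of_nonneg_right (Finset.sum_nonneg fun i _ => norm_nonneg _)
  refine ⟨B, hB, fun k => ?_⟩
  induction k using Nat.strong_induction_on with
  | _ k ih =>
    rcases le_or_gt k k₀ with hk | hk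
    · refine le_trans ?_ (le_self_pow₀ hB (card_pow_pos k).ne')
      have h := Finset.single_le_sum (f := fun i => ‖coeff F c i‖) (s := Finset.range (k₀ + 1))
        (fun i _ => norm_nonneg _) (Finset.mem_range.mpr (Nat.lt_succ_of_le hk))
      exact h.trans (by simp [B])
    · obtain ⟨k, rfl⟩ : ∃ m, k = m + 1 := ⟨k - 1, by omega⟩
      refine norm_coeff_succ_le h1 (by positivity) fun i => ?_
      rw [← pow_pow_sub (F := F) (B := B) i]
      refine mul_le_mul ((hC _).trans (hk₀ (k + 1) hk.le)) ?_ (by positivity) (by positivity)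
      exact pow_le_pow_left₀ (norm_nonneg _) (ih (k - i) (by omega)) _

theorem exists_forall_norm_le {c : ℕ → L} {r : ℕ} (hr : ∀ i, r ≤ i → c i = 0) :
    ∃ C : ℝ, ∀ i, ‖c i‖ ≤ C := by
  refine ⟨∑ i ∈ Finset.range r, ‖c i‖, fun i => ?_⟩
  rcases lt_or_ge i r with hi | hi
  · exact Finset.single_le_sum (f := fun i => ‖c i‖) (fun i _ => norm_nonneg _)
      (Finset.mem_range.mpr hi)
  · rw [hr i hi, norm_zero]
    exact Finset.sum_nonneg fun i _ => norm_nonneg _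

/-- Bootstrapping. Fix `θ` with `‖c 0‖⁻¹ < θ < 1`. Since `(‖c 0‖ θ)^(q^k)` eventually exceeds `C`,
an eventual bound `D^(q^k)` improves to `(θ D)^(q^k)`. Enough repetitions bring the base below `ρ`.
-/
theorem eventually_norm_coeff_le (h1 : 1 < ‖c 0‖) {r : ℕ} (hr : ∀ i, r ≤ i → c i = 0) {ρ : ℝ}
    (hρ : 0 < ρ) : ∀ᶠ k in atTop, ‖coeff F c k‖ ≤ ρ ^ Fintype.card F ^ k := by
  obtain ⟨C, hC⟩ := exists_forall_norm_le hr
  obtain ⟨B, hB1, hB⟩ := exists_norm_coeff_le (F := F) h1 hC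
  have hα : 0 < ‖c 0‖ := by linarith
  obtain ⟨θ, hθ0, hθ1⟩ := exists_between (inv_lt_one_of_one_lt₀ h1)
  have hθpos : 0 < θ := (inv_pos.mpr hα).trans hθ0
  have hθα : 1 < ‖c 0‖ * θ := by
    rwa [inv_lt_iff_one_lt_mul₀' hα] at hθ0
  have step : ∀ m : ℕ, ∀ᶠ k in atTop, ‖coeff F c k‖ ≤ (θ ^ m * B) ^ Fintype.card F ^ k := by
    intro m
    induction m with
    | zero =>
      simp only [pow_zero, one_mul]
      exact Eventually.of_forall hB
    | succ m ih =>
      obtain ⟨k₁, hk₁⟩ := eventually_atTop.mp ih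
      obtain ⟨k₂, hk₂⟩ := eventually_atTop.mp
        ((tendsto_pow_card (F := F) hθα).eventually_ge_atTop C)
      -- Only the terms with `i + 1 < r` contribute, so beyond this threshold every index `k - i`
      -- that occurs is at least `k₁`.
      refine eventually_atTop.mpr ⟨k₁ + k₂ + r + 1, fun k hk => ?_⟩
      obtain ⟨k, rfl⟩ : ∃ m, k = m + 1 := ⟨k - 1, by omega⟩
      have hpos : 0 < θ ^ m * B := by positivity
      refine norm_coeff_succ_le h1 (by positivity) fun i => ?_
      rcases lt_or_ge ((i : ℕ) + 1) r with hi | hi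
      · have e : ‖c 0‖ ^ Fintype.card F ^ (k + 1) * (θ ^ (m + 1) * B) ^ Fintype.card F ^ (k + 1)
            = (‖c 0‖ * θ) ^ Fintype.card F ^ (k + 1) * (θ ^ m * B) ^ Fintype.card F ^ (k + 1) := by
          rw [← mul_pow, ← mul_pow]
          congr 1
          ring
        rw [e, ← pow_pow_sub (F := F) (B := θ ^ m * B) i]
        refine mul_le_mul ((hC _).trans (hk₂ (k + 1) (by omega))) ?_ (by positivity) (by positivity)
        exact pow_le_pow_left₀ (norm_nonneg _) (hk₁ (k - i) (by omega)) _
      · rw [hr _ hi, norm_zero, zero_mul]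
        positivity
  have hlim : Tendsto (fun m : ℕ => θ ^ m * B) atTop (𝓝 0) := by
    simpa using (tendsto_pow_atTop_nhds_zero_of_lt_one hθpos.le hθ1).mul_const B
  obtain ⟨m, hm⟩ := (hlim.eventually_le_const hρ).exists
  filter_upwards [step m] with k hk
  exact hk.trans (pow_le_pow_left₀ (by positivity) hm _)

theorem summable (h1 : 1 < ‖c 0‖) {r : ℕ} (hr : ∀ i, r ≤ i → c i = 0) [CompleteSpace L] (x : L) :
    Summable fun k => coeff F c k * x ^ Fintype.card F ^ k := by
  -- With this radius the `k`-th term is eventually at most `(1/2)^(q^k)`, hence at most `(1/2)^k`.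
  have hρ : 0 < (2 * (‖x‖ + 1))⁻¹ := by positivity
  refine Summable.of_norm_bounded_eventually_nat (g := fun k => (1 / 2 : ℝ) ^ k)
    summable_geometric_two ?_
  filter_upwards [eventually_norm_coeff_le (F := F) h1 hr hρ] with k hk
  rw [norm_mul, norm_pow]
  calc ‖coeff F c k‖ * ‖x‖ ^ Fintype.card F ^ k
      ≤ (2 * (‖x‖ + 1))⁻¹ ^ Fintype.card F ^ k * ‖x‖ ^ Fintype.card F ^ k := by gcongr
    _ = ((2 * (‖x‖ + 1))⁻¹ * ‖x‖) ^ Fintype.card F ^ k := (mul_pow _ _ _).symm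
    _ ≤ (1 / 2) ^ Fintype.card F ^ k := by
        refine pow_le_pow_left₀ (by positivity) ?_ _
        rw [inv_mul_le_iff₀ (by positivity)]
        linarith
    _ ≤ (1 / 2) ^ k := pow_le_pow_of_le_one (by norm_num) (by norm_num)
        ((Nat.le_succ k).trans (le_card_pow k))

end

end ExponentialSeries
end

/-! ### Surjectivity of the exponential. -/

noncomputable section

theorem norm_sub_le_max_of_ultrametric {S : Type*} [SeminormedAddCommGroup S]
    [IsUltrametricDist S] (x y : S) : ‖x - y‖ ≤ max ‖x‖ ‖y‖ := by
  rw [sub_eq_add_neg, ← norm_neg y]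
  exact IsUltrametricDist.norm_add_le_max x (-y)

/-- A polynomial over an algebraically closed field with an ultrametric norm has a root of norm at
most `‖p_0‖ / ‖p_1‖`. -/
theorem Polynomial.exists_root_norm_mul_le {k : Type*} [NormedField k] [IsUltrametricDist k]
    [IsAlgClosed k] (p : Polynomial k) (hp : p.coeff 1 ≠ 0) :
    ∃ z, p.eval z = 0 ∧ ‖p.coeff 1‖ * ‖z‖ ≤ ‖p.coeff 0‖ := by
  by_contra hcon
  push Not at hcon
  have hp0 : p ≠ 0 := by
    rintro rfl
    exact hp (Polynomial.coeff_zero 1)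
  have hsplit : p = Polynomial.C p.leadingCoeff
      * (p.roots.map fun z => Polynomial.X - Polynomial.C z).prod :=
    (IsAlgClosed.splits p).eq_prod_roots
  let t : ℝ := ‖p.coeff 0‖ / ‖p.coeff 1‖
  have h1 : 0 < ‖p.coeff 1‖ := norm_pos_iff.mpr hp
  have hroots : ∀ z ∈ p.roots, t < ‖z‖ := by
    intro z hz
    rw [div_lt_iff₀' h1]
    exact hcon z (Polynomial.isRoot_of_mem_roots hz)
  -- If all roots had norm greater than `t = ‖p_0‖ / ‖p_1‖`, adjoining the linear factors one at a
  -- time would preserve the strict inequality `‖P_1‖ t < ‖P_0‖`. For `p` itself this reads `‖p_0‖ <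
  -- ‖p_0‖`.
  have key : ∀ s : Multiset k, (∀ z ∈ s, t < ‖z‖) →
      ‖(s.map fun z => Polynomial.X - Polynomial.C z).prod.coeff 1‖ * t
        < ‖(s.map fun z => Polynomial.X - Polynomial.C z).prod.coeff 0‖ := by
    intro s
    induction s using Multiset.induction_on with
    | empty => simp [Polynomial.coeff_one]
    | cons z s ih =>
      intro hs
      have hz : t < ‖z‖ := hs z (Multiset.mem_cons_self z s)
      have h := ih fun y hy => hs y (Multiset.mem_cons_of_mem hy)
      rw [Multiset.map_cons, Multiset.prod_cons]
      set P := (s.map fun z => Polynomial.X - Polynomial.C z).prod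
      have ht : 0 ≤ t := by positivity
      have hz0 : 0 < ‖z‖ := ht.trans_lt hz
      have hP0 : 0 < ‖P.coeff 0‖ := lt_of_le_of_lt (by positivity) h
      have e0 : ((Polynomial.X - Polynomial.C z) * P).coeff 0 = -(z * P.coeff 0) := by
        simp [sub_mul]
      have e1 : ((Polynomial.X - Polynomial.C z) * P).coeff 1 = P.coeff 0 - z * P.coeff 1 := by
        simp [sub_mul, Polynomial.coeff_X_mul]
      rw [e0, e1, norm_neg, norm_mul]
      have h2 : ‖P.coeff 0 - z * P.coeff 1‖ ≤ max ‖P.coeff 0‖ (‖z‖ * ‖P.coeff 1‖) := by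
        rw [← norm_mul]
        exact norm_sub_le_max_of_ultrametric _ _
      refine lt_of_le_of_lt (mul_le_mul_of_nonneg_right h2 ht) ?_
      rw [max_mul_of_nonneg _ _ ht, max_lt_iff]
      constructor
      · rw [mul_comm]
        exact mul_lt_mul_of_pos_right hz hP0
      · rw [mul_assoc]
        exact mul_lt_mul_of_pos_left h hz0
  have h := key p.roots hroots
  have hl : 0 < ‖p.leadingCoeff‖ := norm_pos_iff.mpr (Polynomial.leadingCoeff_ne_zero.mpr hp0)
  have h2 := mul_lt_mul_of_pos_left h hl
  rw [← mul_assoc, ← norm_mul, ← norm_mul, ← Polynomial.coeff_C_mul, ← Polynomial.coeff_C_mul,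
    ← hsplit, mul_div_cancel₀ _ h1.ne'] at h2
  exact lt_irrefl _ h2

namespace ExponentialSeries

open Filter Topology

variable (F : Type*) {L : Type*} [Field F] [Fintype F] [NormedField L] [Algebra F L]

/-- The additive map `z ↦ c z ^ (q ^ i)`. -/
def monomialHom (c : L) (i : ℕ) : L →+ L :=
  (AddMonoidHom.mulLeft c).comp (FiniteField.frobeniusAlgHom F L ^ i : L →ₐ[F] L).toRingHom.toAddMonoidHom

theorem monomialHom_apply (c : L) (i : ℕ) (z : L) :
    monomialHom F c i z = c * z ^ Fintype.card F ^ i := by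
  rw [← FiniteField.frobeniusAlgHom_pow_apply F]
  rfl

theorem continuous_monomialHom (c : L) (i : ℕ) : Continuous (monomialHom F c i) := by
  have h : (monomialHom F c i : L → L) = fun z => c * z ^ Fintype.card F ^ i :=
    funext (monomialHom_apply F c i)
  rw [h]
  fun_prop

/-- The exponential function. -/
def exp (c : ℕ → L) (x : L) : L := ∑' k, coeff F c k * x ^ Fintype.card F ^ k

variable {F}
variable [IsUltrametricDist L] [CompleteSpace L] {c : ℕ → L} {r : ℕ}

theorem hasSum_exp (h1 : 1 < ‖c 0‖) (hr : ∀ i, r ≤ i → c i = 0) (x : L) :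
    HasSum (fun k => coeff F c k * x ^ Fintype.card F ^ k) (exp F c x) :=
  (summable h1 hr x).hasSum

theorem exp_add (h1 : 1 < ‖c 0‖) (hr : ∀ i, r ≤ i → c i = 0) (x y : L) :
    exp F c (x + y) = exp F c x + exp F c y := by
  refine (hasSum_exp h1 hr (x + y)).unique ?_
  have h := (hasSum_exp (F := F) h1 hr x).add (hasSum_exp (F := F) h1 hr y)
  simp only [← monomialHom_apply, ← map_add] at h
  simp only [← monomialHom_apply]
  exact h

/-- The formal identity `e c_0 = c e` evaluated at `x`; the rearrangement is legitimate because only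
finitely many `c i` are nonzero. -/
theorem exp_mul (h1 : 1 < ‖c 0‖) (hr : ∀ i, r ≤ i → c i = 0) (x : L) :
    exp F c (c 0 * x) = ∑ i ∈ Finset.range r, c i * exp F c x ^ Fintype.card F ^ i := by
  have h := (hasSum_exp (F := F) h1 hr x).antidiagonal_apply (fun i => monomialHom F (c i) i)
    (fun i => continuous_monomialHom F _ i) (n := r) (fun i hi => by
      ext z
      simp [monomialHom_apply, hr i hi])
  simp only [monomialHom_apply] at h
  refine (hasSum_exp h1 hr _).unique ?_
  refine (congrArg (HasSum · _) (funext fun k => ?_)).mpr h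
  have h2 := congrFun (mul_const_eq (F := F) h1) k
  rw [TwistedSeries.mul_const, frobenius_pow_apply] at h2
  rw [mul_pow, ← mul_assoc, h2, TwistedSeries.mul, Finset.sum_mul]
  refine Finset.sum_congr rfl fun p hp => ?_
  rw [Finset.HasAntidiagonal.mem_antidiagonal] at hp
  rw [frobenius_pow_apply, mul_pow, ← pow_mul, ← pow_add, add_comm p.2, hp, mul_assoc]

/-- The exponential is close to the identity near zero. -/
theorem exists_norm_exp_sub_le (h1 : 1 < ‖c 0‖) (hr : ∀ i, r ≤ i → c i = 0) :
    ∃ ε : ℝ, 0 < ε ∧ ∀ x, ‖x‖ ≤ ε → ‖exp F c x - x‖ ≤ ‖x‖ / 2 := by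
  obtain ⟨C, hC⟩ := exists_forall_norm_le hr
  obtain ⟨B, hB1, hB⟩ := exists_norm_coeff_le (F := F) h1 hC
  -- The terms with `k ≥ 1` have exponent at least `2` and `B ‖x‖ ≤ 1`, so each is at most `B^2
  -- ‖x‖^2`. The radius makes this at most `‖x‖ / 2`.
  refine ⟨1 / (2 * B ^ 2), by positivity, fun x hx => ?_⟩
  have hBpos : 0 < B := by linarith
  have hx2 : B ^ 2 * ‖x‖ ≤ 1 / 2 := by
    rw [le_div_iff₀ (by positivity)] at hx ⊢
    linarith
  have hx1 : B * ‖x‖ ≤ 1 := by nlinarith [norm_nonneg x]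
  have h := (hasSum_nat_add_iff' 1).mpr (hasSum_exp (F := F) h1 hr x)
  simp only [Finset.range_one, Finset.sum_singleton, coeff_zero, pow_zero, pow_one, one_mul] at h
  rw [← h.tsum_eq]
  refine IsUltrametricDist.norm_tsum_le_of_forall_le_of_nonneg (by positivity) fun k => ?_
  rw [norm_mul, norm_pow]
  calc ‖coeff F c (k + 1)‖ * ‖x‖ ^ Fintype.card F ^ (k + 1)
      ≤ B ^ Fintype.card F ^ (k + 1) * ‖x‖ ^ Fintype.card F ^ (k + 1) := by
        gcongr
        exact hB _
    _ = (B * ‖x‖) ^ Fintype.card F ^ (k + 1) := (mul_pow _ _ _).symm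
    _ ≤ (B * ‖x‖) ^ 2 := pow_le_pow_of_le_one (by positivity) hx1 (one_lt_card_pow_succ k)
    _ = B ^ 2 * ‖x‖ * ‖x‖ := by ring
    _ ≤ 1 / 2 * ‖x‖ := by gcongr
    _ = ‖x‖ / 2 := by ring

/-- A preimage of `y` is a fixed point of `x ↦ y - (exp x - x)`. By additivity and closeness to the
identity this map is a `1/2`-contraction of a closed ball. -/
theorem exists_ball_subset_range (h1 : 1 < ‖c 0‖) (hr : ∀ i, r ≤ i → c i = 0) :
    ∃ ε : ℝ, 0 < ε ∧ ∀ y, ‖y‖ ≤ ε → ∃ x, exp F c x = y := by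
  obtain ⟨ε, hε, hexp⟩ := exists_norm_exp_sub_le (F := F) h1 hr
  have hsub : ∀ x y, exp F c (x - y) = exp F c x - exp F c y := fun x y => by
    rw [eq_sub_iff_add_eq, ← exp_add h1 hr, sub_add_cancel]
  refine ⟨ε, hε, fun y hy => ?_⟩
  let T : L → L := fun x => y - (exp F c x - x)
  let s : Set L := Metric.closedBall 0 ε
  have hmaps : Set.MapsTo T s s := by
    intro x hx
    rw [mem_closedBall_zero_iff] at hx ⊢
    refine (norm_sub_le_max_of_ultrametric _ _).trans (max_le hy ?_)
    have := hexp x hx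
    linarith [norm_nonneg x]
  have hcontr : ContractingWith (1 / 2 : ℝ≥0) (hmaps.restrict T s s) := by
    refine ⟨by rw [← NNReal.coe_lt_coe]; norm_num, LipschitzWith.of_dist_le_mul ?_⟩
    rintro ⟨x, hx⟩ ⟨x', hx'⟩
    rw [mem_closedBall_zero_iff] at hx hx'
    change dist (T x) (T x') ≤ _ * dist x x'
    rw [dist_eq_norm, dist_eq_norm]
    have e : T x - T x' = -(exp F c (x - x') - (x - x')) := by
      simp only [T, hsub]
      ring
    rw [e, norm_neg]
    refine (hexp (x - x') ((norm_sub_le_max_of_ultrametric _ _).trans (max_le hx hx'))).trans ?_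
    apply le_of_eq
    push_cast
    ring
  obtain ⟨x, -, hx, -⟩ := hcontr.exists_fixedPoint' Metric.isClosed_closedBall.isComplete hmaps
    (x := 0) (Metric.mem_closedBall_self hε.le) (edist_ne_top _ _)
  refine ⟨x, ?_⟩
  have h : y - (exp F c x - x) = x := hx
  linear_combination -h

/-- For `y` in the dense algebraically closed field `k`, solve `∑ c_i z^(q^i) = y` with `‖z‖ ≤ ‖y‖ /
‖c 0‖`. If `z = exp x`, then `y = exp (c_0 x)`. Repeated division brings `y` into the ball already
covered. A general element of `L` differs from an element of `k` by an element of that ball. -/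
theorem exp_surjective (h1 : 1 < ‖c 0‖) (hr : ∀ i, r ≤ i → c i = 0) {k : Type*} [NormedField k]
    [IsUltrametricDist k] [IsAlgClosed k] (j : k →+* L) (hj : ∀ x, ‖j x‖ = ‖x‖)
    (hdense : DenseRange j) {c' : ℕ → k} (hc' : ∀ i, j (c' i) = c i) :
    Function.Surjective (exp F c) := by
  obtain ⟨ε, hε, hball⟩ := exists_ball_subset_range (F := F) h1 hr
  have hr0 : 0 < r := by
    by_contra h
    rw [hr 0 (by omega), norm_zero] at h1
    linarith
  have hc0 : 0 < ‖c 0‖ := by linarith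
  have hstep : ∀ y : k, ∃ z : k, ‖c 0‖ * ‖z‖ ≤ ‖y‖ ∧
      j y = ∑ i ∈ Finset.range r, c i * j z ^ Fintype.card F ^ i := by
    intro y
    let p : Polynomial k := ∑ i ∈ Finset.range r, Polynomial.monomial (Fintype.card F ^ i) (c' i)
      - Polynomial.C y
    have hp1 : p.coeff 1 = c' 0 := by
      simp only [p, Polynomial.coeff_sub, Polynomial.finsetSum_coeff, Polynomial.coeff_monomial,
        Polynomial.coeff_C, one_ne_zero, if_false, sub_zero]
      rw [Finset.sum_eq_single 0]
      · simp
      · intro i _ hi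
        obtain ⟨i, rfl⟩ := Nat.exists_eq_succ_of_ne_zero hi
        exact if_neg (one_lt_card_pow_succ i).ne'
      · intro h
        exact absurd (Finset.mem_range.mpr hr0) h
    have hp0 : p.coeff 0 = -y := by
      simp only [p, Polynomial.coeff_sub, Polynomial.finsetSum_coeff, Polynomial.coeff_monomial,
        Polynomial.coeff_C, if_true]
      rw [Finset.sum_eq_zero fun i _ => if_neg (card_pow_pos i).ne', zero_sub]
    obtain ⟨z, hz, hle⟩ := p.exists_root_norm_mul_le (by
      rw [hp1, ← norm_ne_zero_iff, ← hj, hc']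
      exact hc0.ne')
    rw [hp1, hp0, norm_neg, ← hj (c' 0), hc'] at hle
    refine ⟨z, hle, ?_⟩
    simp only [p, Polynomial.eval_sub, Polynomial.eval_finsetSum, Polynomial.eval_monomial,
      Polynomial.eval_C] at hz
    rw [← sub_eq_zero.mp hz, map_sum]
    simp only [map_mul, map_pow, hc']
  have hk : ∀ (m : ℕ) (y : k), ‖y‖ ≤ ε * ‖c 0‖ ^ m → ∃ x, exp F c x = j y := by
    intro m
    induction m with
    | zero =>
      intro y hy
      refine hball _ ?_
      rw [hj]
      simpa using hy
    | succ m ih =>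
      intro y hy
      obtain ⟨z, hz, hyz⟩ := hstep y
      obtain ⟨x, hx⟩ := ih z (by
        refine le_of_mul_le_mul_left (hz.trans (hy.trans_eq ?_)) hc0
        ring)
      exact ⟨c 0 * x, by rw [exp_mul h1 hr, hx, hyz]⟩
  intro y
  obtain ⟨y', hy'⟩ := hdense.exists_dist_lt y hε
  rw [dist_eq_norm] at hy'
  obtain ⟨x, hx⟩ := hball (y - j y') hy'.le
  obtain ⟨m, hm⟩ := (((tendsto_pow_atTop_atTop_of_one_lt h1).const_mul_atTop hε).eventually_ge_atTop
    ‖y'‖).exists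
  obtain ⟨x', hx'⟩ := hk m y' hm
  exact ⟨x + x', by rw [exp_add h1 hr, hx, hx', sub_add_cancel]⟩

end ExponentialSeries
end

/-! ### Exponentials of Drinfeld modules and of the modules they trivialize. -/

noncomputable section

namespace AndersonModule

variable {F A E S L : Type*} [Field F] [Fintype F] [CommRing A] [Algebra F A] [CommRing E]
  [Algebra F E] [Algebra A E] [CommRing S] [Algebra F S] [NormedField L] [Algebra F L]

/-- An exponential of a Drinfeld module over `L`, as a series `e` and as a function `f`. -/
structure IsExponential (φ : DrinfeldModule F A E) (σ : E →ₐ[F] L) (e : ℕ → L) (f : L → L) :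
    Prop where
  zero : e 0 = 1
  mul_const : ∀ a : A,
    TwistedSeries.mul (FiniteField.frobeniusAlgHom F L : L →+* L) e
        (TwistedSeries.const (σ (algebraMap A E a)))
      = TwistedSeries.mul (FiniteField.frobeniusAlgHom F L : L →+* L)
        (fun i => σ ((φ.toAlgHom a 0 0).coeff i)) e
  hasSum : ∀ x, HasSum (fun k => e k * x ^ Fintype.card F ^ k) (f x)
  surjective : Function.Surjective f

theorem coeff_toAlgHom_mul (φ : DrinfeldModule F A E) (σ : E →ₐ[F] L) (a b : A) :
    (fun i => σ ((φ.toAlgHom (a * b) 0 0).coeff i))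
      = TwistedSeries.mul (FiniteField.frobeniusAlgHom F L : L →+* L)
        (fun i => σ ((φ.toAlgHom a 0 0).coeff i)) (fun i => σ ((φ.toAlgHom b 0 0).coeff i)) := by
  funext k
  rw [map_mul, Matrix.mul_apply, Fin.sum_univ_one, TwistedPolynomial.coeff_mul, map_sum]
  refine Finset.sum_congr rfl fun p _ => ?_
  rw [ExponentialSeries.frobenius_pow_apply, map_mul, map_pow]

/-- The exponential is built from one large `a` and serves for all `b`. As `A` is commutative, the
defect `e b - φ_b e` satisfies the same functional equation for `a` and has zero constant term, so
it vanishes. If `A` consists of constants, the identity serves. -/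
theorem exists_isExponential [IsUltrametricDist L] [CompleteSpace L] (φ : DrinfeldModule F A E)
    (σ : E →ₐ[F] L)
    (hA : (∃ a : A, 1 < ‖σ (algebraMap A E a)‖) ∨ ∀ a : A, ∃ c : F, algebraMap F A c = a)
    {k : Type*} [NormedField k] [IsUltrametricDist k] [IsAlgClosed k] (j : k →+* L)
    (hj : ∀ x, ‖j x‖ = ‖x‖) (hdense : DenseRange j) (hσ : ∀ x, σ x ∈ Set.range j) :
    ∃ e f, φ.IsExponential σ e f := by
  rcases hA with ⟨a, ha⟩ | hA
  · let c : ℕ → L := fun i => σ ((φ.toAlgHom a 0 0).coeff i)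
    have hc0 : c 0 = σ (algebraMap A E a) := by rw [← φ.coeff_zero_toAlgHom]
    have h1 : 1 < ‖c 0‖ := by rwa [hc0]
    obtain ⟨r, hr'⟩ := (φ.toAlgHom a 0 0).exists_coeff_eq_zero
    have hr : ∀ i, r ≤ i → c i = 0 := fun i hi => by simp only [c, hr' i hi, map_zero]
    have hc : ∀ i, ∃ x, j x = c i := fun i => hσ _
    choose c' hc' using hc
    have hmul := ExponentialSeries.mul_const_eq (F := F) h1
    refine ⟨ExponentialSeries.coeff F c, ExponentialSeries.exp F c,
      ExponentialSeries.coeff_zero F c, fun b => ?_, ExponentialSeries.hasSum_exp h1 hr,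
      ExponentialSeries.exp_surjective h1 hr j hj hdense hc'⟩
    refine sub_eq_zero.mp (ExponentialSeries.eq_zero_of_mul_const_eq (F := F) h1 ?_ ?_)
    · rw [Pi.sub_apply, TwistedSeries.mul_zero_apply, TwistedSeries.mul_zero_apply,
        ExponentialSeries.coeff_zero, TwistedSeries.const_zero_apply, φ.coeff_zero_toAlgHom,
        one_mul, mul_one, sub_self]
    · rw [TwistedSeries.sub_mul, TwistedSeries.mul_sub]
      congr 1
      · rw [TwistedSeries.mul_assoc, TwistedSeries.const_mul_const, mul_comm,
          ← TwistedSeries.const_mul_const (FiniteField.frobeniusAlgHom F L : L →+* L),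
          ← TwistedSeries.mul_assoc, hmul, TwistedSeries.mul_assoc]
      · rw [TwistedSeries.mul_assoc, hmul, ← TwistedSeries.mul_assoc, ← TwistedSeries.mul_assoc,
          ← coeff_toAlgHom_mul, ← coeff_toAlgHom_mul, mul_comm]
  · refine ⟨TwistedSeries.const 1, id, rfl, fun b => ?_, fun x => ?_, Function.surjective_id⟩
    · obtain ⟨c, rfl⟩ := hA b
      have h : (fun i => σ ((φ.toAlgHom (algebraMap F A c) 0 0).coeff i))
          = TwistedSeries.const (σ (algebraMap A E (algebraMap F A c))) := by
        funext i
        have h2 : φ.toAlgHom (algebraMap F A c) 0 0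
            = TwistedPolynomial.C F (algebraMap F E c) := by
          rw [AlgHom.commutes, Matrix.algebraMap_matrix_apply, if_pos rfl]
          rfl
        have h3 := φ.coeff_zero_toAlgHom (algebraMap F A c)
        rw [h2, TwistedPolynomial.coeff_C, if_pos rfl] at h3
        rw [h2, TwistedPolynomial.coeff_C, ← h3, TwistedSeries.const]
        split_ifs <;> simp
      rw [h, TwistedSeries.const_mul_const, TwistedSeries.const_mul_const, mul_comm]
    · convert hasSum_single (f := fun k => TwistedSeries.const 1 k * x ^ Fintype.card F ^ k) 0
        (fun k hk => by simp [TwistedSeries.const, hk]) using 1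
      simp

section Matrix

variable {N : ℕ}

/-- The coefficients in `L` of a matrix over `S{τ}`. -/
def coeffSeries (σ : S →ₐ[F] L) (X : Matrix (Fin N) (Fin N) (TwistedPolynomial F S)) (k : ℕ) :
    Matrix (Fin N) (Fin N) L :=
  Matrix.of fun i j => σ ((X i j).coeff k)

variable (F L N) in
/-- The entrywise Frobenius. -/
def matrixFrobenius : Matrix (Fin N) (Fin N) L →+* Matrix (Fin N) (Fin N) L :=
  (FiniteField.frobeniusAlgHom F L : L →+* L).mapMatrix

theorem matrixFrobenius_pow (k : ℕ) (M : Matrix (Fin N) (Fin N) L) :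
    (matrixFrobenius F L N ^ k) M = M.map (· ^ Fintype.card F ^ k) := by
  induction k generalizing M with
  | zero =>
    ext i j
    simp
  | succ k ih =>
    rw [pow_succ, RingHom.mul_def, RingHom.comp_apply, ih]
    ext i j
    change (M i j ^ Fintype.card F) ^ Fintype.card F ^ k = M i j ^ Fintype.card F ^ (k + 1)
    rw [← pow_mul, pow_succ']

theorem coeffSeries_mul (σ : S →ₐ[F] L) (X Y : Matrix (Fin N) (Fin N) (TwistedPolynomial F S)) :
    coeffSeries σ (X * Y)
      = TwistedSeries.mul (matrixFrobenius F L N) (coeffSeries σ X) (coeffSeries σ Y) := by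
  funext k
  ext i j
  rw [TwistedSeries.mul, Matrix.sum_apply]
  simp only [coeffSeries, Matrix.of_apply, Matrix.mul_apply, TwistedPolynomial.coeff_sum,
    TwistedPolynomial.coeff_mul, map_sum, matrixFrobenius_pow, Matrix.map_apply, map_mul, map_pow]
  exact Finset.sum_comm

theorem coeffSeries_one (σ : S →ₐ[F] L) :
    coeffSeries σ (1 : Matrix (Fin N) (Fin N) (TwistedPolynomial F S)) = TwistedSeries.const 1 := by
  funext k
  ext i j
  simp only [coeffSeries, Matrix.of_apply, Matrix.one_apply, TwistedSeries.const]
  rcases eq_or_ne i j with rfl | hij <;> by_cases hk : k = 0 <;>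
    simp [*, TwistedPolynomial.coeff_one]

theorem exists_coeffSeries_eq_zero (σ : S →ₐ[F] L)
    (X : Matrix (Fin N) (Fin N) (TwistedPolynomial F S)) :
    ∃ n, ∀ k, n ≤ k → coeffSeries σ X k = 0 := by
  choose m hm using fun i j => (X i j).exists_coeff_eq_zero
  refine ⟨∑ i, ∑ j, m i j, fun k hk => ?_⟩
  ext i j
  have h : m i j ≤ k :=
    ((Finset.single_le_sum (f := m i) (fun _ _ => Nat.zero_le _) (Finset.mem_univ j)).trans
      (Finset.single_le_sum (f := fun i => ∑ j, m i j) (fun _ _ => Nat.zero_le _)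
        (Finset.mem_univ i))).trans hk
  simp [coeffSeries, hm i j k h]

variable (F) in
/-- The additive map `x ↦ M x ^ (q ^ k)` on vectors. -/
def vectorHom (M : Matrix (Fin N) (Fin N) L) (k : ℕ) : (Fin N → L) →+ (Fin N → L) :=
  (Matrix.mulVecLin M).toAddMonoidHom.comp
    { toFun := fun x i => x i ^ Fintype.card F ^ k
      map_zero' := funext fun _ => zero_pow (pow_ne_zero _ Fintype.card_ne_zero)
      map_add' := fun x y => funext fun i => by
        simp only [Pi.add_apply, ← FiniteField.frobeniusAlgHom_pow_apply, map_add] }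

theorem vectorHom_apply (M : Matrix (Fin N) (Fin N) L) (k : ℕ) (x : Fin N → L) :
    vectorHom F M k x = Matrix.mulVec M fun i => x i ^ Fintype.card F ^ k := rfl

theorem continuous_vectorHom (M : Matrix (Fin N) (Fin N) L) (k : ℕ) :
    Continuous (vectorHom F M k) := by
  refine continuous_pi fun i => ?_
  simp only [vectorHom_apply, Matrix.mulVec, dotProduct]
  fun_prop

theorem vectorHom_comp (M M' : Matrix (Fin N) (Fin N) L) (k l : ℕ) (x : Fin N → L) :
    vectorHom F M k (vectorHom F M' l x)
      = vectorHom F (M * (matrixFrobenius F L N ^ k) M') (k + l) x := by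
  rw [vectorHom_apply, vectorHom_apply, vectorHom_apply, ← Matrix.mulVec_mulVec,
    matrixFrobenius_pow]
  congr 1
  funext i
  simp only [Matrix.mulVec, dotProduct, ← FiniteField.frobeniusAlgHom_pow_apply, map_sum, map_mul,
    Matrix.map_apply]
  refine Finset.sum_congr rfl fun m _ => ?_
  rw [pow_add (FiniteField.frobeniusAlgHom F L), AlgHom.mul_apply]

/-- The action of a matrix over `S{τ}` on vectors over `L`. -/
def evalMatrix (σ : S →ₐ[F] L) (X : Matrix (Fin N) (Fin N) (TwistedPolynomial F S))
    (x : Fin N → L) : Fin N → L :=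
  ∑ i ∈ Finset.range (exists_coeffSeries_eq_zero σ X).choose, vectorHom F (coeffSeries σ X i) i x

theorem hasSum_mul (σ : S →ₐ[F] L) (X : Matrix (Fin N) (Fin N) (TwistedPolynomial F S))
    {g : ℕ → Matrix (Fin N) (Fin N) L} {x y : Fin N → L}
    (h : HasSum (fun k => vectorHom F (g k) k x) y) :
    HasSum (fun k =>
      vectorHom F (TwistedSeries.mul (matrixFrobenius F L N) (coeffSeries σ X) g k) k x)
      (evalMatrix σ X y) := by
  have h2 := h.antidiagonal_apply (fun i => vectorHom F (coeffSeries σ X i) i)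
    (fun i => continuous_vectorHom _ _) (n := (exists_coeffSeries_eq_zero σ X).choose)
    (fun i hi => by
      rw [(exists_coeffSeries_eq_zero σ X).choose_spec i hi]
      ext x k
      simp [vectorHom_apply])
  refine (congrArg (HasSum · _) (funext fun k => ?_)).mpr h2
  rw [vectorHom_apply, TwistedSeries.mul, Matrix.sum_mulVec]
  refine Finset.sum_congr rfl fun p hp => ?_
  rw [Finset.HasAntidiagonal.mem_antidiagonal] at hp
  rw [vectorHom_comp, hp, vectorHom_apply]

theorem hasSum_const_one (x : Fin N → L) :
    HasSum (fun k => vectorHom F (TwistedSeries.const (1 : Matrix (Fin N) (Fin N) L) k) k x) x := by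
  convert hasSum_single
    (f := fun k => vectorHom F (TwistedSeries.const (1 : Matrix (Fin N) (Fin N) L) k) k x) 0
    (fun k hk => by simp [TwistedSeries.const, hk, vectorHom_apply]) using 1
  simp [vectorHom_apply]

/-- Apply `hasSum_mul` twice to the constant series `1` and use uniqueness of sums. -/
theorem evalMatrix_evalMatrix (σ : S →ₐ[F] L)
    {X Y : Matrix (Fin N) (Fin N) (TwistedPolynomial F S)} (hXY : X * Y = 1) (x : Fin N → L) :
    evalMatrix σ X (evalMatrix σ Y x) = x := by
  have h := hasSum_mul σ X (hasSum_mul σ Y (hasSum_const_one (F := F) x))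
  rw [← TwistedSeries.mul_assoc, ← coeffSeries_mul, hXY, coeffSeries_one,
    TwistedSeries.const_mul_const, mul_one] at h
  exact h.unique (hasSum_const_one x)

/-- An Anderson module which becomes isomorphic to a power of a Drinfeld module with a surjective
entire exponential is uniformizable. -/
theorem IsoPowOver.uniformizable {𝓔 : AndersonModule F A E N} {φ : DrinfeldModule F A E}
    {g : E →ₐ[F] S} (h : 𝓔.IsoPowOver φ g) (σ : S →ₐ[F] L) {e : ℕ → L} {f : L → L}
    (he : φ.IsExponential (σ.comp g) e f) : 𝓔.Uniformizable (σ.comp g : E →+* L) := by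
  obtain ⟨U, hU⟩ := h
  let Θ := matrixFrobenius F L N
  let cU := coeffSeries σ U.val
  let cV := coeffSeries σ U.inv
  let cE : A → ℕ → Matrix (Fin N) (Fin N) L := fun a =>
    coeffSeries σ ((𝓔.toAlgHom a).map (TwistedPolynomial.map g))
  let s : (ℕ → L) → ℕ → Matrix (Fin N) (Fin N) L := fun c k => Matrix.scalar (Fin N) (c k)
  let cφ : A → ℕ → L := fun a i => σ.comp g ((φ.toAlgHom a 0 0).coeff i)
  have hs : ∀ c c', s (TwistedSeries.mul (FiniteField.frobeniusAlgHom F L : L →+* L) c c')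
      = TwistedSeries.mul Θ (s c) (s c') := by
    intro c c'
    refine TwistedSeries.comp_mul _ Θ (Matrix.scalar (Fin N)) (fun x => ?_) c c'
    ext i k
    by_cases hik : i = k <;> simp [hik, Θ, matrixFrobenius]
  have hsconst : ∀ x, s (TwistedSeries.const x) = TwistedSeries.const (Matrix.scalar (Fin N) x) := by
    intro x
    funext k
    by_cases hk : k = 0 <;> simp [s, TwistedSeries.const, hk]
  have hpow : ∀ a, coeffSeries σ ((powMatrix φ N a).map (TwistedPolynomial.map g)) = s (cφ a) := by
    intro a
    funext k
    ext i l
    by_cases hil : i = l <;>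
      simp [s, cφ, coeffSeries, powMatrix, hil, TwistedPolynomial.coeff_map]
  have hcoeff : ∀ a k, cE a k = (𝓔.coeffMatrix a k).map (σ.comp g) := by
    intro a k
    ext i l
    simp [cE, coeffSeries, coeffMatrix, TwistedPolynomial.coeff_map]
  have hUE : ∀ a, TwistedSeries.mul Θ cU (cE a) = TwistedSeries.mul Θ (s (cφ a)) cU := by
    intro a
    rw [← hpow, ← coeffSeries_mul, ← coeffSeries_mul, hU]
  have hVφ : ∀ a, TwistedSeries.mul Θ cV (s (cφ a)) = TwistedSeries.mul Θ (cE a) cV := by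
    intro a
    rw [← hpow, ← coeffSeries_mul, ← coeffSeries_mul]
    congr 1
    have h1 := congrArg (fun X => U.inv * X * U.inv) (hU a)
    simp only [mul_assoc, U.val_inv, mul_one] at h1
    rw [← mul_assoc U.inv U.val, U.inv_val, one_mul] at h1
    exact h1.symm
  have hUV : cU 0 * cV 0 = 1 := by
    have h1 : TwistedSeries.mul Θ cU cV = TwistedSeries.const 1 := by
      rw [← coeffSeries_mul, U.val_inv, coeffSeries_one]
    have h2 := congrFun h1 0
    rwa [TwistedSeries.mul_zero_apply] at h2
  have hVU : cV 0 * cU 0 = 1 := mul_eq_one_comm.mp hUV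
  -- Constant terms in `U 𝓔_a = φ_a U`: the matrix `∂U` conjugates `∂𝓔_a` to the scalar `a`.
  have hlie : ∀ a, cU 0 * cE a 0
      = Matrix.scalar (Fin N) (σ.comp g (algebraMap A E a)) * cU 0 := by
    intro a
    have h2 := congrFun (hUE a) 0
    rw [TwistedSeries.mul_zero_apply, TwistedSeries.mul_zero_apply] at h2
    rw [h2, ← φ.coeff_zero_toAlgHom]
  -- The series `U⁻¹ exp_φ ∂U`. The right factor makes the constant term `1` and turns `∂𝓔_a` into
  -- the scalar that `exp_φ` intertwines with `φ_a`.
  let e' := TwistedSeries.mul Θ cV (TwistedSeries.mul Θ (s e) (TwistedSeries.const (cU 0)))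
  have he' : ∀ a, TwistedSeries.mul Θ e' (TwistedSeries.const (cE a 0))
      = TwistedSeries.mul Θ (cE a) e' := by
    intro a
    have h1 : TwistedSeries.mul Θ (s e)
        (TwistedSeries.const (Matrix.scalar (Fin N) (σ.comp g (algebraMap A E a))))
        = TwistedSeries.mul Θ (s (cφ a)) (s e) := by
      rw [← hsconst, ← hs, he.mul_const, hs]
    calc TwistedSeries.mul Θ e' (TwistedSeries.const (cE a 0))
        = TwistedSeries.mul Θ cV (TwistedSeries.mul Θ (TwistedSeries.mul Θ (s e)
            (TwistedSeries.const (Matrix.scalar (Fin N) (σ.comp g (algebraMap A E a)))))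
            (TwistedSeries.const (cU 0))) := by
          simp only [e', TwistedSeries.mul_assoc, TwistedSeries.const_mul_const, hlie]
      _ = TwistedSeries.mul Θ (cE a) e' := by
          rw [h1, TwistedSeries.mul_assoc, ← TwistedSeries.mul_assoc, hVφ, TwistedSeries.mul_assoc]
  have hsum : ∀ x : Fin N → L, HasSum (fun k => vectorHom F (e' k) k x)
      (evalMatrix σ U.inv fun i => f (Matrix.mulVec (cU 0) x i)) := by
    intro x
    refine hasSum_mul σ U.inv ?_
    rw [Pi.hasSum]
    intro i
    refine (congrArg (HasSum · _) (funext fun k => ?_)).mpr (he.hasSum (Matrix.mulVec (cU 0) x i))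
    rw [TwistedSeries.mul_const, vectorHom_apply, ← Matrix.mulVec_mulVec]
    have h1 := congrFun (vectorHom_comp (F := F) 1 (cU 0) k 0 x) i
    simp only [vectorHom_apply, one_mul, Matrix.one_mulVec, add_zero, pow_zero, pow_one] at h1
    change Matrix.mulVec (Matrix.scalar (Fin N) (e k)) _ i = _
    rw [Matrix.scalar_apply, Matrix.mulVec_diagonal]
    exact congrArg (e k * ·) h1.symm
  refine ⟨e', _, ⟨?_, fun a k => ?_⟩, hsum, fun y => ?_⟩
  · have h0 := TwistedSeries.mul_zero_apply Θ cV
      (TwistedSeries.mul Θ (s e) (TwistedSeries.const (cU 0)))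
    refine h0.trans ?_
    rw [TwistedSeries.mul_zero_apply, TwistedSeries.const_zero_apply]
    simp only [s, he.zero, map_one, one_mul]
    exact hVU
  · have h1 := congrFun (he' a) k
    rw [TwistedSeries.mul_const, TwistedSeries.mul,
      Finset.Nat.sum_antidiagonal_eq_sum_range_succ_mk] at h1
    simp only [Θ, matrixFrobenius_pow, hcoeff] at h1
    exact h1
  · choose w hw using he.surjective
    refine ⟨Matrix.mulVec (cV 0) fun i => w (evalMatrix σ U.val y i), ?_⟩
    simp only [Matrix.mulVec_mulVec, hUV, Matrix.one_mulVec, hw]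
    exact evalMatrix_evalMatrix σ U.inv_val y

end Matrix

end AndersonModule
end

/-! ### The place at infinity and embeddings into `ℂ_∞`. -/

noncomputable section

namespace FunctionFieldPlace

variable {F K : Type*} [Field F] [Field K] [Algebra F K] [IsCurveFunctionField F K]
  (P : FunctionFieldPlace F K)

instance : IsUltrametricDist P.AlgClosure :=
  IsUltrametricDist.isUltrametricDist_of_forall_norm_add_le_max_norm
    (isNonarchimedean_spectralNorm (K := P.Completion) (L := P.AlgClosure))

instance : IsUltrametricDist P.CInfty :=
  IsUltrametricDist.isUltrametricDist_of_forall_norm_add_le_max_norm fun x y => by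
    induction x, y using UniformSpace.Completion.induction_on₂ with
    | hp => exact isClosed_le (by fun_prop) (by fun_prop)
    | ih x y =>
      rw [← UniformSpace.Completion.coe_add]
      simp only [UniformSpace.Completion.norm_coe]
      exact IsUltrametricDist.norm_add_le_max x y

theorem norm_toCInfty (x : K) : ‖P.toCInfty x‖ = P.absValue x :=
  (UniformSpace.Completion.norm_coe _).trans
    ((spectralNorm_extends (K := P.Completion) (L := P.AlgClosure) _).trans
      (UniformSpace.Completion.norm_coe _))

theorem mem_ring_of_absValue_le_one {x : K} (hx : P.absValue x ≤ 1) : x ∈ P.ring := by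
  change ((WithZeroMulInt.toNNReal (ne_zero_of_lt P.one_lt_normBase)
    ((IsDiscreteValuationRing.maximalIdeal P.ring).valuation K x) : ℝ≥0) : ℝ) ≤ 1 at hx
  rw [← NNReal.coe_one, NNReal.coe_le_coe, WithZeroMulInt.toNNReal_le_one_iff P.one_lt_normBase]
    at hx
  obtain ⟨a, rfl⟩ := IsDiscreteValuationRing.exists_lift_of_le_one hx
  exact a.2

/-- The integral closure of the constants in `K` is the intersection of the valuation rings
containing them. These are the places together with the trivial ring `⊤`, which imposes no
condition. -/
theorem isAlgebraic_of_forall_mem_ring {x : K} (hx : ∀ Q : FunctionFieldPlace F K, x ∈ Q.ring) :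
    IsAlgebraic F x := by
  have h : x ∈ (integralClosure (Subring.closure (Set.range (algebraMap F K))) K).toSubring := by
    rw [← iInf_valuationSubring_superset, Subring.mem_iInf]
    intro V
    by_cases hV : V.1 = ⊤
    · rw [hV]; trivial
    · exact hx ⟨V.1, fun c => V.2 ⟨c, rfl⟩, hV⟩
  rw [← RingHom.coe_range, Subring.closure_eq] at h
  obtain ⟨p, hp, hp0⟩ := h
  obtain ⟨q, rfl, -, hq⟩ := Polynomial.lifts_and_degree_eq_and_monic
    (f := (algebraMap F K).rangeRestrict) (p := p)
    (by rw [Polynomial.lifts_iff_coeff_lifts]; intro k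
        exact (algebraMap F K).rangeRestrict_surjective _) hp
  refine ⟨q, hq.ne_zero, ?_⟩
  rw [Polynomial.eval₂_map] at hp0
  exact hp0

/-- If no element of `A` has a pole at `P`, each is regular everywhere, hence constant. Keeping the
second alternative avoids an appeal to Riemann–Roch. -/
theorem exists_one_lt_absValue_or_mem_range :
    (∃ a : P.regularOutside, 1 < P.absValue a) ∨
      ∀ a : P.regularOutside, ∃ c : F, algebraMap F P.regularOutside c = a := by
  refine or_iff_not_imp_left.mpr fun h a => ?_
  push Not at h
  obtain ⟨c, hc⟩ := IsCurveFunctionField.mem_range_of_isAlgebraic (F := F) (a : K)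
    (isAlgebraic_of_forall_mem_ring fun Q => by
      by_cases hQ : Q = P
      · exact hQ ▸ P.mem_ring_of_absValue_le_one (h a)
      · exact a.2 Q hQ)
  exact ⟨c, Subtype.ext hc⟩

end FunctionFieldPlace

/-- The image of `x` is a root of its minimal polynomial transported to `k`, where that polynomial
splits; so the image already lies in `k`. An embedding of `E` into `ℂ_∞` thus lands in the algebraic
closure of `K_∞`. -/
theorem RingHom.exists_comp_eq_of_isAlgebraic {K E k L : Type*} [Field K] [Field E] [Field k]
    [Field L] [IsAlgClosed k] [Algebra K E] [Algebra.IsAlgebraic K E] (ι : k →+* L) (ψ : K →+* k)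
    (σ : E →+* L) (h : σ.comp (algebraMap K E) = ι.comp ψ) :
    ∃ σ₀ : E →+* k, ι.comp σ₀ = σ := by
  have hr : ∀ x, ∃ y, ι y = σ x := by
    intro x
    have hint : _root_.IsIntegral K x := Algebra.IsIntegral.isIntegral x
    have h0 : (minpoly K x).map ψ ≠ 0 := ((minpoly.monic hint).map ψ).ne_zero
    refine (IsAlgClosed.splits ((minpoly K x).map ψ)).mem_range_of_isRoot h0 ?_
    rw [Polynomial.map_map, ← h, Polynomial.IsRoot.def, Polynomial.eval_map,
      ← Polynomial.hom_eval₂]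
    exact (congrArg σ (minpoly.aeval K x)).trans (map_zero σ)
  choose s hs using hr
  refine ⟨⟨⟨⟨s, ?_⟩, ?_⟩, ?_, ?_⟩, RingHom.ext hs⟩
  · exact ι.injective (by simp [hs])
  · exact fun x y => ι.injective (by simp [hs])
  · exact ι.injective (by simp [hs])
  · exact fun x y => ι.injective (by simp [hs])

theorem RingHom.exists_extension_of_isAlgebraic {E S k : Type*} [Field E] [Field S] [Field k]
    [IsAlgClosed k] [Algebra E S] [Algebra.IsAlgebraic E S] (σ : E →+* k) :
    ∃ σ' : S →+* k, σ'.comp (algebraMap E S) = σ := by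
  let _ := σ.toAlgebra
  exact ⟨(IsAlgClosed.lift : S →ₐ[E] k).toRingHom, AlgHom.comp_algebraMap _⟩

/-- An Anderson module which becomes isomorphic to a power of a Drinfeld module over an algebraic
extension of `E` is uniformizable at the place `P`. -/
theorem AndersonModule.IsoPowOver.uniformizable_CInfty {F K E S : Type*} [Field F] [Fintype F]
    [Field K] [Algebra F K] [IsCurveFunctionField F K] (P : FunctionFieldPlace F K)
    [Field E] [Algebra F E] [Algebra K E] [IsScalarTower F K E] [Algebra.IsAlgebraic K E]
    [Field S] [Algebra F S] [Algebra E S] [IsScalarTower F E S] [Algebra.IsAlgebraic E S]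
    {N : ℕ} {𝓔 : AndersonModule F P.regularOutside E N}
    {φ : DrinfeldModule F P.regularOutside E}
    (h : 𝓔.IsoPowOver φ (IsScalarTower.toAlgHom F E S)) (σ : E →+* P.CInfty)
    (hσ : σ.comp (algebraMap K E) = P.toCInfty) : 𝓔.Uniformizable σ := by
  let ι : P.AlgClosure →+* P.CInfty := UniformSpace.Completion.coeRingHom
  obtain ⟨σ₀, hσ₀⟩ := RingHom.exists_comp_eq_of_isAlgebraic ι _ σ hσ
  obtain ⟨σ₁, hσ₁⟩ := RingHom.exists_extension_of_isAlgebraic (S := S) σ₀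
  -- The `F`-structure on `ℂ_∞` is chosen so that `σ` is `F`-linear.
  let _ : Algebra F P.CInfty := (σ.comp (algebraMap F E)).toAlgebra
  have hσ' : (ι.comp σ₁).comp (algebraMap E S) = σ := by rw [RingHom.comp_assoc, hσ₁, hσ₀]
  let σ' : S →ₐ[F] P.CInfty :=
    { ι.comp σ₁ with
      commutes' := fun c => by
        rw [IsScalarTower.algebraMap_apply F E S]
        exact RingHom.congr_fun hσ' _ }
  have hcomp : ∀ x, (σ'.comp (IsScalarTower.toAlgHom F E S)) x = σ x := RingHom.congr_fun hσ'
  have hnorm : ∀ a : P.regularOutside,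
      ‖(σ'.comp (IsScalarTower.toAlgHom F E S)) (algebraMap P.regularOutside E a)‖
        = P.absValue a := by
    intro a
    rw [hcomp, ← P.norm_toCInfty, ← hσ]
    rfl
  obtain ⟨e, f, he⟩ := φ.exists_isExponential (σ'.comp (IsScalarTower.toAlgHom F E S))
    (P.exists_one_lt_absValue_or_mem_range.imp_left fun ⟨a, ha⟩ => ⟨a, by rwa [hnorm]⟩)
    ι (fun x => UniformSpace.Completion.norm_coe x) UniformSpace.Completion.denseRange_coe
    (fun x => ⟨σ₀ x, by rw [hcomp, ← hσ₀]; rfl⟩)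
  have hu := h.uniformizable σ' he
  convert hu using 1
  exact hσ'.symm

theorem IsCurveFunctionField.infinite (F K : Type*) [Field F] [Field K] [Algebra F K]
    [IsCurveFunctionField F K] : Infinite K := by
  obtain ⟨t, ht, -⟩ := IsCurveFunctionField.exists_transcendental (F := F) (K := K)
  exact Infinite.of_injective _ (transcendental_iff_injective.mp ht)
end

theorem corollaryC {F K E Es : Type*} [Field F] [Fintype F]
    [Field K] [Algebra F K] [IsCurveFunctionField F K] (P : FunctionFieldPlace F K)
    [Field E] [Algebra F E] [Algebra K E] [IsScalarTower F K E] [FiniteDimensional K E]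
    [Field Es] [Algebra F Es] [Algebra E Es] [IsScalarTower F E Es] [IsSepClosure E Es]
    {n : ℕ} (φ : DrinfeldModule F P.regularOutside E) (ρ : ArtinRepresentation F E Es n) :
    (∀ 𝓔 : AndersonModule F P.regularOutside E (n * ρ.degree), IsArtinTwist φ ρ 𝓔 →
      𝓔.IsoPowOver φ (IsScalarTower.toAlgHom F E Es) ∧
      ∀ σ : E →+* P.CInfty, σ.comp (algebraMap K E) = P.toCInfty → 𝓔.Uniformizable σ) ∧
    (∃ 𝓔 : AndersonModule F P.regularOutside E (n * ρ.degree), IsArtinTwist φ ρ 𝓔) ∧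
    ∀ (ε : ρ.coeffField →ₐ[F] Es) (α : Module.Basis (Fin ρ.degree) F ρ.coeffField),
      (∃ u, ρ.IsFundamentalSolution ε α u) ∧
      ∀ u, ρ.IsFundamentalSolution ε α u →
        IsUnit (frobeniusMatrix F u).det ∧
        ∃ 𝓔 : AndersonModule F P.regularOutside E (n * ρ.degree), IsArtinTwist φ ρ 𝓔 ∧
          ∀ a : P.regularOutside,
            (𝓔.toAlgHom a).map (TwistedPolynomial.map (IsScalarTower.toAlgHom F E Es))
              = ((frobeniusMatrix F u).transpose⁻¹)⁻¹.map (TwistedPolynomial.C F)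
                * (AndersonModule.powMatrix φ (n * ρ.degree) a).map
                    (TwistedPolynomial.map (IsScalarTower.toAlgHom F E Es))
                * ((frobeniusMatrix F u).transpose⁻¹).map (TwistedPolynomial.C F) := by
  have : Infinite K := IsCurveFunctionField.infinite F K
  have : Infinite E := Infinite.of_injective _ (algebraMap K E).injective
  have : IsGalois E Es := IsSepClosure.isGalois
  obtain ⟨v, hv⟩ := ρ.exists_isUnit_det (Module.finBasis F ρ.coeffField)
  -- An arbitrary basis of invariants suffices for existence and for the comparison of all Artin
  -- twists with `φ^{⊕N}`.
  let T := ρ.trivializedSpace (Module.finBasis F ρ.coeffField) v hv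
  refine ⟨fun 𝓔 h𝓔 => ?_, ⟨T.twist φ, T.twist_isIso φ⟩, fun ε α =>
    ⟨ρ.exists_isFundamentalSolution α ε, fun u hu => ?_⟩⟩
  · have h := T.isoPowOver_of_isIso φ h𝓔
    exact ⟨h, fun σ hσ => h.uniformizable_CInfty P σ hσ⟩
  · have hdet := ρ.isUnit_det_frobeniusMatrix α hu
    obtain ⟨w, hw⟩ := ρ.exists_coord_eq_frobeniusMatrix α hu
    have hw' : IsUnit (Matrix.of fun i j => ρ.coord α (w i) j).det := by
      rwa [hw, Matrix.det_transpose]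
    -- For the explicit formula the basis consists of the Frobenius iterates of the solution, so
    -- that `B` is the transposed Moore matrix and `P = B⁻¹`.
    let T' := ρ.trivializedSpace α w hw'
    refine ⟨hdet, T'.twist φ, T'.twist_isIso φ, fun a => ?_⟩
    have h := T'.twistMatrix_map φ a
    rw [ρ.trivializedSpace_matrix, hw] at h
    rw [Matrix.nonsing_inv_nonsing_inv _ (by rwa [Matrix.det_transpose])]
    exact h
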